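/- Consider a finite relational vocabulary that consists of three distinguished binary predicates $\leq$, $Pred$, $Pred2$ and finitely many further predicates of arbitrary arities. A $\mathbf{C}^2$ sentence is a sentence over this vocabulary, with equality and without constants or function symbols, that uses at most two variables and is built with the Boolean connectives, the quantifiers $\forall x$, $\exists x$ and the counting quantifiers $\exists^{\bowtie k}x$ with $\bowtie\,\in\{\leq,=,\geq\}$ and $k\in\mathbb{N}$. For $n\geq 1$ let $\mathsf{HB}_n$ be the set of all ground atoms over the domain $\{1,\dots,n\}$; a possible world is a subset $\omega\subseteq\mathsf{HB}_n$. A possible world $\omega$ is a model of $\psi\wedge Linear(\leq,Pred,Pred2)$ if $\omega\models\psi$, the relation $\omega[\leq]$ is a (reflexive) linear order of the domain, $Pred(x,y)$ holds in $\omega$ if and only if $x$ is the immediate predecessor of $y$ in this order, and $Pred2(x,y)$ holds in $\omega$ if and only if there is $z$ such that $Pred(x,z)$ and $Pred(z,y)$ hold in $\omega$. For weightings $w,\overline{w}$, which assign a number to each predicate, and with $\mathsf{pred}(a)$ the predicate of the atom $a$, put $$\mathsf{WFOMC}(\phi,n,w,\overline{w})=\sum_{\omega\subseteq\mathsf{HB}_n:\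 \omega\models\phi}\ \prod_{a\in\omega}w(\mathsf{pred}(a))\prod_{a\in\mathsf{HB}_n\setminus\omega}\overline{w}(\mathsf{pred}(a)).$$ **Theorem.** For every $\mathbf{C}^2$ sentence $\psi$, the number $\mathsf{WFOMC}(\psi\wedge Linear(\leq,Pred,Pred2),n,w,\overline{w})$ can be computed in time polynomial in $n$. Precisely: for every $\psi$ there are a random access program $A$ and polynomials $p,q$ with coefficients in $\mathbb{N}$, depending only on $\psi$, such that for every $n\geq 1$: 1. for all real weightings $w,\overline{w}$, the program $A$, started on input $(n,w,\overline{w})$, halts at cost at most $p(n)$ with output $\mathsf{WFOMC}(\psi\wedge Linear(\leq,Pred,Pred2),n,w,\overline{w})$, where each arithmetic operation on real numbers costs one unit; 2. for all rational weightings $w,\overline{w}$, the same program halts with the same output at cost at most $q(n+s)$, where $s$ is the total bit length of the weights and each arithmetic operation on rational numbers is charged with the bit lengths of the numbers involved (the bit cost). Here a random access program is a program, built from assignments, sequential composition, conditionals and while loops, over an indirectly addressable memory of natural numbers (with operations $+$, truncated $-$, $\cdot$, integer division and remainder, always charged with the bit lengths of the numbers involved) and an indirectly addressable memory of field elements (with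 rational constants and the operations $+,-,\cdot,/$); conditions test natural numbers only. -/

import Mathlib

/-! ## The two-variable fragment with counting quantifiers -/

/-- The comparison `⋈` of a counting quantifier: one of `≤`, `=`, `≥`. -/
inductive Cmp where
  | le
  | eq
  | ge

/-- `c.Holds a k` is `a ⋈ k`. -/
def Cmp.Holds : Cmp → ℕ → ℕ → Prop
  | .le, a, k => a ≤ k
  | .eq, a, k => a = k
  | .ge, a, k => k ≤ a

/-- Formulas with counting quantifiers, with equality, without constants and function symbols,
in the two variables `0` and `1` (which may be requantified), over predicates `P` whose arities
are given by `ar`. Further connectives are the usual abbreviations. -/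
inductive C2Formula {P : Type} (ar : P → ℕ) : Type where
  | atom (p : P) (t : Fin (ar p) → Fin 2)
  | equal (x y : Fin 2)
  | neg (φ : C2Formula ar)
  | and (φ χ : C2Formula ar)
  | or (φ χ : C2Formula ar)
  | all (x : Fin 2) (φ : C2Formula ar)
  | ex (x : Fin 2) (φ : C2Formula ar)
  | count (c : Cmp) (k : ℕ) (x : Fin 2) (φ : C2Formula ar)

/-- Ground atoms over the domain `Fin n`, i.e. the Herbrand base. -/
abbrev GroundAtom {P : Type} (ar : P → ℕ) (n : ℕ) : Type := Σ p : P, (Fin (ar p) → Fin n)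

/-- A possible world: a set of ground atoms (those that are true in it). -/
abbrev World {P : Type} (ar : P → ℕ) (n : ℕ) : Type := Finset (GroundAtom ar n)

namespace C2Formula

variable {P : Type} {ar : P → ℕ}

/-- The set of free variables. -/
def free : C2Formula ar → Set (Fin 2)
  | .atom _ t => Set.range t
  | .equal x y => {x, y}
  | .neg φ => φ.free
  | .and φ χ => φ.free ∪ χ.free
  | .or φ χ => φ.free ∪ χ.free
  | .all x φ => φ.free \ {x}
  | .ex x φ => φ.free \ {x}
  | .count _ _ x φ => φ.free \ {x}

/-- A sentence has no free variables. -/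
def IsSentence (φ : C2Formula ar) : Prop := φ.free = ∅

/-- Truth of a formula in a possible world under an assignment of the two variables. -/
def Sat {n : ℕ} (ω : World ar n) : C2Formula ar → (Fin 2 → Fin n) → Prop
  | .atom p t, v => (⟨p, fun i => v (t i)⟩ : GroundAtom ar n) ∈ ω
  | .equal x y, v => v x = v y
  | .neg φ, v => ¬ φ.Sat ω v
  | .and φ χ, v => φ.Sat ω v ∧ χ.Sat ω v
  | .or φ χ, v => φ.Sat ω v ∨ χ.Sat ω v
  | .all x φ, v => ∀ d : Fin n, φ.Sat ω (Function.update v x d)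
  | .ex x φ, v => ∃ d : Fin n, φ.Sat ω (Function.update v x d)
  | .count c k x φ, v => c.Holds {d : Fin n | φ.Sat ω (Function.update v x d)}.ncard k

/-- `ω` is a model of `φ`. For a sentence over a nonempty domain the assignment is irrelevant. -/
def IsModel {n : ℕ} (ω : World ar n) (φ : C2Formula ar) : Prop := ∀ v, φ.Sat ω v

end C2Formula

/-! ## Weighted first-order model counting -/

open Classical in
/-- Weighted first-order model counting over the domain `Fin n` with positive weights `w` and
negative weights `wbar`; `M` says which possible worlds are the models. -/
noncomputable def WFOMC {P : Type} [Fintype P] (ar : P → ℕ) {K : Type} [Field K] (n : ℕ)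
    (M : World ar n → Prop) (w wbar : P → K) : K :=
  ∑ ω : World ar n with M ω, (∏ a ∈ ω, w a.1) * ∏ a ∈ ωᶜ, wbar a.1

/-! ## Linear order, predecessor, predecessor of the predecessor -/

/-- Predicate symbols: three special binary ones (`≤`, `Pred`, `Pred2`) and `m` further ones. -/
inductive PredSym (m : ℕ) : Type where
  | le
  | pred
  | pred2
  | other (i : Fin m)

namespace PredSym

variable {m : ℕ}

/-- The special symbols are binary, the other arities are given by `ar`. -/
def arity (ar : Fin m → ℕ) : PredSym m → ℕ
  | .le => 2
  | .pred => 2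
  | .pred2 => 2
  | .other i => ar i

/-- Numbering of the symbols. -/
def equivFin : PredSym m ≃ Fin (3 + m) where
  toFun
    | .le => Fin.castAdd m 0
    | .pred => Fin.castAdd m 1
    | .pred2 => Fin.castAdd m 2
    | .other i => Fin.natAdd 3 i
  invFun := Fin.addCases ![.le, .pred, .pred2] .other
  left_inv s := by
    cases s with
    | le => exact Fin.addCases_left (0 : Fin 3)
    | pred => exact Fin.addCases_left (1 : Fin 3)
    | pred2 => exact Fin.addCases_left (2 : Fin 3)
    | other i => exact Fin.addCases_right i
  right_inv i := by
    refine Fin.addCases (fun j => ?_) (fun j => ?_) i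
    · fin_cases j <;> rfl
    · simp

instance : Fintype (PredSym m) := Fintype.ofEquiv _ equivFin.symm

end PredSym

section LinearOrder

variable {m : ℕ} {ar : Fin m → ℕ} {n : ℕ}

/-- `x ≤ y` holds in `ω`. -/
def World.Le (ω : World (PredSym.arity ar) n) (x y : Fin n) : Prop :=
  (⟨.le, (![x, y] : Fin 2 → Fin n)⟩ : GroundAtom (PredSym.arity ar) n) ∈ ω

/-- `Pred(x, y)` holds in `ω`. -/
def World.Pred (ω : World (PredSym.arity ar) n) (x y : Fin n) : Prop :=
  (⟨.pred, (![x, y] : Fin 2 → Fin n)⟩ : GroundAtom (PredSym.arity ar) n) ∈ ω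

/-- `Pred2(x, y)` holds in `ω`. -/
def World.Pred2 (ω : World (PredSym.arity ar) n) (x y : Fin n) : Prop :=
  (⟨.pred2, (![x, y] : Fin 2 → Fin n)⟩ : GroundAtom (PredSym.arity ar) n) ∈ ω

/-- `x < y` in `ω`, i.e. `x ≤ y` and not `y ≤ x`. -/
def World.Lt (ω : World (PredSym.arity ar) n) (x y : Fin n) : Prop := World.Le ω x y ∧ ¬ World.Le ω y x

/-- `Linear(≤, Pred, Pred2)`: `≤` is a linear order of the domain, `Pred(x, y)` holds exactly if
`x` is the immediate predecessor of `y` in it, and `Pred2(x, y)` holds exactly if `x` is the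
immediate predecessor of the immediate predecessor of `y`. -/
structure World.Linear (ω : World (PredSym.arity ar) n) : Prop where
  refl : ∀ x, World.Le ω x x
  total : ∀ x y, World.Le ω x y ∨ World.Le ω y x
  antisymm : ∀ x y, World.Le ω x y → World.Le ω y x → x = y
  trans : ∀ x y z, World.Le ω x y → World.Le ω y z → World.Le ω x z
  pred_iff : ∀ x y, World.Pred ω x y ↔
    World.Lt ω x y ∧ ¬ ∃ z, World.Lt ω x z ∧ World.Lt ω z y
  pred2_iff : ∀ x y, World.Pred2 ω x y ↔ ∃ z, World.Pred ω x z ∧ World.Pred ω z y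

/-- `ω` is a model of `ψ ∧ Linear(≤, Pred, Pred2)`. -/
def World.IsLinearModel (ψ : C2Formula (PredSym.arity ar)) (ω : World (PredSym.arity ar) n) : Prop :=
  ψ.IsModel ω ∧ World.Linear ω

end LinearOrder

/-! ## Random access programs

A machine has two memories indexed by natural numbers: one of natural numbers (for counters,
addresses and control) and one of elements of a field `K` (for weights). Both can be addressed
indirectly. Field elements are only combined by field operations; control never depends on them.
Operations on natural numbers are charged with the number of bits involved. The charge for
operations on field elements is determined by a size function `sz : K → ℕ`: with `sz = 0` each
costs one unit (exact arithmetic in `K`), and with the bit length it is the bit cost. -/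

/-- A memory state. -/
structure Mem (K : Type) where
  nat : ℕ → ℕ
  val : ℕ → K

/-- Expressions for natural numbers; `mem a` is the content of the cell with address `a`, and
`sub` is truncated at zero. -/
inductive NExpr where
  | lit (c : ℕ)
  | mem (a : NExpr)
  | add (a b : NExpr)
  | sub (a b : NExpr)
  | mul (a b : NExpr)
  | div (a b : NExpr)
  | mod (a b : NExpr)

namespace NExpr

/-- The value of an expression. -/
def eval (s : ℕ → ℕ) : NExpr → ℕ
  | .lit c => c
  | .mem a => s (a.eval s)
  | .add a b => a.eval s + b.eval s
  | .sub a b => a.eval s - b.eval s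
  | .mul a b => a.eval s * b.eval s
  | .div a b => a.eval s / b.eval s
  | .mod a b => a.eval s % b.eval s

/-- The cost of evaluation: each node costs one plus the bit length of its value. -/
def cost (s : ℕ → ℕ) : NExpr → ℕ
  | .lit c => 1 + Nat.size c
  | .mem a => a.cost s + (1 + Nat.size (s (a.eval s)))
  | .add a b => a.cost s + b.cost s + (1 + Nat.size (a.eval s + b.eval s))
  | .sub a b => a.cost s + b.cost s + (1 + Nat.size (a.eval s - b.eval s))
  | .mul a b => a.cost s + b.cost s + (1 + Nat.size (a.eval s * b.eval s))
  | .div a b => a.cost s + b.cost s + (1 + Nat.size (a.eval s / b.eval s))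
  | .mod a b => a.cost s + b.cost s + (1 + Nat.size (a.eval s % b.eval s))

end NExpr

/-- Expressions for field elements, with rational constants; division by zero gives zero. -/
inductive FExpr where
  | const (q : ℚ)
  | mem (a : NExpr)
  | add (a b : FExpr)
  | sub (a b : FExpr)
  | mul (a b : FExpr)
  | div (a b : FExpr)

namespace FExpr

variable {K : Type} [Field K]

/-- The value of an expression. -/
def eval (s : Mem K) : FExpr → K
  | .const q => (q : K)
  | .mem a => s.val (a.eval s.nat)
  | .add a b => a.eval s + b.eval s
  | .sub a b => a.eval s - b.eval s
  | .mul a b => a.eval s * b.eval s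
  | .div a b => a.eval s / b.eval s

/-- The cost of evaluation: each node costs one plus the size of its value, and an access to the
memory also costs the evaluation of the address. -/
def cost (sz : K → ℕ) (s : Mem K) : FExpr → ℕ
  | .const q => 1 + sz (q : K)
  | .mem a => a.cost s.nat + (1 + sz (s.val (a.eval s.nat)))
  | .add a b => a.cost sz s + b.cost sz s + (1 + sz (a.eval s + b.eval s))
  | .sub a b => a.cost sz s + b.cost sz s + (1 + sz (a.eval s - b.eval s))
  | .mul a b => a.cost sz s + b.cost sz s + (1 + sz (a.eval s * b.eval s))
  | .div a b => a.cost sz s + b.cost sz s + (1 + sz (a.eval s / b.eval s))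

end FExpr

/-- Programs; a condition `c` counts as true if its value is not zero. -/
inductive Prog where
  | skip
  | setNat (a e : NExpr)
  | setVal (a : NExpr) (e : FExpr)
  | seq (p q : Prog)
  | ite (c : NExpr) (p q : Prog)
  | loop (c : NExpr) (p : Prog)

/-- `Prog.Run sz p s t s'`: program `p`, started in memory state `s`, halts in state `s'` after
computing at total cost `t`. -/
inductive Prog.Run {K : Type} [Field K] (sz : K → ℕ) : Prog → Mem K → ℕ → Mem K → Prop where
  | skip (s : Mem K) : Run sz .skip s 1 s
  | setNat (a e : NExpr) (s : Mem K) :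
      Run sz (.setNat a e) s (1 + a.cost s.nat + e.cost s.nat)
        { s with nat := Function.update s.nat (a.eval s.nat) (e.eval s.nat) }
  | setVal (a : NExpr) (e : FExpr) (s : Mem K) :
      Run sz (.setVal a e) s (1 + a.cost s.nat + e.cost sz s)
        { s with val := Function.update s.val (a.eval s.nat) (e.eval s) }
  | seq {p q : Prog} {s s' s'' : Mem K} {t t' : ℕ} :
      Run sz p s t s' → Run sz q s' t' s'' → Run sz (.seq p q) s (t + t') s''
  | ite_true {c : NExpr} {p q : Prog} {s s' : Mem K} {t : ℕ} :
      c.eval s.nat ≠ 0 → Run sz p s t s' → Run sz (.ite c p q) s (1 + c.cost s.nat + t) s'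
  | ite_false {c : NExpr} {p q : Prog} {s s' : Mem K} {t : ℕ} :
      c.eval s.nat = 0 → Run sz q s t s' → Run sz (.ite c p q) s (1 + c.cost s.nat + t) s'
  | loop_true {c : NExpr} {p : Prog} {s s' s'' : Mem K} {t t' : ℕ} :
      c.eval s.nat ≠ 0 → Run sz p s t s' → Run sz (.loop c p) s' t' s'' →
        Run sz (.loop c p) s (1 + c.cost s.nat + t + t') s''
  | loop_false {c : NExpr} {p : Prog} {s : Mem K} :
      c.eval s.nat = 0 → Run sz (.loop c p) s (1 + c.cost s.nat) s

/-- The initial memory on input `n, w, wbar`: the natural number cell `0` contains `n`, the field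
cells `2 * i` and `2 * i + 1` contain the positive and the negative weight of the symbol number
`i`, and all other cells contain zero. -/
def Mem.input {m : ℕ} {K : Type} [Field K] (n : ℕ) (w wbar : PredSym m → K) : Mem K where
  nat a := if a = 0 then n else 0
  val a :=
    if h : a / 2 < 3 + m then
      (if a % 2 = 0 then w else wbar) (PredSym.equivFin.symm ⟨a / 2, h⟩)
    else 0

/-- Started on input `n, w, wbar`, the program `A` halts at cost at most `T` with the value `r` in
field cell `0`. -/
def Prog.Outputs {m : ℕ} {K : Type} [Field K] (sz : K → ℕ) (A : Prog) (n : ℕ)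
    (w wbar : PredSym m → K) (r : K) (T : ℕ) : Prop :=
  ∃ (t : ℕ) (s : Mem K), t ≤ T ∧ Prog.Run sz A (Mem.input n w wbar) t s ∧ s.val 0 = r

/-- The size that makes every operation on field elements cost one unit. -/
def unitSize (_ : ℝ) : ℕ := 0

/-- The bit length of a rational number: that of numerator and denominator in lowest terms. -/
def bitSize (q : ℚ) : ℕ := Nat.size q.num.natAbs + Nat.size q.den

/-- The total bit length of a pair of rational weightings. -/
def weightBits {m : ℕ} (w wbar : PredSym m → ℚ) : ℕ := ∑ p, (bitSize (w p) + bitSize (wbar p))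

/-! ## Polynomial bounds -/

/-! Permutations of the domain act simply transitively on its linear orders. The count is therefore
`n!` times the weighted count of the models with the standard order (`wfomc_eq_factorial_mul`), and
such models can be built by adding the elements in increasing order.

Truth of a two-variable formula is local. A quantified subformula depends on one variable at most,
so its truth values form a unary predicate, its bits. Bits that satisfy the counting condition of
every quantified subformula are the truth values (`C2Formula.consistent_iff`). They are thus unique,
and summing over all guesses of bits counts each model once (`C2Formula.sum_bits_eq`). Each
condition depends only on a count capped at a constant (`C2Formula.qcond_min`). Atoms that mention
three or more elements are unconstrained and contribute powers of `w + wbar` (`sum_prod_rest`);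
nullary atoms are fixed in advance.

While the structure grows, an old element is described by its cell: unary atoms, bits, capped
counts, and the distance to the newest element capped at two. The distance determines what `Pred`
and `Pred2` must say about this element and the next new one (`std_joinWorld_iff`). There are
finitely many cells, and the order in which a new element meets the old ones is irrelevant
(`Growth.outer_perm`), so only the number of elements in each cell matters. This leaves polynomially
many configurations. A counter automaton with two banks of counters performs the growth
(`runVal_outer`), and its weighted runs are tabulated by dynamic programming (`autoRules_isTable`,
`fillProg_leads`).

The recursion of the table is linear: each summand contains a single earlier entry. Levels in the
sense of `SizeModel` hence grow linearly with the index (`IsTable.good`). For rational numbers a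
level bounds the exponent of a common denominator and the magnitude (`bitModel`), for unit cost it
is void (`unitModel`), so one analysis of one program covers both cost measures. -/

theorem Polynomial.eval_mono_nat (p : Polynomial ℕ) {x y : ℕ} (h : x ≤ y) : p.eval x ≤ p.eval y := by
  induction p using Polynomial.induction_on' with
  | add p q hp hq => simpa using Nat.add_le_add hp hq
  | monomial k a => simpa using Nat.mul_le_mul_left a (Nat.pow_le_pow_left h k)

/-- Bit lengths are estimated by the values themselves. This is enough because all counters and
addresses of the program stay polynomial in `n`. -/
theorem NExpr.exists_bound (e : NExpr) : ∃ p : Polynomial ℕ, ∀ (s : ℕ → ℕ) (B : ℕ), (∀ a, s a ≤ B) →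
    e.eval s ≤ p.eval B ∧ e.cost s ≤ p.eval B := by
  have hsz : ∀ x : ℕ, Nat.size x ≤ x := fun x => Nat.size_le.2 Nat.lt_two_pow_self
  induction e with
  | lit c =>
    refine ⟨Polynomial.C (1 + c), fun s B _ => ?_⟩
    have := hsz c
    simp only [eval, cost, Polynomial.eval_C]
    omega
  | mem a ih =>
    obtain ⟨p, hp⟩ := ih
    refine ⟨p + Polynomial.X + 1, fun s B h => ?_⟩
    have h1 := hp s B h
    have h2 := h (a.eval s)
    have h3 := hsz (s (a.eval s))
    simp only [eval, cost, Polynomial.eval_add, Polynomial.eval_X, Polynomial.eval_one]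
    omega
  | add a b iha ihb =>
    obtain ⟨p, hp⟩ := iha
    obtain ⟨q, hq⟩ := ihb
    refine ⟨p + p + q + q + 1, fun s B h => ?_⟩
    have h1 := hp s B h
    have h2 := hq s B h
    have h3 := hsz (a.eval s + b.eval s)
    simp only [eval, cost, Polynomial.eval_add, Polynomial.eval_one]
    omega
  | sub a b iha ihb =>
    obtain ⟨p, hp⟩ := iha
    obtain ⟨q, hq⟩ := ihb
    refine ⟨p + p + q + q + 1, fun s B h => ?_⟩
    have h1 := hp s B h
    have h2 := hq s B h
    have h3 := hsz (a.eval s - b.eval s)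
    simp only [eval, cost, Polynomial.eval_add, Polynomial.eval_one]
    omega
  | mul a b iha ihb =>
    obtain ⟨p, hp⟩ := iha
    obtain ⟨q, hq⟩ := ihb
    refine ⟨p + q + p * q + 1, fun s B h => ?_⟩
    have h1 := hp s B h
    have h2 := hq s B h
    have h3 := hsz (a.eval s * b.eval s)
    have h4 := Nat.mul_le_mul h1.1 h2.1
    simp only [eval, cost, Polynomial.eval_add, Polynomial.eval_mul, Polynomial.eval_one]
    omega
  | div a b iha ihb =>
    obtain ⟨p, hp⟩ := iha
    obtain ⟨q, hq⟩ := ihb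
    refine ⟨p + p + q + q + 1, fun s B h => ?_⟩
    have h1 := hp s B h
    have h2 := hq s B h
    have h3 := hsz (a.eval s / b.eval s)
    have h4 := Nat.div_le_self (a.eval s) (b.eval s)
    simp only [eval, cost, Polynomial.eval_add, Polynomial.eval_one]
    omega
  | mod a b iha ihb =>
    obtain ⟨p, hp⟩ := iha
    obtain ⟨q, hq⟩ := ihb
    refine ⟨p + p + q + q + 1, fun s B h => ?_⟩
    have h1 := hp s B h
    have h2 := hq s B h
    have h3 := hsz (a.eval s % b.eval s)
    have h4 := Nat.mod_le (a.eval s) (b.eval s)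
    simp only [eval, cost, Polynomial.eval_add, Polynomial.eval_one]
    omega

/-! ## Levels of field elements

A `SizeModel` grades field elements by levels that grow slowly under sums and additively under
products, such that the size of an element is linear in its level. -/

structure SizeModel {K : Type} [Field K] (sz : K → ℕ) (S : ℕ) where
  Good : ℕ → K → Prop
  mono : ∀ {a b x}, a ≤ b → Good a x → Good b x
  zero : Good 0 0
  one : Good 0 1
  add : ∀ {a x y}, Good a x → Good a y → Good (a + 1) (x + y)
  mul : ∀ {a b x y}, Good a x → Good b y → Good (a + b) (x * y)
  size_le : ∀ {a x}, Good a x → sz x ≤ S * (a + 1)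

/-- Expressions built from `0`, `1`, memory accesses, sums and products. -/
inductive FExpr.Plain : FExpr → Prop where
  | zero : Plain (.const 0)
  | one : Plain (.const 1)
  | mem (a : NExpr) : Plain (.mem a)
  | add {a b : FExpr} : Plain a → Plain b → Plain (.add a b)
  | mul {a b : FExpr} : Plain a → Plain b → Plain (.mul a b)

/-- Without subtraction and division, levels only accumulate along the expression. Constant and
polynomial are chosen before the field and the size model, so that they serve all cost measures. -/
theorem FExpr.Plain.exists_bound {e : FExpr} (he : e.Plain) :
    ∃ (d : ℕ) (p : Polynomial ℕ), 1 ≤ d ∧ ∀ {K : Type} [Field K] {sz : K → ℕ} {S : ℕ}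
      (M : SizeModel sz S) (s : Mem K) (B L : ℕ), (∀ a, s.nat a ≤ B) → (∀ a, M.Good L (s.val a)) →
      M.Good (d * (L + 1)) (e.eval s) ∧ e.cost sz s ≤ p.eval (B + S + L) := by
  have key : ∀ (d : ℕ) {K : Type} [Field K] {sz : K → ℕ} {S : ℕ} (M : SizeModel sz S) (x : K)
      (B L : ℕ), M.Good (d * (L + 1)) x →
      sz x ≤ (Polynomial.X * (Polynomial.C d * (Polynomial.X + 1) + 1) : Polynomial ℕ).eval
        (B + S + L) := by
    intro d K _ sz S M x B L h
    refine (M.size_le h).trans ?_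
    simp only [Polynomial.eval_mul, Polynomial.eval_add, Polynomial.eval_X, Polynomial.eval_C,
      Polynomial.eval_one]
    gcongr <;> omega
  induction he with
  | zero =>
    refine ⟨1, Polynomial.X * (Polynomial.C 1 * (Polynomial.X + 1) + 1) + 1, le_rfl,
      fun {K} _ {sz S} M s B L _ _ => ?_⟩
    have h : M.Good (1 * (L + 1)) (((0 : ℚ) : K)) := by
      simpa using M.mono (Nat.zero_le _) M.zero
    have h2 := key 1 M _ B L h
    refine ⟨h, ?_⟩
    rw [Polynomial.eval_add, Polynomial.eval_one]
    simp only [cost]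
    omega
  | one =>
    refine ⟨1, Polynomial.X * (Polynomial.C 1 * (Polynomial.X + 1) + 1) + 1, le_rfl,
      fun {K} _ {sz S} M s B L _ _ => ?_⟩
    have h : M.Good (1 * (L + 1)) (((1 : ℚ) : K)) := by
      simpa using M.mono (Nat.zero_le _) M.one
    have h2 := key 1 M _ B L h
    refine ⟨h, ?_⟩
    rw [Polynomial.eval_add, Polynomial.eval_one]
    simp only [cost]
    omega
  | mem a =>
    obtain ⟨q, hq⟩ := a.exists_bound
    refine ⟨1, Polynomial.X * (Polynomial.C 1 * (Polynomial.X + 1) + 1) + 1 + q, le_rfl,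
      fun {K} _ {sz S} M s B L hB hL => ?_⟩
    have h : M.Good (1 * (L + 1)) (s.val (a.eval s.nat)) := M.mono (by omega) (hL _)
    have h2 := key 1 M _ B L h
    have h3 := (hq s.nat B hB).2.trans (q.eval_mono_nat (show B ≤ B + S + L by omega))
    refine ⟨h, ?_⟩
    rw [Polynomial.eval_add, Polynomial.eval_add, Polynomial.eval_one]
    simp only [cost]
    omega
  | @add a b _ _ iha ihb =>
    obtain ⟨d, p, hd, hp⟩ := iha
    obtain ⟨d', p', hd', hp'⟩ := ihb
    refine ⟨d + d', p + p' + Polynomial.X * (Polynomial.C (d + d') * (Polynomial.X + 1) + 1) + 1,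
      by omega, fun {K} _ {sz S} M s B L hB hL => ?_⟩
    obtain ⟨h1, h2⟩ := hp M s B L hB hL
    obtain ⟨h1', h2'⟩ := hp' M s B L hB hL
    -- A sum raises the level by one; the share of the other summand, at least one because of `1 ≤
    -- d'`, pays for this.
    have e1 : d * (L + 1) ≤ (d + d') * (L + 1) - 1 := by
      have : 1 * (L + 1) ≤ d' * (L + 1) := Nat.mul_le_mul_right _ hd'
      rw [Nat.add_mul]; omega
    have e2 : d' * (L + 1) ≤ (d + d') * (L + 1) - 1 := by
      have : 1 * (L + 1) ≤ d * (L + 1) := Nat.mul_le_mul_right _ hd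
      rw [Nat.add_mul]; omega
    have h : M.Good ((d + d') * (L + 1)) (a.eval s + b.eval s) := by
      refine M.mono ?_ (M.add (M.mono e1 h1) (M.mono e2 h1'))
      have : 1 * 1 ≤ (d + d') * (L + 1) := Nat.mul_le_mul (by omega) (by omega)
      omega
    have h3 := key _ M _ B L h
    refine ⟨h, ?_⟩
    rw [Polynomial.eval_add, Polynomial.eval_add, Polynomial.eval_add, Polynomial.eval_one]
    simp only [cost]
    omega
  | @mul a b _ _ iha ihb =>
    obtain ⟨d, p, hd, hp⟩ := iha
    obtain ⟨d', p', hd', hp'⟩ := ihb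
    refine ⟨d + d', p + p' + Polynomial.X * (Polynomial.C (d + d') * (Polynomial.X + 1) + 1) + 1,
      by omega, fun {K} _ {sz S} M s B L hB hL => ?_⟩
    obtain ⟨h1, h2⟩ := hp M s B L hB hL
    obtain ⟨h1', h2'⟩ := hp' M s B L hB hL
    have h : M.Good ((d + d') * (L + 1)) (a.eval s * b.eval s) := by
      rw [Nat.add_mul]
      exact M.mul h1 h1'
    have h3 := key _ M _ B L h
    refine ⟨h, ?_⟩
    rw [Polynomial.eval_add, Polynomial.eval_add, Polynomial.eval_add, Polynomial.eval_one]
    simp only [cost]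
    omega

/-! ## Programs whose number memory holds an input and one counter -/

/-- The number memory with `n` in cell `0` and `x` in cell `1`. -/
def natMem (n x : ℕ) : ℕ → ℕ := fun a => if a = 0 then n else if a = 1 then x else 0

theorem natMem_le (n x a : ℕ) : natMem n x a ≤ n + x := by
  unfold natMem; split_ifs <;> omega

theorem natMem_update (n x y : ℕ) : Function.update (natMem n x) 1 y = natMem n y := by
  funext a
  by_cases h : a = 1 <;> simp [natMem, h, Function.update]

/-- `p` leads from counter `x` and field memory `v` to `x'` and `v'` at cost at most `T`. -/
def Prog.Leads {K : Type} [Field K] (sz : K → ℕ) (p : Prog) (n x : ℕ) (v : ℕ → K) (T : ℕ)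
    (x' : ℕ) (v' : ℕ → K) : Prop :=
  ∃ t ≤ T, Prog.Run sz p ⟨natMem n x, v⟩ t ⟨natMem n x', v'⟩

section Leads

variable {K : Type} [Field K] {sz : K → ℕ} {n : ℕ}

theorem Prog.Leads.seq {p q : Prog} {x x' x'' T T' : ℕ} {v v' v'' : ℕ → K}
    (h : p.Leads sz n x v T x' v') (h' : q.Leads sz n x' v' T' x'' v'') :
    (Prog.seq p q).Leads sz n x v (T + T') x'' v'' := by
  obtain ⟨t, ht, hr⟩ := h
  obtain ⟨t', ht', hr'⟩ := h'
  exact ⟨t + t', by omega, .seq hr hr'⟩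

theorem Prog.Leads.mono {p : Prog} {x x' T T' : ℕ} {v v' : ℕ → K}
    (h : p.Leads sz n x v T x' v') (hT : T ≤ T') : p.Leads sz n x v T' x' v' := by
  obtain ⟨t, ht, hr⟩ := h
  exact ⟨t, ht.trans hT, hr⟩

theorem Prog.leads_setNat (e : NExpr) {x T : ℕ} {v : ℕ → K} (hT : e.cost (natMem n x) ≤ T) :
    (Prog.setNat (.lit 1) e).Leads sz n x v (T + 3) (e.eval (natMem n x)) v := by
  have := Prog.Run.setNat (sz := sz) (.lit 1) e ⟨natMem n x, v⟩
  simp only [NExpr.eval, natMem_update] at this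
  refine ⟨_, ?_, this⟩
  simp [NExpr.cost]
  omega

theorem Prog.leads_setVal (a : NExpr) (e : FExpr) {x T T' : ℕ} {v : ℕ → K}
    (hT : a.cost (natMem n x) ≤ T) (hT' : e.cost sz ⟨natMem n x, v⟩ ≤ T') :
    (Prog.setVal a e).Leads sz n x v (T + T' + 1) x
      (Function.update v (a.eval (natMem n x)) (e.eval ⟨natMem n x, v⟩)) :=
  ⟨_, by simp only; omega, Prog.Run.setVal (sz := sz) a e ⟨natMem n x, v⟩⟩

/-- `x i` and `v i` describe the memory after `i` rounds. The factor `N + 1` includes the last test,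
which fails. -/
theorem Prog.leads_loop {c : NExpr} {p : Prog} (N : ℕ) (x : ℕ → ℕ) (v : ℕ → ℕ → K) {T T' : ℕ}
    (hc : ∀ i ≤ N, c.cost (natMem n (x i)) ≤ T)
    (hstep : ∀ i < N, c.eval (natMem n (x i)) ≠ 0 ∧
      p.Leads sz n (x i) (v i) T' (x (i + 1)) (v (i + 1)))
    (hend : c.eval (natMem n (x N)) = 0) :
    (Prog.loop c p).Leads sz n (x 0) (v 0) ((N + 1) * (T + T' + 1)) (x N) (v N) := by
  -- A run of a loop is peeled off at its front, so the induction is on the number `k` of remaining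
  -- rounds.
  have : ∀ k i, i + k = N →
      (Prog.loop c p).Leads sz n (x i) (v i) ((k + 1) * (T + T' + 1)) (x N) (v N) := by
    intro k
    induction k with
    | zero =>
      intro i hi
      obtain rfl : i = N := by omega
      have := hc i le_rfl
      exact ⟨_, by simp only; omega, Prog.Run.loop_false hend⟩
    | succ k ih =>
      intro i hi
      obtain ⟨h1, t, ht, hr⟩ := hstep i (by omega)
      obtain ⟨t', ht', hr'⟩ := ih (i + 1) (by omega)
      have := hc i (by omega)
      refine ⟨_, ?_, Prog.Run.loop_true h1 hr hr'⟩
      rw [Nat.add_mul (k + 1) 1]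
      simp only
      omega
  exact this N 0 (by omega)

end Leads

/-! ## A program that fills a table -/

/-- A weight: zero or a product of input cells. -/
abbrev Wt (Z : ℕ) : Type := Option (List (Fin Z))

namespace Wt

variable {Z : ℕ} {K : Type} [Field K]

/-- The value of a weight. -/
def val (inp : ℕ → K) : Wt Z → K
  | none => 0
  | some l => (l.map fun a : Fin Z => inp a).prod

/-- An expression for the value of a weight. -/
def expr : Wt Z → FExpr
  | none => .const 0
  | some l => l.foldr (fun (a : Fin Z) e => .mul (.mem (.lit a)) e) (.const 1)

/-- The number of factors. -/
def len : Wt Z → ℕ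
  | none => 0
  | some l => l.length

theorem plain_expr (u : Wt Z) : u.expr.Plain := by
  cases u with
  | none => exact .zero
  | some l =>
    induction l with
    | nil => exact .one
    | cons a l ih => exact .mul (.mem _) ih

theorem eval_expr (u : Wt Z) (s : Mem K) (inp : ℕ → K) (h : ∀ a < Z, s.val a = inp a) :
    u.expr.eval s = u.val inp := by
  cases u with
  | none => simp [expr, val, FExpr.eval]
  | some l =>
    induction l with
    | nil => simp [expr, val, FExpr.eval]
    | cons a l ih =>
      simp only [expr, val, List.foldr_cons, FExpr.eval, NExpr.eval, List.map_cons,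
        List.prod_cons] at ih ⊢
      rw [ih, h a a.2]

theorem good_val {sz : K → ℕ} {S : ℕ} (M : SizeModel sz S) (u : Wt Z) (inp : ℕ → K)
    (h : ∀ a < Z, M.Good 1 (inp a)) : M.Good u.len (u.val inp) := by
  cases u with
  | none => exact M.zero
  | some l =>
    induction l with
    | nil => exact M.one
    | cons a l ih =>
      simp only [len, val, List.length_cons, List.map_cons, List.prod_cons] at ih ⊢
      rw [add_comm]
      exact M.mul (h a a.2) ih

end Wt

section Table

variable {Z : ℕ} {K : Type} [Field K]

/-- A weighted sum of table entries; the table begins at cell `Z`. -/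
def sumExpr (l : List (Wt Z × NExpr)) : FExpr :=
  l.foldr (fun r e => .add (.mul r.1.expr (.mem (.add (.lit Z) r.2))) e) (.const 0)

/-- The value of a weighted sum of table entries. -/
def sumVal (l : List (Wt Z × NExpr)) (inp tab : ℕ → K) (s : ℕ → ℕ) : K :=
  (l.map fun r => r.1.val inp * tab (r.2.eval s)).sum

theorem plain_sumExpr (l : List (Wt Z × NExpr)) : (sumExpr l).Plain := by
  induction l with
  | nil => exact .zero
  | cons r l ih => exact .add (.mul r.1.plain_expr (.mem _)) ih

/-- The field memory: inputs, a result, a factor, and the first entries of the table. -/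
def tabMem (Z : ℕ) (inp tab : ℕ → K) (r f : K) (x : ℕ) : ℕ → K := fun a =>
  if a < Z then inp a else if a = Z then r else if a = Z + 1 then f
  else if a < Z + 2 + x then tab (a - Z) else 0

/-- While the table is filled, the result cell holds `0` and the factor cell holds `1`. They double
as the entries `0` and `1` of the table, so that entry `y` always sits at address `Z + y`. -/
theorem eval_sumExpr (l : List (Wt Z × NExpr)) (s : ℕ → ℕ) (inp tab : ℕ → K) (x : ℕ)
    (h0 : tab 0 = 0) (h1 : tab 1 = 1) (hl : ∀ r ∈ l, r.2.eval s < x + 2) :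
    (sumExpr l).eval ⟨s, tabMem Z inp tab 0 1 x⟩ = sumVal l inp tab s := by
  induction l with
  | nil => simp [sumExpr, sumVal, FExpr.eval]
  | cons r l ih =>
    have ih := ih fun r hr => hl r (List.mem_cons_of_mem _ hr)
    have hr := hl r List.mem_cons_self
    simp only [sumExpr, sumVal, List.foldr_cons, FExpr.eval, NExpr.eval, List.map_cons,
      List.sum_cons] at ih ⊢
    rw [ih, r.1.eval_expr _ inp fun a ha => by simp [tabMem, ha]]
    congr 2
    generalize r.2.eval s = y at hr
    rcases y with - | - | y
    · simp [tabMem, h0]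
    · simp [tabMem, h1]
    · simp only [tabMem]
      rw [if_neg (by omega), if_neg (by omega), if_neg (by omega), if_pos (by omega)]
      congr 1
      omega

/-- A bound for the growth of levels in a weighted sum. -/
def sumLevel (l : List (Wt Z × NExpr)) : ℕ := (l.map fun r => r.1.len + 1).sum

/-- Each product contains only one table entry, so the level `L` enters once and the rest of the
growth is a constant of the list. -/
theorem good_sumVal {sz : K → ℕ} {S : ℕ} (M : SizeModel sz S) (l : List (Wt Z × NExpr))
    (s : ℕ → ℕ) (inp tab : ℕ → K) (L : ℕ) (hi : ∀ a < Z, M.Good 1 (inp a))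
    (ht : ∀ r ∈ l, M.Good L (tab (r.2.eval s))) :
    M.Good (L + sumLevel l) (sumVal l inp tab s) := by
  induction l with
  | nil => exact M.mono (Nat.zero_le _) M.zero
  | cons r l ih =>
    have ih := ih fun r hr => ht r (List.mem_cons_of_mem _ hr)
    have hr := M.mul (r.1.good_val M inp hi) (ht r List.mem_cons_self)
    simp only [sumLevel, sumVal, List.map_cons, List.sum_cons] at ih ⊢
    refine M.mono ?_ (M.add (M.mono (b := L + r.1.len +
      (List.map (fun r => r.1.len + 1) l).sum) ?_ hr) (M.mono ?_ ih)) <;> omega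

theorem good_tabMem {sz : K → ℕ} {S : ℕ} (M : SizeModel sz S) {inp tab : ℕ → K} {r f : K} {x L : ℕ}
    (hi : ∀ a < Z, M.Good 1 (inp a)) (hL : 1 ≤ L) (hr : M.Good L r) (hf : M.Good L f)
    (ht : ∀ y < x + 2, M.Good L (tab y)) (a : ℕ) : M.Good L (tabMem Z inp tab r f x a) := by
  unfold tabMem
  split_ifs with h1 h2 h3 h4
  · exact M.mono hL (hi a h1)
  · exact hr
  · exact hf
  · exact ht _ (by omega)
  · exact M.mono (Nat.zero_le _) M.zero

/-- The entries of `tab` below `X + 2` satisfy the recursion given by `rules`. -/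
structure IsTable (rules : List (Wt Z × NExpr)) (n X : ℕ) (inp tab : ℕ → K) : Prop where
  zero : tab 0 = 0
  one : tab 1 = 1
  lt : ∀ x < X, ∀ r ∈ rules, r.2.eval (natMem n x) < x + 2
  eq : ∀ x < X, tab (x + 2) = sumVal rules inp tab (natMem n x)

/-- By linearity of the recursion an entry exceeds the level of its predecessors by a constant only.
Products of two entries would allow exponential growth instead. -/
theorem IsTable.good {rules : List (Wt Z × NExpr)} {n X : ℕ} {inp tab : ℕ → K}
    (h : IsTable rules n X inp tab) {sz : K → ℕ} {S : ℕ} (M : SizeModel sz S)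
    (hi : ∀ a < Z, M.Good 1 (inp a)) (x : ℕ) (hx : x < X + 2) :
    M.Good (sumLevel rules * x) (tab x) := by
  induction x using Nat.strong_induction_on with
  | _ x ih =>
    rcases x with - | - | x
    · rw [h.zero]; exact M.mono (Nat.zero_le _) M.zero
    · rw [h.one]; exact M.mono (Nat.zero_le _) M.one
    · rw [h.eq x (by omega)]
      refine M.mono ?_ (good_sumVal M rules (natMem n x) inp tab (sumLevel rules * (x + 1)) hi ?_)
      · rw [← Nat.mul_succ]
      · intro r hr
        have := h.lt x (by omega) r hr
        exact M.mono (Nat.mul_le_mul_left _ (by omega)) (ih _ this (by omega))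

/-- The program that fills the table. -/
def fillProg (rules : List (Wt Z × NExpr)) (X : NExpr) : Prog :=
  .loop (.sub X (.mem (.lit 1)))
    (.seq (.setVal (.add (.lit (Z + 2)) (.mem (.lit 1))) (sumExpr rules))
      (.setNat (.lit 1) (.add (.mem (.lit 1)) (.lit 1))))

theorem tabMem_update_table (inp tab : ℕ → K) (r f : K) (x : ℕ) :
    Function.update (tabMem Z inp tab r f x) (Z + 2 + x) (tab (x + 2)) =
      tabMem Z inp tab r f (x + 1) := by
  funext a
  by_cases h : a = Z + 2 + x
  · subst h
    have : Z + 2 + x - Z = x + 2 := by omega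
    rw [Function.update_self, tabMem, if_neg (by omega), if_neg (by omega), if_neg (by omega),
      if_pos (by omega), this]
  · rw [Function.update_of_ne h]
    unfold tabMem
    split_ifs <;> first | rfl | omega

theorem tabMem_update_result (inp tab : ℕ → K) (r r' f : K) (x : ℕ) :
    Function.update (tabMem Z inp tab r f x) Z r' = tabMem Z inp tab r' f x := by
  funext a
  by_cases h : a = Z
  · subst h; simp [tabMem]
  · rw [Function.update_of_ne h]; simp [tabMem, h]

theorem tabMem_update_factor (inp tab : ℕ → K) (r f f' : K) (x : ℕ) :
    Function.update (tabMem Z inp tab r f x) (Z + 1) f' = tabMem Z inp tab r f' x := by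
  funext a
  by_cases h : a = Z + 1
  · subst h; simp [tabMem]
  · rw [Function.update_of_ne h]; simp [tabMem, h]

theorem fillProg_leads (rules : List (Wt Z × NExpr)) (X : NExpr) (Xf : ℕ → ℕ)
    (hX : ∀ n x, X.eval (natMem n x) = Xf n) :
    ∃ P : Polynomial ℕ, ∀ {K : Type} [Field K] {sz : K → ℕ} {S : ℕ} (M : SizeModel sz S) (n : ℕ)
      (inp tab : ℕ → K), (∀ a < Z, M.Good 1 (inp a)) → IsTable rules n (Xf n) inp tab →
      (fillProg rules X).Leads sz n 0 (tabMem Z inp tab 0 1 0) (P.eval (n + S)) (Xf n)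
        (tabMem Z inp tab 0 1 (Xf n)) := by
  obtain ⟨pX, hpX⟩ := X.exists_bound
  obtain ⟨pc, hpc⟩ := (NExpr.sub X (.mem (.lit 1))).exists_bound
  obtain ⟨pa, hpa⟩ := (NExpr.add (.lit (Z + 2)) (.mem (.lit 1))).exists_bound
  obtain ⟨pi, hpi⟩ := (NExpr.add (.mem (.lit 1)) (.lit 1)).exists_bound
  obtain ⟨_, pE, -, hpE⟩ := (plain_sumExpr rules).exists_bound
  -- A majorant, in terms of `n + S`, of `n + Xf n + S + L`, on which the cost of a round depends.
  set b : Polynomial ℕ := Polynomial.X + pX + (Polynomial.C (sumLevel rules) * (pX + 2) + 1) with hb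
  refine ⟨(pX + 1) * (pc.comp b + (pa.comp b + pE.comp b + 1 + (pi.comp b + 3)) + 1), ?_⟩
  intro K _ sz S M n inp tab hi ht
  have hXn : Xf n ≤ pX.eval (n + S) := by
    have := (hpX (natMem n 0) n fun a => by simpa using natMem_le n 0 a).1
    rw [hX] at this
    exact this.trans (pX.eval_mono_nat (by omega))
  set L := sumLevel rules * (Xf n + 2) + 1 with hL
  have hbn : n + Xf n + S + L ≤ b.eval (n + S) := by
    have h1 : sumLevel rules * (Xf n + 2) ≤ sumLevel rules * (pX.eval (n + S) + 2) := by gcongr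
    simp only [hb, Polynomial.eval_add, Polynomial.eval_X, Polynomial.eval_mul, Polynomial.eval_C,
      Polynomial.eval_one, Polynomial.eval_ofNat]
    omega
  have hmem : ∀ i ≤ Xf n, ∀ a, natMem n i a ≤ n + Xf n := fun i h a =>
    (natMem_le n i a).trans (by omega)
  have hgood : ∀ i ≤ Xf n, ∀ a, M.Good L (tabMem Z inp tab 0 1 i a) := fun i h a =>
    good_tabMem M hi (by omega) (M.mono (Nat.zero_le _) M.zero) (M.mono (Nat.zero_le _) M.one)
      (fun y hy => M.mono (by
        have : sumLevel rules * y ≤ sumLevel rules * (Xf n + 2) :=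
          Nat.mul_le_mul_left _ (by omega)
        omega) (ht.good M hi y (by omega))) a
  have hle : ∀ p : Polynomial ℕ, p.eval (n + Xf n) ≤ (p.comp b).eval (n + S) := fun p => by
    rw [Polynomial.eval_comp]
    exact p.eval_mono_nat (by omega)
  refine (Prog.leads_loop (c := .sub X (.mem (.lit 1))) (Xf n) id
    (fun i => tabMem Z inp tab 0 1 i) (T := (pc.comp b).eval (n + S))
    (T' := (pa.comp b + pE.comp b + 1 + (pi.comp b + 3)).eval (n + S)) ?_ ?_ ?_).mono ?_
  · exact fun i h => (hpc _ _ (hmem i h)).2.trans (hle _)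
  · intro i h
    refine ⟨?_, ?_⟩
    · simp only [NExpr.eval, hX]
      simp [natMem]
      omega
    · have e1 := Prog.leads_setVal (sz := sz) (.add (.lit (Z + 2)) (.mem (.lit 1))) (sumExpr rules)
        (v := tabMem Z inp tab 0 1 i) ((hpa _ _ (hmem i h.le)).2.trans (hle _))
        ((hpE M ⟨natMem n i, _⟩ _ _ (hmem i h.le) (hgood i h.le)).2.trans (pE.eval_mono_nat hbn))
      rw [eval_sumExpr _ _ _ _ _ ht.zero ht.one (ht.lt i h), ← ht.eq i h] at e1
      have e2 := Prog.leads_setNat (sz := sz) (.add (.mem (.lit 1)) (.lit 1))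
        (v := tabMem Z inp tab 0 1 (i + 1)) ((hpi _ _ (hmem i h.le)).2.trans (hle _))
      have ev : NExpr.eval (natMem n i) (.add (.lit (Z + 2)) (.mem (.lit 1))) = Z + 2 + i := by
        simp [NExpr.eval, natMem]
      have ev2 : NExpr.eval (natMem n i) (.add (.mem (.lit 1)) (.lit 1)) = i + 1 := by
        simp [NExpr.eval, natMem]
      rw [ev, tabMem_update_table] at e1
      rw [ev2] at e2
      refine (e1.seq e2).mono ?_
      simp only [Polynomial.eval_add, Polynomial.eval_comp, Polynomial.eval_one,
        Polynomial.eval_ofNat]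
      exact le_rfl
  · simp only [NExpr.eval, hX]
    simp [natMem]
  · simp only [Polynomial.eval_mul, Polynomial.eval_add, Polynomial.eval_one]
    gcongr

end Table

/-! ### Multiplication by a factorial and by powers of sums of inputs -/

section Scale

variable {Z : ℕ} {K : Type} [Field K]

/-- Multiplies the result by `e` as often as the counter says, and increases the factor. -/
def scaleProg (Z : ℕ) (e : FExpr) : Prog :=
  .loop (.mem (.lit 1))
    (.seq (.setVal (.lit Z) (.mul (.mem (.lit Z)) e))
      (.seq (.setVal (.lit (Z + 1)) (.add (.mem (.lit (Z + 1))) (.const 1)))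
        (.setNat (.lit 1) (.sub (.mem (.lit 1)) (.lit 1)))))

theorem SizeModel.natCast {sz : K → ℕ} {S : ℕ} (M : SizeModel sz S) (k : ℕ) :
    M.Good k (k : K) := by
  induction k with
  | zero => simpa using M.zero
  | succ k ih => simpa using M.add ih (M.mono (Nat.zero_le _) M.one)

theorem SizeModel.prod_range {sz : K → ℕ} {S : ℕ} (M : SizeModel sz S) (g : ℕ → K) (G E : ℕ)
    (h : ∀ j < E, M.Good G (g j)) : M.Good (E * G) (∏ j ∈ Finset.range E, g j) := by
  induction E with
  | zero => simpa using M.one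
  | succ E ih =>
    rw [Finset.prod_range_succ, Nat.succ_mul]
    exact M.mul (ih fun j hj => h j (by omega)) (h E (by omega))

/-- The factor counts up while the counter runs down. If `e` reads the factor cell, the product is a
factorial; if `e` is a sum of two inputs, it is a power. Hence `e` may depend on the factor, but on
neither the counter nor the result. -/
theorem scaleProg_leads {e : FExpr} (he : e.Plain) :
    ∃ P : Polynomial ℕ, ∀ {K : Type} [Field K] {sz : K → ℕ} {S : ℕ} (M : SizeModel sz S)
      (n : ℕ) (inp tab : ℕ → K) (X L : ℕ), (∀ a < Z, M.Good 1 (inp a)) →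
      (∀ y < X + 2, M.Good L (tab y)) → ∀ (r : K), M.Good L r → ∀ (f E G : ℕ) (g : ℕ → K),
      (∀ x r f, e.eval ⟨natMem n x, tabMem Z inp tab r (f : ℕ) X⟩ = g f) →
      (∀ j < E, M.Good G (g (f + j))) →
      (scaleProg Z e).Leads sz n E (tabMem Z inp tab r (f : ℕ) X) (P.eval (n + S + L + f + E + G)) 0
        (tabMem Z inp tab (r * ∏ j ∈ Finset.range E, g (f + j)) ((f + E : ℕ) : K) X) := by
  have hpl : (FExpr.mul (.mem (.lit Z)) e).Plain := .mul (.mem _) he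
  have hpl' : (FExpr.add (.mem (.lit (Z + 1))) (.const 1)).Plain := .add (.mem _) .one
  obtain ⟨pc, hpc⟩ := (NExpr.mem (.lit 1)).exists_bound
  obtain ⟨pa, hpa⟩ := (NExpr.lit Z).exists_bound
  obtain ⟨pb, hpb⟩ := (NExpr.lit (Z + 1)).exists_bound
  obtain ⟨pi, hpi⟩ := (NExpr.sub (.mem (.lit 1)) (.lit 1)).exists_bound
  obtain ⟨_, pE, -, hpE⟩ := hpl.exists_bound
  obtain ⟨_, pF, -, hpF⟩ := hpl'.exists_bound
  set b : Polynomial ℕ := Polynomial.X + (1 + Polynomial.X + Polynomial.X * Polynomial.X) with hb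
  refine ⟨(Polynomial.X + 1) * (pc.comp b + ((pa.comp b + pE.comp b + 1) +
    ((pb.comp b + pF.comp b + 1) + (pi.comp b + 3))) + 1), ?_⟩
  intro K _ sz S M n inp tab X L hi ht r hr f E G g hg hG
  set y := n + S + L + f + E + G with hy
  -- `L + E * G` covers the partial products and `f + E` the factor, since a natural number `k` has
  -- level `k`.
  set L' := 1 + L + E * G + f + E with hL'
  have hbn : n + E + S + L' ≤ b.eval y := by
    have h1 : E * G ≤ y * y := Nat.mul_le_mul (by omega) (by omega)
    simp only [hb, Polynomial.eval_add, Polynomial.eval_X, Polynomial.eval_mul,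
      Polynomial.eval_one]
    omega
  have hmem : ∀ i a, natMem n (E - i) a ≤ n + E := fun i a =>
    (natMem_le n _ a).trans (by omega)
  have hr' : ∀ i ≤ E, M.Good L' (r * ∏ j ∈ Finset.range i, g (f + j)) := fun i h =>
    M.mono (by
      have : i * G ≤ E * G := Nat.mul_le_mul_right _ h
      omega) (M.mul hr (M.prod_range (fun j => g (f + j)) G i fun j hj => hG j (by omega)))
  have hgood : ∀ (i i' : ℕ), i ≤ E → i' ≤ E → ∀ a, M.Good L' (tabMem Z inp tab
      (r * ∏ j ∈ Finset.range i, g (f + j)) ((f + i' : ℕ) : K) X a) := fun i i' h h' a =>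
    good_tabMem M hi (by omega) (hr' i h) (M.mono (by omega) (M.natCast (f + i')))
      (fun y hy => M.mono (by omega) (ht y hy)) a
  have hle : ∀ p : Polynomial ℕ, p.eval (n + E) ≤ (p.comp b).eval y := fun p => by
    rw [Polynomial.eval_comp]
    exact p.eval_mono_nat (by omega)
  have main := Prog.leads_loop (sz := sz) (n := n) (c := .mem (.lit 1)) E (fun i => E - i)
    (fun i => tabMem Z inp tab (r * ∏ j ∈ Finset.range i, g (f + j)) ((f + i : ℕ) : K) X)
    (p := .seq (.setVal (.lit Z) (.mul (.mem (.lit Z)) e))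
      (.seq (.setVal (.lit (Z + 1)) (.add (.mem (.lit (Z + 1))) (.const 1)))
        (.setNat (.lit 1) (.sub (.mem (.lit 1)) (.lit 1)))))
    (T := (pc.comp b).eval y)
    (T' := (((pa.comp b + pE.comp b + 1) +
      ((pb.comp b + pF.comp b + 1) + (pi.comp b + 3)))).eval y) ?_ ?_ ?_
  · simp only [Nat.sub_zero, Nat.sub_self, Finset.range_zero, Finset.prod_empty, mul_one,
      add_zero] at main
    refine main.mono ?_
    simp only [Polynomial.eval_mul, Polynomial.eval_add, Polynomial.eval_one, Polynomial.eval_X]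
    gcongr
    omega
  · exact fun i _ => (hpc _ _ (hmem i)).2.trans (hle _)
  · intro i h
    refine ⟨?_, ?_⟩
    · simp [NExpr.eval, natMem]
      omega
    · have e1 := Prog.leads_setVal (sz := sz) (.lit Z) (.mul (.mem (.lit Z)) e)
        (v := tabMem Z inp tab (r * ∏ j ∈ Finset.range i, g (f + j)) ((f + i : ℕ) : K) X)
        ((hpa _ _ (hmem i)).2.trans (hle _))
        ((hpE M ⟨natMem n (E - i), _⟩ _ _ (hmem i) (hgood i i h.le h.le)).2.trans
          (pE.eval_mono_nat hbn))
      have ev1 : FExpr.eval ⟨natMem n (E - i), tabMem Z inp tab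
          (r * ∏ j ∈ Finset.range i, g (f + j)) ((f + i : ℕ) : K) X⟩ (.mul (.mem (.lit Z)) e) =
          r * ∏ j ∈ Finset.range (i + 1), g (f + j) := by
        rw [FExpr.eval, hg, Finset.prod_range_succ, ← mul_assoc]
        simp [FExpr.eval, NExpr.eval, tabMem]
      rw [ev1, NExpr.eval, tabMem_update_result] at e1
      have e2 := Prog.leads_setVal (sz := sz) (.lit (Z + 1))
        (.add (.mem (.lit (Z + 1))) (.const 1))
        (v := tabMem Z inp tab (r * ∏ j ∈ Finset.range (i + 1), g (f + j)) ((f + i : ℕ) : K) X)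
        ((hpb _ _ (hmem i)).2.trans (hle _))
        ((hpF M ⟨natMem n (E - i), _⟩ _ _ (hmem i) (hgood (i + 1) i h h.le)).2.trans
          (pF.eval_mono_nat hbn))
      have ev2 : FExpr.eval ⟨natMem n (E - i), tabMem Z inp tab
          (r * ∏ j ∈ Finset.range (i + 1), g (f + j)) ((f + i : ℕ) : K) X⟩
          (.add (.mem (.lit (Z + 1))) (.const 1)) = ((f + (i + 1) : ℕ) : K) := by
        simp [FExpr.eval, NExpr.eval, tabMem]
        ring
      rw [ev2, NExpr.eval, tabMem_update_factor] at e2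
      have e3 := Prog.leads_setNat (sz := sz) (n := n) (.sub (.mem (.lit 1)) (.lit 1))
        (v := tabMem Z inp tab (r * ∏ j ∈ Finset.range (i + 1), g (f + j))
          ((f + (i + 1) : ℕ) : K) X) ((hpi _ _ (hmem i)).2.trans (hle _))
      have ev3 : NExpr.eval (natMem n (E - i)) (.sub (.mem (.lit 1)) (.lit 1)) = E - (i + 1) := by
        simp [NExpr.eval, natMem]
        omega
      rw [ev3] at e3
      refine (e1.seq (e2.seq e3)).mono ?_
      simp only [Polynomial.eval_add, Polynomial.eval_comp, Polynomial.eval_one,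
        Polynomial.eval_ofNat]
      exact le_rfl
  · simp [NExpr.eval, natMem]

/-- Multiplies the result by powers of sums of two input cells. -/
def powersProg (Z : ℕ) : List (NExpr × ℕ × ℕ) → Prog
  | [] => .skip
  | t :: l => .seq (.seq (.setNat (.lit 1) t.1)
      (scaleProg Z (.add (.mem (.lit t.2.1)) (.mem (.lit t.2.2))))) (powersProg Z l)

/-- The factor cell keeps increasing from one power to the next. Its value `f'` is irrelevant, but
it must stay bounded because it is paid for. -/
theorem powersProg_leads (l : List (NExpr × ℕ × ℕ)) (hl : ∀ t ∈ l, t.2.1 < Z ∧ t.2.2 < Z) :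
    ∃ P : Polynomial ℕ, ∀ {K : Type} [Field K] {sz : K → ℕ} {S : ℕ} (M : SizeModel sz S)
      (n : ℕ) (inp tab : ℕ → K) (X L : ℕ), (∀ a < Z, M.Good 1 (inp a)) →
      (∀ y < X + 2, M.Good L (tab y)) → ∀ (r : K), M.Good L r → ∀ (f : ℕ), ∃ f' : ℕ,
      (powersProg Z l).Leads sz n 0 (tabMem Z inp tab r (f : K) X) (P.eval (n + S + L + f)) 0
        (tabMem Z inp tab (r * (l.map fun t =>
          (inp t.2.1 + inp t.2.2) ^ t.1.eval (natMem n 0)).prod) (f' : K) X) ∧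
      M.Good (P.eval (n + S + L + f)) (r * (l.map fun t =>
          (inp t.2.1 + inp t.2.2) ^ t.1.eval (natMem n 0)).prod) ∧
      f' ≤ P.eval (n + S + L + f) := by
  induction l with
  | nil =>
    refine ⟨1 + Polynomial.X, ?_⟩
    intro K _ sz S M n inp tab X L hi ht r hr f
    refine ⟨f, ⟨1, ?_, ?_⟩, ?_, ?_⟩
    · simp
    · simpa [powersProg] using Prog.Run.skip _
    · simpa using M.mono (by omega) hr
    · simp; omega
  | cons t l ih =>
    obtain ⟨P, hP⟩ := ih fun t ht => hl t (List.mem_cons_of_mem _ ht)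
    obtain ⟨pt, hpt⟩ := t.1.exists_bound
    have hpl : (FExpr.add (.mem (.lit t.2.1)) (.mem (.lit t.2.2))).Plain := .add (.mem _) (.mem _)
    obtain ⟨Q, hQ⟩ := scaleProg_leads (Z := Z) hpl
    set b : Polynomial ℕ := Polynomial.X + pt + pt + pt + 2 with hb
    refine ⟨pt + 3 + Q.comp b + P.comp b, ?_⟩
    intro K _ sz S M n inp tab X L hi ht r hr f
    set y := n + S + L + f with hy
    obtain ⟨hE, hE'⟩ := hpt (natMem n 0) n fun a => by simpa using natMem_le n 0 a
    set E := t.1.eval (natMem n 0) with hEdef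
    have hEy : E ≤ pt.eval y := hE.trans (pt.eval_mono_nat (by omega))
    have hby : b.eval y = y + pt.eval y + pt.eval y + pt.eval y + 2 := by simp [hb]
    obtain ⟨h1, h2⟩ := hl t List.mem_cons_self
    have s1 := Prog.leads_setNat (sz := sz) (n := n) (x := 0) t.1 (v := tabMem Z inp tab r (f : K) X)
      (hE'.trans (pt.eval_mono_nat (show n ≤ y by omega)))
    have hin : M.Good 2 (inp t.2.1 + inp t.2.2) := M.add (hi _ h1) (hi _ h2)
    have s2 := hQ M n inp tab X L hi ht r hr f E 2 (fun _ => inp t.2.1 + inp t.2.2)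
      (fun x r f => by simp [FExpr.eval, NExpr.eval, tabMem, h1, h2]) (fun _ _ => hin)
    rw [Finset.prod_const, Finset.card_range] at s2
    have hr2 : M.Good (L + E * 2) (r * (inp t.2.1 + inp t.2.2) ^ E) := by
      refine M.mul hr ?_
      simpa using M.prod_range (fun _ => inp t.2.1 + inp t.2.2) 2 E fun _ _ => hin
    obtain ⟨f', s3, g3, hf'⟩ := hP M n inp tab X (L + E * 2) hi
      (fun y hy => M.mono (by omega) (ht y hy)) _ hr2 (f + E)
    have hPy : P.eval (n + S + (L + E * 2) + (f + E)) ≤ (P.comp b).eval y := by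
      rw [Polynomial.eval_comp, hby]
      exact P.eval_mono_nat (by omega)
    have hQy : Q.eval (n + S + L + f + E + 2) ≤ (Q.comp b).eval y := by
      rw [Polynomial.eval_comp, hby]
      exact Q.eval_mono_nat (by omega)
    have hT : (pt + 3 + Q.comp b + P.comp b).eval y =
        pt.eval y + 3 + (Q.comp b).eval y + (P.comp b).eval y := by simp
    refine ⟨f', ?_, ?_, ?_⟩
    · rw [List.map_cons, List.prod_cons, ← mul_assoc, hT]
      exact ((s1.seq s2).seq s3).mono (by omega)
    · rw [List.map_cons, List.prod_cons, ← mul_assoc, hT]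
      exact M.mono (by omega) g3
    · omega

end Scale

/-! ### The complete program: table, weighted sum, factorial, powers -/

section TableProg

variable {m : ℕ}

/-- The field memory at the start. -/
def inputVal {m : ℕ} {K : Type} [Field K] (w wbar : PredSym m → K) : ℕ → K :=
  (Mem.input 0 w wbar).val

theorem inputVal_pos {K : Type} [Field K] (w wbar : PredSym m → K) (i : Fin (3 + m)) :
    inputVal w wbar (2 * i) = w (PredSym.equivFin.symm i) := by
  have h : 2 * (i : ℕ) / 2 = i := by omega
  simp [inputVal, Mem.input, h]

theorem inputVal_neg {K : Type} [Field K] (w wbar : PredSym m → K) (i : Fin (3 + m)) :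
    inputVal w wbar (2 * i + 1) = wbar (PredSym.equivFin.symm i) := by
  have h : (2 * (i : ℕ) + 1) / 2 = i := by omega
  have h2 : (2 * (i : ℕ) + 1) % 2 ≠ 0 := by omega
  simp only [inputVal, Mem.input, h, i.2, dite_true, h2, if_false]

theorem input_eq {K : Type} [Field K] (n : ℕ) (w wbar : PredSym m → K) (tab : ℕ → K) :
    Mem.input n w wbar =
      ⟨natMem n 0, tabMem (2 * (3 + m)) (inputVal w wbar) tab 0 0 0⟩ := by
  unfold Mem.input natMem
  congr 1
  · funext a; simp
  · funext a
    unfold tabMem inputVal Mem.input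
    simp only
    split_ifs <;> first | rfl | omega

theorem exists_table_prog {Z : ℕ} (hZ : Z = 2 * (3 + m)) (rules outs : List (Wt Z × NExpr)) (X : NExpr) (Xf : ℕ → ℕ)
    (hX : ∀ n x, X.eval (natMem n x) = Xf n) (ex : PredSym m → NExpr) :
    ∃ (A : Prog) (P : Polynomial ℕ), ∀ {K : Type} [Field K] {sz : K → ℕ} {S : ℕ}
      (M : SizeModel sz S) (n : ℕ) (w wbar : PredSym m → K),
      (∀ p, M.Good 1 (w p)) → (∀ p, M.Good 1 (wbar p)) → ∀ tab : ℕ → K,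
      IsTable rules n (Xf n) (inputVal w wbar) tab →
      (∀ r ∈ outs, r.2.eval (natMem n 0) < Xf n + 2) →
      A.Outputs sz n w wbar
        (sumVal outs (inputVal w wbar) tab (natMem n 0) * (n.factorial : K) *
          ∏ p, (w p + wbar p) ^ (ex p).eval (natMem n 0)) (P.eval (n + S)) := by
  obtain ⟨P1, hP1⟩ := fillProg_leads rules X Xf hX
  set pows : List (NExpr × ℕ × ℕ) := Finset.univ.toList.map fun i : Fin (3 + m) =>
    (ex (PredSym.equivFin.symm i), 2 * (i : ℕ), 2 * (i : ℕ) + 1) with hpows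
  have hpZ : ∀ t ∈ pows, t.2.1 < Z ∧ t.2.2 < Z := by
    intro t ht
    obtain ⟨i, -, rfl⟩ := List.mem_map.1 ht
    have := i.2
    simp only
    omega
  have hpl : (FExpr.mem (.lit (Z + 1))).Plain := .mem _
  obtain ⟨P2, hP2⟩ := scaleProg_leads (Z := Z) hpl
  obtain ⟨P3, hP3⟩ := powersProg_leads pows hpZ
  obtain ⟨pX, hpX⟩ := X.exists_bound
  obtain ⟨_, pE, -, hpE⟩ := (plain_sumExpr outs).exists_bound
  have hpl' : (FExpr.mem (.lit Z)).Plain := .mem _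
  obtain ⟨_, pF, -, hpF⟩ := hpl'.exists_bound
  set c := sumLevel rules with hc
  set L : Polynomial ℕ := Polynomial.C c * (pX + 2) + Polynomial.C (sumLevel outs) + 1 with hL
  set b1 : Polynomial ℕ := Polynomial.X + pX + L with hb1
  set b2 : Polynomial ℕ := Polynomial.X + L + 1 + Polynomial.X + (Polynomial.X + 1) with hb2
  set L3 : Polynomial ℕ := L + Polynomial.X * (Polynomial.X + 1) with hL3
  set b3 : Polynomial ℕ := Polynomial.X + L3 + (1 + Polynomial.X) with hb3
  set L4 : Polynomial ℕ := L3 + P3.comp b3 with hL4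
  set b4 : Polynomial ℕ := Polynomial.X + L4 with hb4
  -- The factor becomes `1` to act as table entry `1`. The counter is reset after the filling and
  -- then set to `n` for the factorial. Cell `0` is an input weight and is overwritten only at the
  -- end.
  refine ⟨.seq (.seq (.seq (.seq (.seq (.seq (.seq
    (.setVal (.lit (Z + 1)) (.const 1)) (fillProg rules X)) (.setNat (.lit 1) (.lit 0)))
    (.setVal (.lit Z) (sumExpr outs))) (.setNat (.lit 1) (.mem (.lit 0))))
    (scaleProg Z (.mem (.lit (Z + 1))))) (powersProg Z pows)) (.setVal (.lit 0) (.mem (.lit Z))),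
    Polynomial.C (Nat.size (Z + 1) + 10 + Nat.size Z) + (2 * Polynomial.X) + P1 + pE.comp b1 +
      (Polynomial.X + 10) + P2.comp b2 + P3.comp b3 + pF.comp b4 + 20, ?_⟩
  intro K _ sz S M n w wbar hw hwbar tab ht houts
  set y := n + S with hy
  set inp := inputVal w wbar with hinp
  have hi : ∀ a < Z, M.Good 1 (inp a) := by
    intro a ha
    have ha2 : a / 2 < 3 + m := by omega
    rcases Nat.mod_two_eq_zero_or_one a with h | h
    · have e := inputVal_pos w wbar ⟨a / 2, ha2⟩
      have : 2 * (a / 2) = a := by omega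
      simp only [this] at e
      rw [hinp, e]; exact hw _
    · have e := inputVal_neg w wbar ⟨a / 2, ha2⟩
      have : 2 * (a / 2) + 1 = a := by omega
      simp only [this] at e
      rw [hinp, e]; exact hwbar _
  have hXn : Xf n ≤ pX.eval y := by
    have := (hpX (natMem n 0) n fun a => by simpa using natMem_le n 0 a).1
    rw [hX] at this
    exact this.trans (pX.eval_mono_nat (by omega))
  have hLy : L.eval y = c * (pX.eval y + 2) + sumLevel outs + 1 := by simp [hL]
  have htab0 : ∀ z < Xf n + 2, M.Good (c * (pX.eval y + 2)) (tab z) := fun z hz =>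
    M.mono (Nat.mul_le_mul_left c (show z ≤ pX.eval y + 2 by omega)) (ht.good M hi z hz)
  have htab : ∀ z < Xf n + 2, M.Good (L.eval y) (tab z) := fun z hz =>
    M.mono (by omega) (htab0 z hz)
  have hnat0 : ∀ a, natMem n 0 a ≤ n := fun a => by simpa using natMem_le n 0 a
  set r0 := sumVal outs inp tab (natMem n 0) with hr0
  have hr0g : M.Good (L.eval y) r0 :=
    M.mono (by omega) (good_sumVal M outs (natMem n 0) inp tab _ hi
      fun r hr => htab0 _ (houts r hr))
  -- first phase
  have s1 := Prog.leads_setVal (sz := sz) (n := n) (x := 0) (.lit (Z + 1)) (.const 1)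
    (v := tabMem Z inp tab 0 0 0) (T := 1 + Nat.size (Z + 1)) (T' := 1 + 2 * S)
    (by simp [NExpr.cost]) (by
      simp only [FExpr.cost]
      have := M.size_le (M.mono (Nat.zero_le 1) M.one)
      simp only [Rat.cast_one]
      omega)
  simp only [NExpr.eval, FExpr.eval, Rat.cast_one, tabMem_update_factor] at s1
  have s2 := hP1 M n inp tab hi ht
  have s3 := Prog.leads_setNat (sz := sz) (n := n) (x := Xf n) (.lit 0)
    (v := tabMem Z inp tab 0 1 (Xf n)) (T := 1) (by simp [NExpr.cost])
  have s4 := Prog.leads_setVal (sz := sz) (n := n) (x := 0) (.lit Z) (sumExpr outs)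
    (v := tabMem Z inp tab 0 1 (Xf n)) (T := 1 + Nat.size Z) (T' := (pE.comp b1).eval y)
    (by simp [NExpr.cost]) (by
      refine (hpE M ⟨natMem n 0, _⟩ n (L.eval y) hnat0 (good_tabMem M hi (by omega)
        (M.mono (Nat.zero_le _) M.zero) (M.mono (Nat.zero_le _) M.one) htab)).2.trans ?_
      rw [Polynomial.eval_comp]
      refine pE.eval_mono_nat ?_
      simp only [hb1, Polynomial.eval_add, Polynomial.eval_X]
      omega)
  rw [eval_sumExpr outs _ inp tab _ ht.zero ht.one houts, NExpr.eval, tabMem_update_result] at s4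
  have s5 := Prog.leads_setNat (sz := sz) (n := n) (x := 0) (.mem (.lit 0))
    (v := tabMem Z inp tab r0 1 (Xf n)) (T := n + 5) (by
      have : Nat.size n ≤ n := Nat.size_le.2 Nat.lt_two_pow_self
      simp [NExpr.cost, NExpr.eval, natMem]
      omega)
  have ev5 : NExpr.eval (natMem n 0) (.mem (.lit 0)) = n := by simp [NExpr.eval, natMem]
  rw [ev5] at s5
  -- The factor is still `1` here, so the `n` rounds multiply by `1, ..., n`.
  have s6 := hP2 M n inp tab (Xf n) (L.eval y) hi htab r0 hr0g 1 n (n + 1) (fun f => (f : K))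
    (fun x r f => by simp [FExpr.eval, NExpr.eval, tabMem])
    (fun j hj => M.mono (by omega) (M.natCast (1 + j)))
  have hfac : ∏ j ∈ Finset.range n, ((1 + j : ℕ) : K) = (n.factorial : K) := by
    rw [← Finset.prod_range_add_one_eq_factorial, Nat.cast_prod]
    exact Finset.prod_congr rfl fun j _ => by rw [add_comm]
  rw [hfac, Nat.cast_one] at s6
  have hr3 : M.Good (L3.eval y) (r0 * (n.factorial : K)) := by
    have := M.prod_range (fun j => ((1 + j : ℕ) : K)) (n + 1) n
      fun j hj => M.mono (by omega) (M.natCast (1 + j))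
    rw [hfac] at this
    refine M.mono ?_ (M.mul hr0g this)
    simp only [hL3, Polynomial.eval_add, Polynomial.eval_X, Polynomial.eval_mul,
      Polynomial.eval_one]
    have : n * (n + 1) ≤ y * (y + 1) := Nat.mul_le_mul (by omega) (by omega)
    omega
  have hLL3 : L.eval y ≤ L3.eval y := by simp [hL3]
  obtain ⟨f', s7, g7, hf'⟩ := hP3 M n inp tab (Xf n) (L3.eval y) hi
    (fun z hz => M.mono hLL3 (htab z hz)) _ hr3 (1 + n)
  have hb3y : P3.eval (n + S + L3.eval y + (1 + n)) ≤ (P3.comp b3).eval y := by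
    rw [Polynomial.eval_comp]
    refine P3.eval_mono_nat ?_
    simp only [hb3, Polynomial.eval_add, Polynomial.eval_X, Polynomial.eval_one]
    omega
  have hpow : (pows.map fun t => (inp t.2.1 + inp t.2.2) ^ t.1.eval (natMem n 0)).prod =
      ∏ p, (w p + wbar p) ^ (ex p).eval (natMem n 0) := by
    rw [hpows, List.map_map, Finset.prod_map_toList, ← PredSym.equivFin.symm.prod_comp]
    refine Finset.prod_congr rfl fun i _ => ?_
    simp only [Function.comp, hinp, inputVal_pos, inputVal_neg]
  rw [hpow] at s7 g7
  set res := r0 * (n.factorial : K) * ∏ p, (w p + wbar p) ^ (ex p).eval (natMem n 0) with hres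
  have hL4y : L4.eval y = L3.eval y + (P3.comp b3).eval y := by simp [hL4]
  have hgood4 : ∀ a, M.Good (L4.eval y) (tabMem Z inp tab res (f' : K) (Xf n) a) :=
    good_tabMem M hi (by omega) (M.mono (by omega) g7) (M.mono (by omega) (M.natCast f'))
      (fun z hz => M.mono (by omega) (htab z hz))
  have s8 := Prog.leads_setVal (sz := sz) (n := n) (x := 0) (.lit 0) (.mem (.lit Z))
    (v := tabMem Z inp tab res (f' : K) (Xf n)) (T := 1) (T' := (pF.comp b4).eval y)
    (by simp [NExpr.cost]) (by
      refine (hpF M ⟨natMem n 0, _⟩ n (L4.eval y) hnat0 hgood4).2.trans ?_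
      rw [Polynomial.eval_comp]
      refine pF.eval_mono_nat ?_
      simp only [hb4, Polynomial.eval_add, Polynomial.eval_X]
      omega)
  have hb2y : P2.eval (n + S + L.eval y + 1 + n + (n + 1)) ≤ (P2.comp b2).eval y := by
    rw [Polynomial.eval_comp]
    refine P2.eval_mono_nat ?_
    simp only [hb2, Polynomial.eval_add, Polynomial.eval_X, Polynomial.eval_one]
    omega
  obtain ⟨t, htt, hrun⟩ := ((((((s1.seq s2).seq s3).seq s4).seq s5).seq s6).seq s7).seq s8
  refine ⟨t, _, ?_, by rw [input_eq n w wbar tab, ← hZ]; exact hrun, ?_⟩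
  · refine htt.trans ?_
    simp only [Polynomial.eval_add, Polynomial.eval_mul, Polynomial.eval_C, Polynomial.eval_X,
      Polynomial.eval_ofNat]
    rw [← hy] at *
    omega
  · simp [FExpr.eval, NExpr.eval, tabMem]

end TableProg

/-! ## Functions given by number expressions -/

/-- A function of the number memory that is given by an expression. -/
def NComp (f : (ℕ → ℕ) → ℕ) : Prop := ∃ e : NExpr, ∀ s, e.eval s = f s

namespace NComp

variable {f g h : (ℕ → ℕ) → ℕ}

theorem const (c : ℕ) : NComp fun _ => c := ⟨.lit c, fun _ => rfl⟩

theorem mem (i : ℕ) : NComp fun s => s i := ⟨.mem (.lit i), fun _ => rfl⟩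

theorem add (hf : NComp f) (hg : NComp g) : NComp fun s => f s + g s := by
  obtain ⟨a, ha⟩ := hf
  obtain ⟨b, hb⟩ := hg
  exact ⟨.add a b, fun s => by rw [NExpr.eval, ha, hb]⟩

theorem sub (hf : NComp f) (hg : NComp g) : NComp fun s => f s - g s := by
  obtain ⟨a, ha⟩ := hf
  obtain ⟨b, hb⟩ := hg
  exact ⟨.sub a b, fun s => by rw [NExpr.eval, ha, hb]⟩

theorem mul (hf : NComp f) (hg : NComp g) : NComp fun s => f s * g s := by
  obtain ⟨a, ha⟩ := hf
  obtain ⟨b, hb⟩ := hg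
  exact ⟨.mul a b, fun s => by rw [NExpr.eval, ha, hb]⟩

theorem div (hf : NComp f) (hg : NComp g) : NComp fun s => f s / g s := by
  obtain ⟨a, ha⟩ := hf
  obtain ⟨b, hb⟩ := hg
  exact ⟨.div a b, fun s => by rw [NExpr.eval, ha, hb]⟩

theorem mod (hf : NComp f) (hg : NComp g) : NComp fun s => f s % g s := by
  obtain ⟨a, ha⟩ := hf
  obtain ⟨b, hb⟩ := hg
  exact ⟨.mod a b, fun s => by rw [NExpr.eval, ha, hb]⟩

theorem pow (hf : NComp f) (k : ℕ) : NComp fun s => f s ^ k := by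
  induction k with
  | zero => simpa using const 1
  | succ k ih => simpa only [pow_succ] using ih.mul hf

theorem sum {ι : Type} (t : Finset ι) {F : ι → (ℕ → ℕ) → ℕ} (h : ∀ i ∈ t, NComp (F i)) :
    NComp fun s => ∑ i ∈ t, F i s := by
  classical
  induction t using Finset.induction_on with
  | empty => simpa using const 0
  | insert i t hi ih =>
    simp only [Finset.sum_insert hi]
    exact (h i (Finset.mem_insert_self i t)).add (ih fun j hj => h j (Finset.mem_insert_of_mem hj))

end NComp

open Classical in
/-- A property of the number memory that is decided by an expression. -/
def NDec (p : (ℕ → ℕ) → Prop) : Prop := NComp fun s => if p s then 1 else 0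

namespace NDec

variable {f g : (ℕ → ℕ) → ℕ} {p q : (ℕ → ℕ) → Prop}

theorem const (p : Prop) : NDec fun _ => p := NComp.const _

/-- With truncated subtraction, `1 - (f - g)` is `1` exactly if `f ≤ g`. -/
theorem le (hf : NComp f) (hg : NComp g) : NDec fun s => f s ≤ g s := by
  have : NComp fun s => 1 - (f s - g s) := (NComp.const 1).sub (hf.sub hg)
  unfold NDec
  convert this using 2 with s
  split_ifs <;> omega

theorem not (hp : NDec p) : NDec fun s => ¬ p s := by
  classical
  have : NComp fun s => 1 - (if p s then 1 else 0) := (NComp.const 1).sub hp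
  unfold NDec
  convert this using 2 with s
  by_cases h : p s <;> simp [h]

theorem and (hp : NDec p) (hq : NDec q) : NDec fun s => p s ∧ q s := by
  classical
  have : NComp fun s => (if p s then 1 else 0) * (if q s then 1 else 0) := NComp.mul hp hq
  unfold NDec
  convert this using 2 with s
  by_cases h : p s <;> by_cases h' : q s <;> simp [h, h']

theorem imp (hp : NDec p) (hq : NDec q) : NDec fun s => p s → q s := by
  have := (hp.and hq.not).not
  simpa only [not_and, not_not] using this

theorem lt (hf : NComp f) (hg : NComp g) : NDec fun s => f s < g s := by
  simpa only [not_le] using (le hg hf).not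

theorem eq (hf : NComp f) (hg : NComp g) : NDec fun s => f s = g s := by
  simpa only [le_antisymm_iff] using (le hf hg).and (le hg hf)

theorem all {ι : Type} (t : Finset ι) {F : ι → (ℕ → ℕ) → Prop} (h : ∀ i ∈ t, NDec (F i)) :
    NDec fun s => ∀ i ∈ t, F i s := by
  classical
  induction t using Finset.induction_on with
  | empty => simpa using const True
  | insert i t hi ih =>
    simp only [Finset.forall_mem_insert]
    exact (h i (Finset.mem_insert_self i t)).and
      (ih fun j hj => h j (Finset.mem_insert_of_mem hj))

/-- Expressions have no case distinction; the two values are blended with the coefficients `0` and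
`1`. -/
theorem ite [∀ s, Decidable (p s)] (hp : NDec p) (hf : NComp f) (hg : NComp g) :
    NComp fun s => if p s then f s else g s := by
  have hp' : NComp fun s => if p s then 1 else 0 := by
    unfold NDec at hp
    convert hp
  have : NComp fun s => (if p s then 1 else 0) * f s + (1 - (if p s then 1 else 0)) * g s :=
    (hp'.mul hf).add (((NComp.const 1).sub hp').mul hg)
  convert this using 2 with s
  by_cases h : p s <;> simp [h]

end NDec

/-! ## Positional codes -/

/-- The number with digits `d` in base `R`. -/
def digitCode (R L : ℕ) (d : Fin L → ℕ) : ℕ := ∑ j : Fin L, d j * R ^ (j : ℕ)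

/-- The digit number `j` of the last `L` digits. -/
def digitAt (R L x j : ℕ) : ℕ := x % R ^ L / R ^ j % R

theorem digitCode_lt {R L : ℕ} {d : Fin L → ℕ} (hd : ∀ j, d j < R) : digitCode R L d < R ^ L := by
  have := (finFunctionFinEquiv fun j => (⟨d j, hd j⟩ : Fin R)).2
  simpa [digitCode] using this

/-- Reduction modulo `R ^ L` removes the leading part `f`; the remaining digits are those of
`finFunctionFinEquiv`. -/
theorem digitAt_digitCode {R L : ℕ} {d : Fin L → ℕ} (hd : ∀ j, d j < R) (f : ℕ) (j : Fin L) :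
    digitAt R L (f * R ^ L + digitCode R L d) j = d j := by
  have h := congrFun (finFunctionFinEquiv.left_inv fun j => (⟨d j, hd j⟩ : Fin R)) j
  have h' := congrArg Fin.val h
  rw [digitAt, add_comm, Nat.add_mul_mod_self_right, Nat.mod_eq_of_lt (digitCode_lt hd)]
  simpa [digitCode, finFunctionFinEquiv] using h'

/-! ## Weighted counter automata -/

/-- A transition: counters that must be zero, decrements, increments, the next state (or none for
acceptance), and a weight. -/
structure CRule (Q I : Type) (Z : ℕ) where
  zero : I → Prop
  dec : I → ℕ
  inc : I → ℕ
  tgt : Option Q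
  wt : Wt Z

section Automaton

variable {Q I : Type} {Z : ℕ}

/-- The counters after a transition. -/
def CRule.next (r : CRule Q I Z) (v : I → ℕ) : I → ℕ := fun i => v i - r.dec i + r.inc i

/-- Whether a transition is possible; counters have to stay below `R`. -/
def CRule.Enabled (r : CRule Q I Z) (R : ℕ) (v : I → ℕ) : Prop :=
  (∀ i, r.zero i → v i = 0) ∧ (∀ i, r.dec i ≤ v i) ∧ ∀ i, r.next v i < R

open Classical in
/-- The total weight of the accepting runs with at most `f` transitions. -/
noncomputable def runVal {K : Type} [Field K] (rules : Q → List (CRule Q I Z)) (R : ℕ)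
    (inp : ℕ → K) : ℕ → Q → (I → ℕ) → K
  | 0, _, _ => 0
  | f + 1, q, v => ((rules q).map fun r =>
      if r.Enabled R v then
        r.wt.val inp * (match r.tgt with
          | none => 1
          | some q' => runVal rules R inp f q' (r.next v))
      else 0).sum

variable [Fintype Q] [Fintype I]

/-- The base used for an automaton. -/
def autoBase (Q : Type) [Fintype Q] (n : ℕ) : ℕ := n + (Fintype.card Q + 1)

/-- The number of digits of a configuration. -/
def autoLen (I : Type) [Fintype I] : ℕ := Fintype.card (Option I)

/-- The position of the state (`none`) and of the counters. -/
noncomputable def autoPos (I : Type) [Fintype I] : Option I ≃ Fin (autoLen I) :=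
  Fintype.equivFin (Option I)

/-- The digits of a configuration. -/
noncomputable def autoDigits (q : Q) (v : I → ℕ) : Fin (autoLen I) → ℕ := fun j =>
  match (autoPos I).symm j with
  | none => Fintype.equivFin Q q
  | some i => v i

theorem autoDigits_none (q : Q) (v : I → ℕ) :
    autoDigits q v (autoPos I none) = Fintype.equivFin Q q := by simp [autoDigits]

theorem autoDigits_some (q : Q) (v : I → ℕ) (i : I) :
    autoDigits q v (autoPos I (some i)) = v i := by simp [autoDigits]

/-- The base contains the summand `Fintype.card Q` so that the number of the state is a digit like
the counters. -/
theorem autoDigits_lt {q : Q} {v : I → ℕ} {n : ℕ} (hv : ∀ i, v i < autoBase Q n)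
    (j : Fin (autoLen I)) : autoDigits q v j < autoBase Q n := by
  unfold autoDigits
  split
  · have := (Fintype.equivFin Q q).2
    simp only [autoBase]
    omega
  · exact hv _

/-- The code of a configuration with fuel `f`. -/
noncomputable def autoCode (n f : ℕ) (q : Q) (v : I → ℕ) : ℕ :=
  f * autoBase Q n ^ autoLen I + digitCode (autoBase Q n) (autoLen I) (autoDigits q v)

/-- The fuel in a code. -/
def codeFuel (Q I : Type) [Fintype Q] [Fintype I] (n x : ℕ) : ℕ := x / autoBase Q n ^ autoLen I

/-- The state in a code. -/
noncomputable def codeState (Q I : Type) [Fintype Q] [Fintype I] (n x : ℕ) : ℕ :=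
  digitAt (autoBase Q n) (autoLen I) x (autoPos I none)

/-- The counters in a code. -/
noncomputable def codeCount (Q I : Type) [Fintype Q] [Fintype I] (n x : ℕ) (i : I) : ℕ :=
  digitAt (autoBase Q n) (autoLen I) x (autoPos I (some i))

theorem codeFuel_autoCode {n : ℕ} {v : I → ℕ} (hv : ∀ i, v i < autoBase Q n) (f : ℕ) (q : Q) :
    codeFuel Q I n (autoCode n f q v) = f := by
  have h := digitCode_lt (autoDigits_lt (q := q) hv)
  rw [codeFuel, autoCode, add_comm, Nat.add_mul_div_right _ _ (by omega), Nat.div_eq_of_lt h,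
    zero_add]

theorem codeState_autoCode {n : ℕ} {v : I → ℕ} (hv : ∀ i, v i < autoBase Q n) (f : ℕ) (q : Q) :
    codeState Q I n (autoCode n f q v) = Fintype.equivFin Q q := by
  rw [codeState, autoCode, digitAt_digitCode (autoDigits_lt hv), autoDigits_none]

theorem codeCount_autoCode {n : ℕ} {v : I → ℕ} (hv : ∀ i, v i < autoBase Q n) (f : ℕ) (q : Q) :
    codeCount Q I n (autoCode n f q v) = v := by
  funext i
  rw [codeCount, autoCode, digitAt_digitCode (autoDigits_lt hv), autoDigits_some]

theorem autoCode_lt {n : ℕ} {v : I → ℕ} (hv : ∀ i, v i < autoBase Q n) (f : ℕ) (q : Q) :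
    autoCode n f q v < (f + 1) * autoBase Q n ^ autoLen I := by
  have := digitCode_lt (autoDigits_lt (q := q) hv)
  rw [autoCode, Nat.add_mul]
  omega

open Classical in
/-- The table entry that a transition from state `q` refers to. -/
noncomputable def ruleAddr (q : Q) (r : CRule Q I Z) (n x : ℕ) : ℕ :=
  if (codeFuel Q I n x ≠ 0 ∧ codeState Q I n x = Fintype.equivFin Q q) ∧
      r.Enabled (autoBase Q n) (codeCount Q I n x) then
    match r.tgt with
    | none => 1
    | some q' => 2 + autoCode n (codeFuel Q I n x - 1) q' (r.next (codeCount Q I n x))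
  else 0

/-- Fuel is the leading part of a code. A successor has one unit less and hence a smaller code,
whatever its counters are. This is why the table can be filled by increasing address. -/
theorem ruleAddr_lt (q : Q) (r : CRule Q I Z) (n x : ℕ) : ruleAddr q r n x < x + 2 := by
  unfold ruleAddr
  split_ifs with h
  · split
    · omega
    · have h1 := autoCode_lt h.2.2.2 (codeFuel Q I n x - 1) (by assumption)
      have h2 : codeFuel Q I n x - 1 + 1 = codeFuel Q I n x := by
        have := h.1.1
        omega
      rw [h2] at h1
      have h3 := Nat.div_mul_le_self x (autoBase Q n ^ autoLen I)
      unfold codeFuel at *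
      omega
  · omega

theorem nComp_ruleAddr (q : Q) (r : CRule Q I Z) : NComp fun s => ruleAddr q r (s 0) (s 1) := by
  have hR : NComp fun s => autoBase Q (s 0) := (NComp.mem 0).add (NComp.const _)
  have hRL : NComp fun s => autoBase Q (s 0) ^ autoLen I := hR.pow _
  have hf : NComp fun s => codeFuel Q I (s 0) (s 1) := (NComp.mem 1).div hRL
  have hdig : ∀ j : ℕ, NComp fun s => digitAt (autoBase Q (s 0)) (autoLen I) (s 1) j := fun j =>
    (((NComp.mem 1).mod hRL).div (hR.pow j)).mod hR
  have hc : ∀ i, NComp fun s => codeCount Q I (s 0) (s 1) i := fun i => hdig _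
  have hn : ∀ i, NComp fun s => r.next (codeCount Q I (s 0) (s 1)) i := fun i =>
    ((hc i).sub (NComp.const _)).add (NComp.const _)
  have hE : NDec fun s => r.Enabled (autoBase Q (s 0)) (codeCount Q I (s 0) (s 1)) := by
    unfold CRule.Enabled
    refine NDec.and ?_ (NDec.and ?_ ?_)
    · simpa using NDec.all Finset.univ fun i _ =>
        (NDec.const (r.zero i)).imp (NDec.eq (hc i) (NComp.const 0))
    · simpa using NDec.all Finset.univ fun i _ => NDec.le (NComp.const (r.dec i)) (hc i)
    · simpa using NDec.all Finset.univ fun i _ => NDec.lt (hn i) hR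
  have hM : NComp fun s => match r.tgt with
      | none => 1
      | some q' => 2 + autoCode (s 0) (codeFuel Q I (s 0) (s 1) - 1) q'
          (r.next (codeCount Q I (s 0) (s 1))) := by
    split
    · exact NComp.const 1
    · refine (NComp.const 2).add (((hf.sub (NComp.const 1)).mul hRL).add ?_)
      unfold digitCode
      refine NComp.sum _ fun j _ => NComp.mul ?_ (hR.pow _)
      unfold autoDigits
      split
      · exact NComp.const _
      · exact hn _
  classical
  have := NDec.ite (((NDec.eq hf (NComp.const 0)).not.and (NDec.eq (hdig (autoPos I none))
    (NComp.const (Fintype.equivFin Q q)))).and hE) hM (NComp.const 0)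
  unfold ruleAddr
  convert this
  rfl

open Classical in
/-- The table of all values of `runVal`. -/
noncomputable def autoTab {K : Type} [Field K] (rules : Q → List (CRule Q I Z)) (n : ℕ)
    (inp : ℕ → K) : ℕ → K
  | 0 => 0
  | 1 => 1
  | x + 2 => ∑ q : Q, if codeState Q I n x = Fintype.equivFin Q q then
      runVal rules (autoBase Q n) inp (codeFuel Q I n x) q (codeCount Q I n x) else 0

theorem autoTab_autoCode {K : Type} [Field K] (rules : Q → List (CRule Q I Z)) {n : ℕ}
    (inp : ℕ → K) {v : I → ℕ} (hv : ∀ i, v i < autoBase Q n) (f : ℕ) (q : Q) :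
    autoTab rules n inp (2 + autoCode n f q v) = runVal rules (autoBase Q n) inp f q v := by
  classical
  rw [add_comm, autoTab, codeState_autoCode hv, codeFuel_autoCode hv, codeCount_autoCode hv,
    Finset.sum_eq_single q]
  · simp
  · intro q' _ hq
    rw [if_neg]
    rw [Fin.val_inj, (Fintype.equivFin Q).apply_eq_iff_eq]
    exact hq.symm
  · simp

/-- The recursion of the table, as weighted sums. -/
noncomputable def autoRules (rules : Q → List (CRule Q I Z)) : List (Wt Z × NExpr) :=
  (Finset.univ : Finset Q).toList.flatMap fun q =>
    (rules q).map fun r => (r.wt, (nComp_ruleAddr q r).choose)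

/-- One list of rules must serve all addresses, so it contains the transitions of all states. A
transition that does not apply refers to entry `0`, an accepting one to entry `1`; the case
distinctions of `runVal` thus disappear into addresses. -/
theorem autoRules_isTable {K : Type} [Field K] (rules : Q → List (CRule Q I Z)) (n X : ℕ)
    (inp : ℕ → K) : IsTable (autoRules rules) n X inp (autoTab rules n inp) := by
  classical
  have hev : ∀ (q : Q) (r : CRule Q I Z) (x : ℕ),
      NExpr.eval (natMem n x) (nComp_ruleAddr q r).choose = ruleAddr q r n x := fun q r x => by
    rw [(nComp_ruleAddr q r).choose_spec]
    simp [natMem]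
  refine ⟨rfl, rfl, ?_, ?_⟩
  · intro x _ r hr
    obtain ⟨q, -, hr⟩ := List.mem_flatMap.1 hr
    obtain ⟨r, -, rfl⟩ := List.mem_map.1 hr
    rw [hev]
    exact ruleAddr_lt q r n x
  · intro x _
    have hflat : ∀ (l : List Q) (F : Wt Z × NExpr → K) (G : Q → List (Wt Z × NExpr)),
        ((l.flatMap G).map F).sum = (l.map fun q => ((G q).map F).sum).sum := by
      intro l F G
      induction l with
      | nil => simp
      | cons a l ih => simp [ih]
    rw [autoTab, sumVal, autoRules, hflat, Finset.sum_map_toList]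
    refine Finset.sum_congr rfl fun q _ => ?_
    rw [List.map_map]
    by_cases hq : codeState Q I n x = Fintype.equivFin Q q
    · rw [if_pos hq]
      rcases hf : codeFuel Q I n x with - | f
      · rw [runVal]
        symm
        refine List.sum_eq_zero fun y hy => ?_
        obtain ⟨r, -, rfl⟩ := List.mem_map.1 hy
        simp only [Function.comp, hev]
        rw [ruleAddr, if_neg (by simp [hf]), autoTab, mul_zero]
      · rw [runVal]
        congr 1
        refine List.map_congr_left fun r _ => ?_
        simp only [Function.comp, hev]
        unfold ruleAddr
        by_cases hE : r.Enabled (autoBase Q n) (codeCount Q I n x)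
        · rw [if_pos hE, if_pos ⟨⟨by omega, hq⟩, hE⟩]
          congr 1
          split
          · rfl
          · rw [autoTab_autoCode rules inp hE.2.2, hf, Nat.add_sub_cancel]
        · rw [if_neg hE, if_neg (fun h => hE h.2), autoTab, mul_zero]
    · rw [if_neg hq]
      symm
      refine List.sum_eq_zero fun y hy => ?_
      obtain ⟨r, -, rfl⟩ := List.mem_map.1 hy
      simp only [Function.comp, hev]
      rw [ruleAddr, if_neg (fun h => hq h.1.2), autoTab, mul_zero]

theorem exists_automaton_prog {m : ℕ} (hZ : Z = 2 * (3 + m)) (rules : Q → List (CRule Q I Z))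
    (fuel : ℕ → ℕ) (hfuel : NComp fun s => fuel (s 0)) (start : ℕ → I → ℕ)
    (hstart : ∀ i, NComp fun s => start (s 0) i) (hle : ∀ n i, start n i ≤ n)
    (outs : List (Wt Z × Q)) (ex : PredSym m → ℕ → ℕ) (hex : ∀ p, NComp fun s => ex p (s 0)) :
    ∃ (A : Prog) (P : Polynomial ℕ), ∀ {K : Type} [Field K] {sz : K → ℕ} {S : ℕ}
      (M : SizeModel sz S) (n : ℕ) (w wbar : PredSym m → K),
      (∀ p, M.Good 1 (w p)) → (∀ p, M.Good 1 (wbar p)) →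
      A.Outputs sz n w wbar
        ((outs.map fun o => o.1.val (inputVal w wbar) * runVal rules (autoBase Q n)
            (inputVal w wbar) (fuel n) o.2 (start n)).sum * (n.factorial : K) *
          ∏ p, (w p + wbar p) ^ ex p n) (P.eval (n + S)) := by
  have hR : NComp fun s => autoBase Q (s 0) := (NComp.mem 0).add (NComp.const _)
  have hRL : NComp fun s => autoBase Q (s 0) ^ autoLen I := hR.pow _
  -- All codes with fuel at most `fuel n` lie below this number.
  obtain ⟨X, hX⟩ : NComp fun s => (fuel (s 0) + 1) * autoBase Q (s 0) ^ autoLen I :=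
    (hfuel.add (NComp.const 1)).mul hRL
  have hout : ∀ q : Q, NComp fun s => 2 + autoCode (s 0) (fuel (s 0)) q (start (s 0)) := by
    intro q
    refine (NComp.const 2).add ((hfuel.mul hRL).add ?_)
    unfold digitCode
    refine NComp.sum _ fun j _ => NComp.mul ?_ (hR.pow _)
    unfold autoDigits
    split
    · exact NComp.const _
    · exact hstart _
  choose eo heo using hout
  choose ee hee using hex
  obtain ⟨A, P, hA⟩ := exists_table_prog hZ (autoRules rules)
    (outs.map fun o => (o.1, eo o.2)) X (fun n => (fuel n + 1) * autoBase Q n ^ autoLen I)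
    (fun n x => by rw [hX]; simp [natMem]) ee
  refine ⟨A, P, fun {K} _ {sz S} M n w wbar hw hwbar => ?_⟩
  have hb : ∀ i, start n i < autoBase Q n := fun i => by
    have := hle n i
    unfold autoBase
    omega
  have h := hA M n w wbar hw hwbar _ (autoRules_isTable rules n _ _) ?_
  · have e1 : sumVal (outs.map fun o => (o.1, eo o.2)) (inputVal w wbar)
        (autoTab rules n (inputVal w wbar)) (natMem n 0) =
        (outs.map fun o => o.1.val (inputVal w wbar) * runVal rules (autoBase Q n)
            (inputVal w wbar) (fuel n) o.2 (start n)).sum := by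
      rw [sumVal, List.map_map]
      congr 2
      funext o
      simp only [Function.comp, heo]
      rw [← autoTab_autoCode rules _ hb]
      simp [natMem]
    have e2 : ∀ p, (ee p).eval (natMem n 0) = ex p n := fun p => by
      rw [hee]
      simp [natMem]
    simpa only [e1, e2] using h
  · intro r hr
    obtain ⟨o, -, rfl⟩ := List.mem_map.1 hr
    simp only [heo]
    have := autoCode_lt hb (fuel n) o.2
    simp only [natMem, if_true]
    omega

end Automaton

/-! ## Structures that grow element by element

A new element chooses a type in `U` and then interacts with each earlier element, whose cell in `C`
changes, by choosing a table in `T`; the effects on the new element are added up in `S`. -/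

structure Growth (U S T C : Type) (Z : ℕ) where
  init : U → S
  fin : U → S → C
  move : C → U → T → C
  eff : C → U → T → S
  acc : C → Prop
  wtNew : U → Wt Z
  wtPair : C → U → T → Wt Z

namespace Growth

variable {U S T C : Type} {Z : ℕ} [Fintype U] [Fintype T] [AddCommMonoid S]
  {K : Type} [Field K] (Γ : Growth U S T C Z) (inp : ℕ → K)

/-- The total weight of the interactions of a new element with the elements in a list, followed by
a continuation `F`. -/
def inner (F : List C → K) (u : U) : List C → List C → S → K
  | [], r, s => F (Γ.fin u s :: r)
  | c :: l, r, s => ∑ t, (Γ.wtPair c u t).val inp *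
      inner F u l (Γ.move c u t :: r) (s + Γ.eff c u t)

open Classical in
/-- The total weight of the ways to add `k` elements such that all cells are accepted. -/
noncomputable def outer : ℕ → List C → K
  | 0, l => if ∀ c ∈ l, Γ.acc c then 1 else 0
  | k + 1, l => ∑ u, (Γ.wtNew u).val inp * Γ.inner inp (outer k) u l [] (Γ.init u)

variable {Γ inp}

theorem inner_perm_right {F : List C → K} (hF : ∀ l l', l.Perm l' → F l = F l') (u : U)
    (l r r' : List C) (s : S) (h : r.Perm r') :
    Γ.inner inp F u l r s = Γ.inner inp F u l r' s := by
  induction l generalizing r r' s with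
  | nil => exact hF _ _ (h.cons _)
  | cons c l ih =>
    simp only [inner]
    exact Finset.sum_congr rfl fun t _ => by rw [ih _ _ _ (h.cons _)]

/-- For two neighbours the sums over their tables commute, the effects add up commutatively, and the
list of processed cells matters only up to permutation. -/
theorem inner_perm {F : List C → K} (hF : ∀ l l', l.Perm l' → F l = F l') (u : U)
    {l l' : List C} (h : l.Perm l') (r : List C) (s : S) :
    Γ.inner inp F u l r s = Γ.inner inp F u l' r s := by
  induction h generalizing r s with
  | nil => rfl
  | cons c _ ih =>
    simp only [inner]
    exact Finset.sum_congr rfl fun t _ => by rw [ih]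
  | swap c d l =>
    simp only [inner, Finset.mul_sum]
    rw [Finset.sum_comm]
    refine Finset.sum_congr rfl fun t _ => Finset.sum_congr rfl fun t' _ => ?_
    rw [mul_left_comm, inner_perm_right hF u l _ _ _ (List.Perm.swap _ _ r), add_right_comm]
  | trans _ _ ih ih' => exact (ih r s).trans (ih' r s)

/-- Hence only the multiplicities of the cells matter, and counters suffice to store a
configuration. -/
theorem outer_perm (k : ℕ) {l l' : List C} (h : l.Perm l') :
    Γ.outer inp k l = Γ.outer inp k l' := by
  induction k generalizing l l' with
  | zero =>
    classical
    have : (∀ c ∈ l, Γ.acc c) ↔ ∀ c ∈ l', Γ.acc c := by simp only [h.mem_iff]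
    simp only [outer]
    by_cases h' : ∀ c ∈ l, Γ.acc c
    · rw [if_pos h', if_pos (this.1 h')]
    · rw [if_neg h', if_neg fun h => h' (this.2 h)]
  | succ k ih =>
    simp only [outer]
    exact Finset.sum_congr rfl fun u _ => by rw [inner_perm (fun _ _ h => ih h) u h]

end Growth

/-! ### Growing structures simulated by a counter automaton -/

section GrowthAutomaton

variable {G U S T C : Type} {Z : ℕ}

/-- The states of the automaton: a global parameter, the bank of the unprocessed elements, and
possibly the type and state of a new element. -/
abbrev GrowState (G U S : Type) : Type := G × Bool × Option (U × S)

/-- The counters of the automaton: the number of elements still to come, and for each bank and cell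
the number of elements. -/
abbrev GrowCounter (C : Type) : Type := Option (Bool × C)

/-- The transition that accepts. -/
def acceptRule (Γ : Growth U S T C Z) (ε : Bool) : CRule (GrowState G U S) (GrowCounter C) Z where
  zero
    | none => True
    | some (b, c) => b = ε ∧ ¬ Γ.acc c
  dec := 0
  inc := 0
  tgt := none
  wt := some []

open Classical in
/-- The transition that begins a new element. -/
noncomputable def newRule (Γ : Growth U S T C Z) (g : G) (ε : Bool) (u : U) :
    CRule (GrowState G U S) (GrowCounter C) Z where
  zero _ := False
  dec := Pi.single none 1
  inc := 0
  tgt := some (g, ε, some (u, Γ.init u))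
  wt := Γ.wtNew u

open Classical in
/-- The transition that completes a new element. -/
noncomputable def finishRule (Γ : Growth U S T C Z) (g : G) (ε : Bool) (u : U) (s : S) :
    CRule (GrowState G U S) (GrowCounter C) Z where
  zero
    | none => False
    | some (b, _) => b = ε
  dec := 0
  inc := Pi.single (some (!ε, Γ.fin u s)) 1
  tgt := some (g, !ε, none)
  wt := some []

open Classical in
/-- The transition that lets the new element interact with an element in the first nonempty
cell. -/
noncomputable def pairRule [AddCommMonoid S] [Fintype C] (Γ : Growth U S T C Z) (g : G) (ε : Bool)
    (u : U) (s : S) (c : C) (t : T) : CRule (GrowState G U S) (GrowCounter C) Z where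
  zero
    | none => False
    | some (b, c') => b = ε ∧ Fintype.equivFin C c' < Fintype.equivFin C c
  dec := Pi.single (some (ε, c)) 1
  inc := Pi.single (some (!ε, Γ.move c u t)) 1
  tgt := some (g, ε, some (u, s + Γ.eff c u t))
  wt := Γ.wtPair c u t

/-- The automaton of a family of growing structures. -/
noncomputable def growRules [AddCommMonoid S] [Fintype U] [Fintype C] [Fintype T]
    (Γ : G → Growth U S T C Z) :
    GrowState G U S → List (CRule (GrowState G U S) (GrowCounter C) Z)
  | (g, ε, none) => acceptRule (Γ g) ε ::
      (Finset.univ : Finset U).toList.map fun u => newRule (Γ g) g ε u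
  | (g, ε, some (u, s)) => finishRule (Γ g) g ε u s ::
      (Finset.univ : Finset (C × T)).toList.map fun x => pairRule (Γ g) g ε u s x.1 x.2

open Classical in
/-- The counters for `k` elements to come, unprocessed cells `l` and processed cells `r`. -/
noncomputable def growCount (ε : Bool) (k : ℕ) (l r : List C) : GrowCounter C → ℕ
  | none => k
  | some (b, c) => if b = ε then l.count c else r.count c

theorem growCount_le (ε : Bool) (k : ℕ) (l r : List C) (i : GrowCounter C) :
    growCount ε k l r i ≤ k + l.length + r.length := by
  classical
  rcases i with - | ⟨b, c⟩
  · simp [growCount]; omega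
  · have h1 := List.count_le_length (a := c) (l := l)
    have h2 := List.count_le_length (a := c) (l := r)
    simp only [growCount]
    split_ifs <;> omega

variable [AddCommMonoid S] [Fintype U] [Fintype C] [Fintype T] {K : Type} [Field K]
  (Γ : G → Growth U S T C Z) (inp : ℕ → K)

theorem finishRule_next (g : G) (ε : Bool) (u : U) (s : S) (k : ℕ) (r : List C) :
    (finishRule (Γ g) g ε u s).next (growCount ε k [] r) =
      growCount (!ε) k ((Γ g).fin u s :: r) [] := by
  classical
  funext i
  rcases i with - | ⟨b, c⟩
  · simp [CRule.next, finishRule, growCount]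
  · by_cases hb : b = ε
    · subst hb
      simp [CRule.next, finishRule, growCount]
    · have hb' : b = !ε := by cases b <;> cases ε <;> simp_all
      subst hb'
      by_cases hc : c = (Γ g).fin u s
      · simp [CRule.next, finishRule, growCount, hc]
      · have hc' : (Γ g).fin u s ≠ c := fun h => hc h.symm
        simp [CRule.next, finishRule, growCount, hc, hc']

open Classical in
theorem pairRule_next (g : G) (ε : Bool) (u : U) (s : S) (c : C) (t : T) (k : ℕ) (l r : List C) :
    (pairRule (Γ g) g ε u s c t).next (growCount ε k l r) =
      growCount ε k (l.erase c) ((Γ g).move c u t :: r) := by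
  funext i
  rcases i with - | ⟨b, d⟩
  · simp [CRule.next, pairRule, growCount]
  · by_cases hb : b = ε
    · subst hb
      by_cases hd : d = c
      · subst hd
        simp [CRule.next, pairRule, growCount]
      · simp [CRule.next, pairRule, growCount, hd, List.count_erase_of_ne]
    · have hb' : b = !ε := by cases b <;> cases ε <;> simp_all
      subst hb'
      by_cases hc : d = (Γ g).move c u t
      · simp [CRule.next, pairRule, growCount, hc]
      · have hc' : (Γ g).move c u t ≠ d := fun h => hc h.symm
        simp [CRule.next, pairRule, growCount, hc, hc']

/-- The zero tests force the first nonempty cell, so just one order of processing is run rather than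
all of them; `Growth.inner_perm` brings the list into this order. Fuel: one unit per unprocessed
element, one to finish, the rest for `hk`. -/
theorem runVal_inner {n R : ℕ} (hR : n < R) (g : G) (k : ℕ)
    (hk : ∀ (f : ℕ) (ε : Bool) (l : List C), k * (n + 3) + 1 ≤ f → k + l.length ≤ n →
      runVal (growRules Γ) R inp f (g, ε, none) (growCount ε k l []) = (Γ g).outer inp k l)
    (f : ℕ) (ε : Bool) (u : U) (s : S) (l r : List C) (hf : k * (n + 3) + 2 + l.length ≤ f)
    (hl : k + l.length + r.length + 1 ≤ n) :
    runVal (growRules Γ) R inp f (g, ε, some (u, s)) (growCount ε k l r) =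
      (Γ g).inner inp ((Γ g).outer inp k) u l r s := by
  classical
  induction hlen : l.length generalizing f s l r with
  | zero =>
    obtain rfl := List.length_eq_zero_iff.1 hlen
    obtain ⟨f, rfl⟩ : ∃ f', f = f' + 1 := ⟨f - 1, by omega⟩
    have hE : (finishRule (Γ g) g ε u s).Enabled R (growCount ε k [] r) := by
      refine ⟨?_, fun i => Nat.zero_le _, fun i => ?_⟩
      · rintro (- | ⟨b, c⟩) h
        · exact h.elim
        · have h : b = ε := h
          simp [growCount, h]
      · rw [finishRule_next]
        refine (growCount_le _ _ _ _ i).trans_lt ?_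
        simp only [List.length_cons, List.length_nil] at *
        omega
    have hz : ∀ x : C × T, ¬ (pairRule (Γ g) g ε u s x.1 x.2).Enabled R (growCount ε k [] r) := by
      intro x h
      have := h.2.1 (some (ε, x.1))
      simp [pairRule, growCount] at this
    simp only [runVal, growRules, List.map_cons, List.sum_cons, List.map_map, Function.comp_def,
      if_pos hE, if_neg (hz _)]
    rw [finishRule_next]
    simp only [finishRule, Wt.val, Growth.inner, List.length_nil] at *
    rw [hk f (!ε) _ (by omega) (by simp; omega)]
    simp
  | succ len ih =>
    obtain ⟨f, rfl⟩ : ∃ f', f = f' + 1 := ⟨f - 1, by omega⟩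
    obtain ⟨c, hc, hmin⟩ : ∃ c ∈ l, ∀ d ∈ l, Fintype.equivFin C c ≤ Fintype.equivFin C d := by
      have hne : l.toFinset.Nonempty := by
        rw [List.toFinset_nonempty_iff]
        rintro rfl
        simp at hlen
      obtain ⟨c, hc, h⟩ := l.toFinset.exists_min_image (Fintype.equivFin C) hne
      exact ⟨c, List.mem_toFinset.1 hc, fun d hd => h d (List.mem_toFinset.2 hd)⟩
    have hz : ¬ (finishRule (Γ g) g ε u s).Enabled R (growCount ε k l r) := by
      intro h
      have h1 : growCount ε k l r (some (ε, c)) = 0 := h.1 (some (ε, c)) rfl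
      simp only [growCount, if_true, List.count_eq_zero] at h1
      exact h1 hc
    have herase : (l.erase c).length = len := by
      rw [List.length_erase_of_mem hc]; omega
    have hE : ∀ t, (pairRule (Γ g) g ε u s c t).Enabled R (growCount ε k l r) := by
      intro t
      refine ⟨?_, fun i => ?_, fun i => ?_⟩
      · rintro (- | ⟨b, d⟩) h
        · exact h.elim
        · have h : b = ε ∧ Fintype.equivFin C d < Fintype.equivFin C c := h
          simp only [growCount, h.1, if_true, List.count_eq_zero]
          exact fun hd => absurd (hmin d hd) (not_le.2 h.2)
      · by_cases hi : i = some (ε, c)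
        · subst hi
          simpa [pairRule, growCount] using hc
        · simp [pairRule, hi]
      · rw [pairRule_next]
        refine (growCount_le _ _ _ _ i).trans_lt ?_
        simp only [List.length_cons]
        omega
    -- Taking a later cell fails at the zero test for `c`; taking an empty one fails at the
    -- decrement.
    have hne : ∀ d t, d ≠ c → ¬ (pairRule (Γ g) g ε u s d t).Enabled R (growCount ε k l r) := by
      intro d t hd h
      have h1 := h.2.1 (some (ε, d))
      simp only [pairRule, Pi.single_eq_same, growCount, if_true] at h1
      have hdl : d ∈ l := List.count_pos_iff.1 h1
      have hlt : Fintype.equivFin C c < Fintype.equivFin C d :=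
        lt_of_le_of_ne (hmin d hdl) fun e => hd ((Fintype.equivFin C).injective e).symm
      have h2 : growCount ε k l r (some (ε, c)) = 0 := h.1 (some (ε, c)) ⟨rfl, hlt⟩
      simp only [growCount, if_true, List.count_eq_zero] at h2
      exact h2 hc
    have hperm := List.perm_cons_erase hc
    rw [Growth.inner_perm (fun _ _ h => Growth.outer_perm k h) u hperm]
    simp only [runVal, growRules, List.map_cons, List.sum_cons, List.map_map, Function.comp_def,
      if_neg hz, zero_add]
    rw [Finset.sum_map_toList, Fintype.sum_prod_type, Finset.sum_eq_single c]
    · simp only [if_pos (hE _), pairRule_next, Growth.inner]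
      refine Finset.sum_congr rfl fun t _ => ?_
      simp only [pairRule]
      rw [ih f _ (l.erase c) _ (by omega) (by simp only [List.length_cons]; omega) herase]
    · intro d _ hd
      exact Finset.sum_eq_zero fun t _ => if_neg (hne d t hd)
    · simp

/-- A new element needs one step to begin, at most `n` interactions and one step to finish, which `n
+ 3` covers. The additional unit is for acceptance. Finishing swaps the banks, so `ε` is arbitrary.
-/
theorem runVal_outer {n R : ℕ} (hR : n < R) (g : G) (k f : ℕ) (ε : Bool) (l : List C)
    (hf : k * (n + 3) + 1 ≤ f) (hl : k + l.length ≤ n) :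
    runVal (growRules Γ) R inp f (g, ε, none) (growCount ε k l []) = (Γ g).outer inp k l := by
  classical
  induction k generalizing f ε l with
  | zero =>
    obtain ⟨f, rfl⟩ : ∃ f', f = f' + 1 := ⟨f - 1, by omega⟩
    have hz : ∀ u, ¬ (newRule (Γ g) g ε u).Enabled R (growCount ε 0 l []) := by
      intro u h
      have := h.2.1 none
      simp [newRule, growCount] at this
    have hE : (acceptRule (G := G) (Γ g) ε).Enabled R (growCount ε 0 l []) ↔
        ∀ c ∈ l, (Γ g).acc c := by
      constructor
      · intro h c hc
        by_contra hacc
        have h1 : growCount ε 0 l [] (some (ε, c)) = 0 := h.1 (some (ε, c)) ⟨rfl, hacc⟩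
        simp only [growCount, if_true, List.count_eq_zero] at h1
        exact h1 hc
      · refine fun h => ⟨?_, fun i => Nat.zero_le _, fun i => ?_⟩
        · rintro (- | ⟨b, c⟩) h1
          · rfl
          · have h1 : b = ε ∧ ¬ (Γ g).acc c := h1
            simp only [growCount, h1.1, if_true, List.count_eq_zero]
            exact fun hc => h1.2 (h c hc)
        · have h1 := growCount_le ε 0 l [] i
          simp only [CRule.next, acceptRule, Pi.zero_apply, List.length_nil] at *
          omega
    simp only [runVal, growRules, List.map_cons, List.sum_cons, List.map_map, Function.comp_def,
      if_neg (hz _), hE, Growth.outer]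
    simp [acceptRule, Wt.val]
  | succ k ih =>
    obtain ⟨f, rfl⟩ : ∃ f', f = f' + 1 := ⟨f - 1, by omega⟩
    have hz : ¬ (acceptRule (G := G) (Γ g) ε).Enabled R (growCount ε (k + 1) l []) := by
      intro h
      have h1 : growCount ε (k + 1) l [] none = 0 := h.1 none trivial
      simp [growCount] at h1
    have hnext : ∀ u, (newRule (Γ g) g ε u).next (growCount ε (k + 1) l []) =
        growCount ε k l [] := by
      intro u
      funext i
      rcases i with - | ⟨b, c⟩
      · simp [CRule.next, newRule, growCount]
      · simp [CRule.next, newRule, growCount]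
    have hE : ∀ u, (newRule (Γ g) g ε u).Enabled R (growCount ε (k + 1) l []) := by
      refine fun u => ⟨fun i h => h.elim, fun i => ?_, fun i => ?_⟩
      · rcases i with - | ⟨b, c⟩
        · simp [newRule, growCount]
        · simp [newRule]
      · rw [hnext]
        refine (growCount_le _ _ _ _ i).trans_lt ?_
        simp only [List.length_nil]
        omega
    simp only [runVal, growRules, List.map_cons, List.sum_cons, List.map_map, Function.comp_def,
      if_pos (hE _), if_neg hz, hnext, Growth.outer, zero_add]
    rw [Finset.sum_map_toList]
    refine Finset.sum_congr rfl fun u _ => ?_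
    simp only [newRule]
    rw [runVal_inner Γ inp hR g k (fun f ε l => ih f ε l) f ε u _ l [] ?_ ?_]
    · rw [Nat.add_mul] at hf
      omega
    · simp only [List.length_nil]; omega

end GrowthAutomaton

/-! ### Growth as a sum over explicit data -/

/-- The data of a structure with `n` elements: each element has a type, and a table for each
earlier element. -/
abbrev GrowData (U T : Type) (n : ℕ) : Type := ∀ c : Fin n, U × (Fin c → T)

namespace Growth

variable {U S T C : Type} {Z : ℕ} [Fintype U] [Fintype T] [AddCommMonoid S]
  {K : Type} [Field K] (Γ : Growth U S T C Z) (inp : ℕ → K)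

/-- The data without the last element. -/
def _root_.GrowData.init {U T : Type} {n : ℕ} (D : GrowData U T (n + 1)) : GrowData U T n :=
  fun c => D c.castSucc

/-- The type of the last element. -/
def _root_.GrowData.lastType {U T : Type} {n : ℕ} (D : GrowData U T (n + 1)) : U :=
  (D (Fin.last n)).1

/-- The tables of the last element. -/
def _root_.GrowData.lastRow {U T : Type} {n : ℕ} (D : GrowData U T (n + 1)) : Fin n → T :=
  (D (Fin.last n)).2

/-- The cells of the elements. -/
def cells : ∀ n, GrowData U T n → Fin n → C
  | 0, _ => Fin.elim0
  | n + 1, D => Fin.snoc (α := fun _ => C)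
      (fun a => Γ.move (cells n D.init a) D.lastType (D.lastRow a))
      (Γ.fin D.lastType (Γ.init D.lastType +
        ∑ a, Γ.eff (cells n D.init a) D.lastType (D.lastRow a)))

/-- The weight of the data. -/
def dataVal : ∀ n, GrowData U T n → K
  | 0, _ => 1
  | n + 1, D => dataVal n D.init * ((Γ.wtNew D.lastType).val inp *
      ∏ a, (Γ.wtPair (Γ.cells n D.init a) D.lastType (D.lastRow a)).val inp)

variable {Γ inp}

/-- The successive choices become a single sum over rows of tables. Processed cells pile up in
reverse order, which the invariance of `F` compensates. -/
theorem inner_ofFn {F : List C → K} (hF : ∀ l l', l.Perm l' → F l = F l') (u : U) {n : ℕ}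
    (x : Fin n → C) (r : List C) (s : S) :
    Γ.inner inp F u (List.ofFn x) r s = ∑ t : Fin n → T,
      (∏ a, (Γ.wtPair (x a) u (t a)).val inp) *
        F (Γ.fin u (s + ∑ a, Γ.eff (x a) u (t a)) ::
          (List.ofFn (fun a => Γ.move (x a) u (t a)) ++ r)) := by
  induction n generalizing r s with
  | zero => simp [inner]
  | succ n ih =>
    rw [List.ofFn_succ, inner, ← (Fin.consEquiv fun _ => T).sum_comp, Fintype.sum_prod_type]
    refine Finset.sum_congr rfl fun t _ => ?_
    rw [ih, Finset.mul_sum]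
    refine Finset.sum_congr rfl fun t' _ => ?_
    rw [Fin.prod_univ_succ, Fin.sum_univ_succ, List.ofFn_succ, ← mul_assoc]
    simp only [Fin.consEquiv_apply, Fin.cons_zero, Fin.cons_succ, add_assoc]
    congr 1
    refine hF _ _ (List.Perm.cons _ ?_)
    rw [List.cons_append]
    exact List.perm_middle

theorem sum_growData {A : Type} [AddCommMonoid A] (n : ℕ) (f : GrowData U T (n + 1) → A) :
    ∑ D, f D = ∑ D' : GrowData U T n, ∑ u : U, ∑ t : Fin n → T,
      f (Fin.snoc (α := fun c : Fin (n + 1) => U × (Fin c → T)) D' (u, t)) := by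
  rw [← (Fin.snocEquiv fun c : Fin (n + 1) => U × (Fin c → T)).sum_comp, Fintype.sum_prod_type,
    Finset.sum_comm]
  refine Finset.sum_congr rfl fun D' _ => ?_
  exact Fintype.sum_prod_type _

/-- Induction on `j` with `k` arbitrary: the last of the `j + 1` elements is the first of the `k +
1` elements still to come after `j`, so one step of `outer` is unfolded. -/
theorem outer_eq_sum (k j : ℕ) : Γ.outer inp (k + j) [] =
    ∑ D : GrowData U T j, Γ.dataVal inp j D * Γ.outer inp k (List.ofFn (Γ.cells j D)) := by
  induction j generalizing k with
  | zero => simp [dataVal]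
  | succ j ih =>
    rw [show k + (j + 1) = k + 1 + j by omega, ih, sum_growData]
    refine Finset.sum_congr rfl fun D _ => ?_
    rw [outer, Finset.mul_sum]
    refine Finset.sum_congr rfl fun u _ => ?_
    rw [inner_ofFn (fun _ _ h => outer_perm k h), Finset.mul_sum, Finset.mul_sum]
    refine Finset.sum_congr rfl fun t _ => ?_
    set D' : GrowData U T (j + 1) :=
      Fin.snoc (α := fun c : Fin (j + 1) => U × (Fin c → T)) D (u, t) with hD'
    have h1 : D'.init = D := by
      funext c
      simp [hD', GrowData.init]
    have h2 : D'.lastType = u := by simp [hD', GrowData.lastType]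
    have h3 : D'.lastRow = t := by simp [hD', GrowData.lastRow]
    rw [dataVal, h1, h2, h3, mul_assoc, mul_assoc]
    congr 3
    refine outer_perm k ?_
    rw [List.ofFn_succ', List.concat_eq_append, List.append_nil]
    simp only [cells, Fin.snoc_castSucc, Fin.snoc_last, h1, h2, h3]
    exact (List.perm_append_singleton _ _).symm

open Classical in
theorem outer_nil (n : ℕ) : Γ.outer inp n [] =
    ∑ D : GrowData U T n, Γ.dataVal inp n D * if ∀ a, Γ.acc (Γ.cells n D a) then 1 else 0 := by
  have := outer_eq_sum (Γ := Γ) (inp := inp) 0 n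
  rw [zero_add] at this
  rw [this]
  refine Finset.sum_congr rfl fun D _ => ?_
  congr 1
  exact if_congr (by simp [List.mem_ofFn]) rfl rfl

end Growth

/-! ## Local evaluation of formulas

Quantified subformulas are replaced by unary predicates, whose truth values are called bits. -/

namespace C2Formula

variable {P : Type} {ar : P → ℕ}

/-- The quantified subformulas. -/
def quants : C2Formula ar → List (C2Formula ar)
  | .atom _ _ => []
  | .equal _ _ => []
  | .neg φ => φ.quants
  | .and φ χ => φ.quants ++ χ.quants
  | .or φ χ => φ.quants ++ χ.quants
  | .all x φ => .all x φ :: φ.quants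
  | .ex x φ => .ex x φ :: φ.quants
  | .count c k x φ => .count c k x φ :: φ.quants

/-- Evaluation in terms of the truth values `A` of the atoms, the truth value `E` of the equality
of the two variables, and the bits `β` of the two variables. -/
def ev (A : (p : P) → (Fin (ar p) → Fin 2) → Prop) (E : Prop) (β : Fin 2 → C2Formula ar → Prop) :
    C2Formula ar → Prop
  | .atom p t => A p t
  | .equal x y => x = y ∨ E
  | .neg φ => ¬ φ.ev A E β
  | .and φ χ => φ.ev A E β ∧ χ.ev A E β
  | .or φ χ => φ.ev A E β ∨ χ.ev A E β
  | .all x φ => β (1 - x) (.all x φ)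
  | .ex x φ => β (1 - x) (.ex x φ)
  | .count c k x φ => β (1 - x) (.count c k x φ)

/-- The variable bound by the outermost quantifier. -/
def qvar : C2Formula ar → Fin 2
  | .all x _ => x
  | .ex x _ => x
  | .count _ _ x _ => x
  | _ => 0

/-- The property whose instances the outermost quantifier counts. -/
def qev (A : (p : P) → (Fin (ar p) → Fin 2) → Prop) (E : Prop) (β : Fin 2 → C2Formula ar → Prop) :
    C2Formula ar → Prop
  | .all _ φ => ¬ φ.ev A E β
  | .ex _ φ => φ.ev A E β
  | .count _ _ _ φ => φ.ev A E β
  | _ => False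

/-- The condition that the outermost quantifier imposes on the number of instances. -/
def qcond : C2Formula ar → ℕ → Prop
  | .all _ _, a => a = 0
  | .ex _ _, a => 1 ≤ a
  | .count c k _ _, a => c.Holds a k
  | _, _ => False

/-- A number above which all counts are equivalent. -/
def rank : C2Formula ar → ℕ
  | .atom _ _ => 1
  | .equal _ _ => 1
  | .neg φ => φ.rank
  | .and φ χ => φ.rank + χ.rank
  | .or φ χ => φ.rank + χ.rank
  | .all _ φ => φ.rank + 1
  | .ex _ φ => φ.rank + 1
  | .count _ k _ φ => φ.rank + (k + 1)

theorem rank_le_of_mem_quants {θ : C2Formula ar} (φ : C2Formula ar) (h : θ ∈ φ.quants) :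
    θ.rank ≤ φ.rank := by
  induction φ with
  | atom p t => simp [quants] at h
  | equal x y => simp [quants] at h
  | neg φ ih => exact ih h
  | and φ χ ih ih' =>
    simp only [quants, List.mem_append] at h
    simp only [rank]
    rcases h with h | h
    · have := ih h; omega
    · have := ih' h; omega
  | or φ χ ih ih' =>
    simp only [quants, List.mem_append] at h
    simp only [rank]
    rcases h with h | h
    · have := ih h; omega
    · have := ih' h; omega
  | all x φ ih =>
    simp only [quants, List.mem_cons] at h
    rcases h with rfl | h
    · exact le_rfl
    · have := ih h
      simp only [rank]
      omega
  | ex x φ ih =>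
    simp only [quants, List.mem_cons] at h
    rcases h with rfl | h
    · exact le_rfl
    · have := ih h
      simp only [rank]
      omega
  | count c k x φ ih =>
    simp only [quants, List.mem_cons] at h
    rcases h with rfl | h
    · exact le_rfl
    · have := ih h
      simp only [rank]
      omega

/-- Consequently finitely many capped counts per element decide all quantifiers. -/
theorem qcond_min (θ : C2Formula ar) {K : ℕ} (hK : θ.rank ≤ K) (a : ℕ) :
    θ.qcond (min a K) ↔ θ.qcond a := by
  cases θ with
  | all x φ => simp only [qcond, rank] at *; omega
  | ex x φ => simp only [qcond, rank] at *; omega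
  | count c k x φ =>
    cases c <;> simp only [qcond, Cmp.Holds, rank] at * <;> omega
  | _ => rfl

variable {n : ℕ}

/-- The truth values of the atoms under an assignment. -/
def atomsAt (ω : World ar n) (v : Fin 2 → Fin n) (p : P) (t : Fin (ar p) → Fin 2) : Prop :=
  (⟨p, fun i => v (t i)⟩ : GroundAtom ar n) ∈ ω

/-- Whether an element is an instance for the outermost quantifier of `θ`, under an assignment. -/
def qevAt (ω : World ar n) (bits : Fin n → C2Formula ar → Prop) (θ : C2Formula ar)
    (v : Fin 2 → Fin n) : Prop :=
  θ.qev (atomsAt ω v) (v 0 = v 1) fun j => bits (v j)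

/-- The bits of `θ` are consistent with the counts they determine. -/
def Consistent (ω : World ar n) (bits : Fin n → C2Formula ar → Prop) (θ : C2Formula ar) : Prop :=
  ∀ a, bits a θ ↔
    θ.qcond {d : Fin n | qevAt ω bits θ (Function.update (fun _ => a) θ.qvar d)}.ncard

/-- The value of the bound variable is overwritten, so with two variables only that of `1 - x`
survives. This is what makes a quantified subformula a unary predicate. -/
theorem update_eq_update_const (v : Fin 2 → Fin n) (x : Fin 2) (d : Fin n) :
    Function.update (fun _ => v (1 - x)) x d = Function.update v x d := by
  funext j
  fin_cases x <;> fin_cases j <;> simp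

theorem ev_iff_sat (ω : World ar n) (bits : Fin n → C2Formula ar → Prop) (φ : C2Formula ar)
    (h : ∀ θ ∈ φ.quants, ∀ a, bits a θ ↔ θ.Sat ω fun _ => a) (v : Fin 2 → Fin n) :
    φ.ev (atomsAt ω v) (v 0 = v 1) (fun j => bits (v j)) ↔ φ.Sat ω v := by
  induction φ with
  | atom p t => rfl
  | equal x y =>
    simp only [ev, Sat]
    fin_cases x <;> fin_cases y <;> simp [eq_comm]
  | neg φ ih => simp only [ev, Sat, ih h]
  | and φ χ ih ih' =>
    simp only [ev, Sat, ih fun θ hθ => h θ (List.mem_append_left _ hθ),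
      ih' fun θ hθ => h θ (List.mem_append_right _ hθ)]
  | or φ χ ih ih' =>
    simp only [ev, Sat, ih fun θ hθ => h θ (List.mem_append_left _ hθ),
      ih' fun θ hθ => h θ (List.mem_append_right _ hθ)]
  | all x φ _ =>
    simp only [ev]
    rw [h _ List.mem_cons_self]
    simp only [Sat, update_eq_update_const]
  | ex x φ _ =>
    simp only [ev]
    rw [h _ List.mem_cons_self]
    simp only [Sat, update_eq_update_const]
  | count c k x φ _ =>
    simp only [ev]
    rw [h _ List.mem_cons_self]
    simp only [Sat, update_eq_update_const]

theorem qcond_all_iff (ω : World ar n) (bits : Fin n → C2Formula ar → Prop) (x : Fin 2)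
    (φ : C2Formula ar) (h : ∀ θ ∈ φ.quants, ∀ a, bits a θ ↔ θ.Sat ω fun _ => a) (a : Fin n) :
    (C2Formula.all x φ).qcond {d : Fin n | qevAt ω bits (.all x φ)
      (Function.update (fun _ => a) (C2Formula.all x φ).qvar d)}.ncard ↔
      (C2Formula.all x φ).Sat ω fun _ => a := by
  simp only [qcond, qevAt, qev, Sat, qvar, ev_iff_sat ω bits φ h]
  rw [Set.ncard_eq_zero (Set.toFinite _), Set.eq_empty_iff_forall_notMem]
  exact forall_congr' fun d => not_not

theorem qcond_ex_iff (ω : World ar n) (bits : Fin n → C2Formula ar → Prop) (x : Fin 2)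
    (φ : C2Formula ar) (h : ∀ θ ∈ φ.quants, ∀ a, bits a θ ↔ θ.Sat ω fun _ => a) (a : Fin n) :
    (C2Formula.ex x φ).qcond {d : Fin n | qevAt ω bits (.ex x φ)
      (Function.update (fun _ => a) (C2Formula.ex x φ).qvar d)}.ncard ↔
      (C2Formula.ex x φ).Sat ω fun _ => a := by
  simp only [qcond, qevAt, qev, Sat, qvar, ev_iff_sat ω bits φ h, Nat.one_le_iff_ne_zero, ne_eq]
  rw [Set.ncard_eq_zero (Set.toFinite _), ← ne_eq, ← Set.nonempty_iff_ne_empty]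
  rfl

theorem qcond_count_iff (ω : World ar n) (bits : Fin n → C2Formula ar → Prop) (c : Cmp) (k : ℕ)
    (x : Fin 2) (φ : C2Formula ar) (h : ∀ θ ∈ φ.quants, ∀ a, bits a θ ↔ θ.Sat ω fun _ => a)
    (a : Fin n) :
    (C2Formula.count c k x φ).qcond {d : Fin n | qevAt ω bits (.count c k x φ)
      (Function.update (fun _ => a) (C2Formula.count c k x φ).qvar d)}.ncard ↔
      (C2Formula.count c k x φ).Sat ω fun _ => a := by
  simp only [qcond, qevAt, qev, Sat, qvar, ev_iff_sat ω bits φ h]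

/-- Consistent bits are the truth values. -/
theorem consistent_iff (ω : World ar n) (bits : Fin n → C2Formula ar → Prop) (φ : C2Formula ar) :
    (∀ θ ∈ φ.quants, Consistent ω bits θ) ↔
      ∀ θ ∈ φ.quants, ∀ a, bits a θ ↔ θ.Sat ω fun _ => a := by
  induction φ with
  | atom p t => simp [quants]
  | equal x y => simp [quants]
  | neg φ ih => exact ih
  | and φ χ ih ih' =>
    simp only [quants, List.mem_append, or_imp, forall_and, ih, ih']
  | or φ χ ih ih' =>
    simp only [quants, List.mem_append, or_imp, forall_and, ih, ih']
  | all x φ ih =>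
    simp only [quants, List.forall_mem_cons, ih]
    -- The body refers only to bits of inner quantifiers, which are truth values by `h`. The
    -- condition on the outer bit then becomes the definition of truth.
    refine and_congr_left fun h => forall_congr' fun a => ?_
    rw [qcond_all_iff ω bits x φ h]
  | ex x φ ih =>
    simp only [quants, List.forall_mem_cons, ih]
    refine and_congr_left fun h => forall_congr' fun a => ?_
    rw [qcond_ex_iff ω bits x φ h]
  | count c k x φ ih =>
    simp only [quants, List.forall_mem_cons, ih]
    refine and_congr_left fun h => forall_congr' fun a => ?_
    rw [qcond_count_iff ω bits c k x φ h]

/-- The universal closure. -/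
def close (ψ : C2Formula ar) : C2Formula ar := .all 0 (.all 1 ψ)

/-- Makes being a model visible as a bit of every element. -/
theorem isModel_iff_close (ω : World ar n) (ψ : C2Formula ar) :
    ψ.IsModel ω ↔ ∀ a, ψ.close.Sat ω fun _ => a := by
  simp only [IsModel, close, Sat]
  constructor
  · exact fun h a d e => h _
  · intro h v
    have := h (v 0) (v 0) (v 1)
    convert this using 1
    funext j
    fin_cases j <;> simp

/-- The indices of the bits for a formula. -/
abbrev BitIdx (φ : C2Formula ar) : Type := {θ : C2Formula ar // θ ∈ φ.quants}

noncomputable instance (φ : C2Formula ar) : Fintype (BitIdx φ) := by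
  have : Finite (BitIdx φ) := (List.finite_toSet φ.quants).to_subtype
  exact Fintype.ofFinite _

/-- Bits for the subformulas of `φ`, as a predicate of all formulas. -/
def extBits (φ : C2Formula ar) (b : BitIdx φ → Bool) (θ : C2Formula ar) : Prop :=
  ∃ h : θ ∈ φ.quants, b ⟨θ, h⟩ = true

theorem extBits_iff {φ : C2Formula ar} (b : BitIdx φ → Bool) {θ : C2Formula ar}
    (h : θ ∈ φ.quants) : extBits φ b θ ↔ b ⟨θ, h⟩ = true := ⟨fun ⟨_, h⟩ => h, fun h' => ⟨h, h'⟩⟩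

theorem close_mem (ψ : C2Formula ar) : ψ.close ∈ ψ.close.quants := List.mem_cons_self

open Classical in
/-- A formula is valid in a world if and only if some bits, which are then unique, are consistent
and true for the universal closure. -/
theorem sum_bits_eq {K : Type} [Field K] (ω : World ar n) (ψ : C2Formula ar) :
    (∑ b : Fin n → BitIdx ψ.close → Bool,
      if ∀ a, (∀ θ : BitIdx ψ.close, extBits ψ.close (b a) θ ↔
        θ.1.qcond {d : Fin n | qevAt ω (fun a => extBits ψ.close (b a)) θ
          (Function.update (fun _ => a) θ.1.qvar d)}.ncard) ∧ b a ⟨ψ.close, ψ.close_mem⟩ = true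
      then (1 : K) else 0) = if ψ.IsModel ω then 1 else 0 := by
  set b₀ : Fin n → BitIdx ψ.close → Bool := fun a θ => decide (θ.1.Sat ω fun _ => a) with hb₀
  have key : ∀ b : Fin n → BitIdx ψ.close → Bool,
      (∀ a, (∀ θ : BitIdx ψ.close, extBits ψ.close (b a) θ ↔
        θ.1.qcond {d : Fin n | qevAt ω (fun a => extBits ψ.close (b a)) θ
          (Function.update (fun _ => a) θ.1.qvar d)}.ncard) ∧ b a ⟨ψ.close, ψ.close_mem⟩ = true) ↔
      b = b₀ ∧ ψ.IsModel ω := by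
    intro b
    have h1 : (∀ a, ∀ θ : BitIdx ψ.close, extBits ψ.close (b a) θ ↔
        θ.1.qcond {d : Fin n | qevAt ω (fun a => extBits ψ.close (b a)) θ
          (Function.update (fun _ => a) θ.1.qvar d)}.ncard) ↔ b = b₀ := by
      have h2 := consistent_iff ω (fun a => extBits ψ.close (b a)) ψ.close
      have h3 : (∀ a, ∀ θ : BitIdx ψ.close, extBits ψ.close (b a) θ ↔
        θ.1.qcond {d : Fin n | qevAt ω (fun a => extBits ψ.close (b a)) θ
          (Function.update (fun _ => a) θ.1.qvar d)}.ncard) ↔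
          ∀ θ ∈ ψ.close.quants, Consistent ω (fun a => extBits ψ.close (b a)) θ :=
        ⟨fun h θ hθ a => h a ⟨θ, hθ⟩, fun h a θ => h θ.1 θ.2 a⟩
      rw [h3, h2]
      constructor
      · intro h
        funext a θ
        have := h θ.1 θ.2 a
        rw [extBits_iff _ θ.2] at this
        rw [hb₀, Bool.eq_iff_iff, this]
        simp
      · rintro rfl θ hθ a
        rw [extBits_iff _ hθ, hb₀]
        simp
    rw [forall_and, h1, isModel_iff_close]
    refine and_congr_right fun h => forall_congr' fun a => ?_
    rw [h, hb₀]
    simp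
  simp only [key]
  by_cases h : ψ.IsModel ω
  · simp [h]
  · simp [h]

end C2Formula

/-! ## Decomposition of the Herbrand base -/

section Herbrand

/-- Argument tuples with at least three different entries. -/
abbrev RestArgs (k n : ℕ) : Type :=
  {t : Fin k → Fin n // k ≠ 0 ∧ ¬ ∃ c d, ∀ i, t i = c ∨ t i = d}

variable {P : Type} (ar : P → ℕ)

/-- Nullary predicates. -/
abbrev NullAt : Type := {p : P // ar p = 0}

/-- Predicates that are not nullary. -/
abbrev UnAt : Type := {p : P // ar p ≠ 0}

/-- Atoms that mention both elements of a pair; `true` stands for the larger element. -/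
abbrev BinAt : Type := {x : Σ p : P, (Fin (ar p) → Bool) // Function.Surjective x.2}

/-- Atoms by the number of elements they mention. -/
abbrev SplitAtom (n : ℕ) : Type :=
  NullAt ar ⊕ (Fin n × UnAt ar) ⊕ ((Σ c : Fin n, Fin c) × BinAt ar) ⊕ Σ p : P, RestArgs (ar p) n

variable {ar} {n : ℕ}

/-- An element below `c` as an element of the domain. -/
def below {n : ℕ} {c : Fin n} (a : Fin c) : Fin n := ⟨a, a.2.trans c.2⟩

theorem below_lt {c : Fin n} (a : Fin c) : below a < c := a.2

/-- The ground atom of an atom of the decomposition. -/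
def joinAtom : SplitAtom ar n → GroundAtom ar n
  | .inl p => ⟨p.1, fun i => (Fin.cast p.2 i).elim0⟩
  | .inr (.inl x) => ⟨x.2.1, fun _ => x.1⟩
  | .inr (.inr (.inl x)) => ⟨x.2.1.1, fun i => if x.2.1.2 i then x.1.1 else below x.1.2⟩
  | .inr (.inr (.inr r)) => ⟨r.1, r.2.1⟩

/-- The elements mentioned by an atom determine its part of the decomposition; if there are two of
them, the larger one is that marked `true`. -/
theorem joinAtom_injective : Function.Injective (joinAtom (ar := ar) (n := n)) := by
  have bin_ne : ∀ x : BinAt ar, ar x.1.1 ≠ 0 := by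
    rintro ⟨⟨p, t⟩, ht⟩ h
    obtain ⟨i, -⟩ := ht true
    exact (Fin.cast h i).elim0
  rintro (⟨p, hp⟩ | ⟨a, p, hp⟩ | ⟨⟨c, a⟩, ⟨⟨p, t⟩, ht⟩⟩ | ⟨p, t, hp, ht⟩)
    (⟨p', hp'⟩ | ⟨a', p', hp'⟩ | ⟨⟨c', a'⟩, ⟨⟨p', t'⟩, ht'⟩⟩ | ⟨p', t', hp', ht'⟩) h <;>
  simp only [joinAtom, Sigma.mk.injEq] at h <;>
  obtain ⟨rfl, h⟩ := h
  · rfl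
  · exact absurd hp hp'
  · exact absurd hp (bin_ne ⟨⟨p, t'⟩, ht'⟩)
  · exact absurd hp hp'
  · exact absurd hp' hp
  · have h : a = a' := congrFun (eq_of_heq h) ⟨0, Nat.pos_of_ne_zero hp⟩
    rw [h]
  · have h := eq_of_heq h
    obtain ⟨i, hi⟩ := ht' true
    obtain ⟨j, hj⟩ := ht' false
    have h1 := congrFun h i
    have h2 := congrFun h j
    simp only at hi hj
    simp only [hi, hj, if_true, Bool.false_eq_true, if_false] at h1 h2
    exact absurd (h2.symm.trans h1) (below_lt a').ne
  · exact absurd ⟨a, a, fun i => Or.inl (congrFun (eq_of_heq h) i).symm⟩ ht'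
  · exact absurd hp' (bin_ne ⟨⟨p, t⟩, ht⟩)
  · have h := eq_of_heq h
    obtain ⟨i, hi⟩ := ht true
    obtain ⟨j, hj⟩ := ht false
    have h1 := congrFun h i
    have h2 := congrFun h j
    simp only at hi hj
    simp only [hi, hj, if_true, Bool.false_eq_true, if_false] at h1 h2
    exact absurd (h2.trans h1.symm) (below_lt a).ne
  · have h := eq_of_heq h
    obtain ⟨i, hi⟩ := ht true
    obtain ⟨j, hj⟩ := ht false
    have h1 := congrFun h i
    have h2 := congrFun h j
    simp only at hi hj
    simp only [hi, hj, if_true, Bool.false_eq_true, if_false] at h1 h2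
    have hac := below_lt a
    have hac' := below_lt a'
    -- Otherwise `c` would be the smaller element of the second pair, and `below a`, which is
    -- smaller still, could not belong to that pair.
    have hi' : t' i = true := by
      by_contra hi'
      rw [if_neg hi'] at h1
      have e1 := congrArg Fin.val h1
      simp only [Fin.lt_def] at hac hac'
      split_ifs at h2 <;>
      · have e2 := congrArg Fin.val h2
        omega
    rw [if_pos hi'] at h1
    subst h1
    have hj' : t' j = false := by
      by_contra hj'
      rw [Bool.not_eq_false] at hj'
      rw [if_pos hj'] at h2
      exact absurd h2 hac.ne
    rw [hj'] at h2
    simp only [Bool.false_eq_true, if_false] at h2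
    have haa : a = a' := Fin.ext (by simpa [below] using h2)
    subst haa
    have htt : t = t' := by
      funext l
      have := congrFun h l
      cases h3 : t l <;> cases h4 : t' l <;> simp only [h3, h4, if_true, Bool.false_eq_true,
        if_false] at this
      · rfl
      · exact absurd this hac.ne
      · exact absurd this hac.ne'
      · rfl
    subst htt
    rfl
  · exact absurd ⟨c, below a, fun i => by
      rw [← congrFun (eq_of_heq h) i]
      cases t i <;> simp⟩ ht'
  · exact absurd hp' hp
  · exact absurd ⟨a', a', fun i => Or.inl (congrFun (eq_of_heq h) i)⟩ ht
  · exact absurd ⟨c', below a', fun i => by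
      rw [congrFun (eq_of_heq h) i]
      cases t' i <;> simp⟩ ht
  · have h := eq_of_heq h
    subst h
    rfl

theorem joinAtom_bin {p : P} {t : Fin (ar p) → Fin n} {c a : Fin n} (hac : a < c)
    (ht : ∀ i, t i = c ∨ t i = a) (hs : Function.Surjective fun i => decide (t i = c)) :
    joinAtom (.inr (.inr (.inl (⟨c, ⟨a, hac⟩⟩, ⟨⟨p, fun i => decide (t i = c)⟩, hs⟩)))) =
      (⟨p, t⟩ : GroundAtom ar n) := by
  simp only [joinAtom, Sigma.mk.injEq, heq_eq_eq, true_and]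
  funext i
  rcases ht i with h | h
  · simp [h]
  · simp [h, hac.ne, below]

theorem joinAtom_surjective : Function.Surjective (joinAtom (ar := ar) (n := n)) := by
  classical
  rintro ⟨p, t⟩
  by_cases hp : ar p = 0
  · refine ⟨.inl ⟨p, hp⟩, ?_⟩
    simp only [joinAtom, Sigma.mk.injEq, heq_eq_eq, true_and]
    funext i
    exact (Fin.cast hp i).elim0
  by_cases hc : ∃ c d, ∀ i, t i = c ∨ t i = d
  · by_cases h1 : ∃ a, ∀ i, t i = a
    · obtain ⟨a, h1⟩ := h1
      refine ⟨.inr (.inl (a, ⟨p, hp⟩)), ?_⟩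
      simp only [joinAtom, Sigma.mk.injEq, heq_eq_eq, true_and]
      funext i
      exact (h1 i).symm
    · obtain ⟨c, d, hcd⟩ := hc
      push Not at h1
      have hsurj : ∀ c d, (∀ i, t i = c ∨ t i = d) →
          Function.Surjective fun i => decide (t i = c) := by
        intro c d hcd b
        obtain ⟨i, hi⟩ := h1 c
        obtain ⟨j, hj⟩ := h1 d
        cases b
        · exact ⟨i, by simp [hi]⟩
        · exact ⟨j, by simpa using (hcd j).resolve_right hj⟩
      rcases lt_trichotomy c d with h | h | h
      · exact ⟨_, joinAtom_bin h (fun i => (hcd i).symm) (hsurj d c fun i => (hcd i).symm)⟩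
      · obtain ⟨i, hi⟩ := h1 c
        exact absurd ((hcd i).elim id fun h' => h'.trans h.symm) hi
      · exact ⟨_, joinAtom_bin h hcd (hsurj c d hcd)⟩
  · exact ⟨.inr (.inr (.inr ⟨p, t, hp, hc⟩)), rfl⟩

variable (ar n) in
/-- The decomposition of the Herbrand base. -/
noncomputable def atomEquiv : SplitAtom ar n ≃ GroundAtom ar n :=
  Equiv.ofBijective joinAtom ⟨joinAtom_injective, joinAtom_surjective⟩

theorem card_pairs (n : ℕ) : Fintype.card (Σ c : Fin n, Fin c) = n * (n - 1) / 2 := by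
  rw [Fintype.card_sigma]
  simp only [Fintype.card_fin]
  rw [Fin.sum_univ_eq_sum_range (fun i => i) n, Finset.sum_range_id]

open Classical in
/-- The number of tuples with at least three different entries. -/
theorem exists_card_restArgs (k : ℕ) : ∃ c₀ c₁ c₂ : ℕ, ∀ n,
    Fintype.card (RestArgs k n) = n ^ k - (c₀ + n * c₁ + n * (n - 1) / 2 * c₂) := by
  -- The decomposition is applied to a vocabulary with a single predicate of arity `k`, whose `n ^
  -- k` atoms are split into four parts.
  refine ⟨Fintype.card (NullAt fun _ : Unit => k), Fintype.card (UnAt fun _ : Unit => k),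
    Fintype.card (BinAt fun _ : Unit => k), fun n => ?_⟩
  have h := Fintype.card_congr (atomEquiv (fun _ : Unit => k) n)
  rw [Fintype.card_sum, Fintype.card_sum, Fintype.card_sum, Fintype.card_prod, Fintype.card_prod,
    card_pairs, Fintype.card_sigma, Fintype.card_sigma] at h
  simp only [Fintype.card_pi, Finset.univ_unique, Finset.sum_singleton, Fintype.card_fin,
    Finset.prod_const, Finset.card_univ] at h
  omega

/-! ### Worlds and their weights along the decomposition -/

section Worlds

variable {X : Type}

/-- The truth values of the atoms of the decomposition. -/
def joinBool (g : NullAt ar → Bool) (D : GrowData ((UnAt ar → Bool) × X) (BinAt ar → Bool) n)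
    (ρ : (Σ p : P, RestArgs (ar p) n) → Bool) : SplitAtom ar n → Bool
  | .inl p => g p
  | .inr (.inl x) => (D x.1).1.1 x.2
  | .inr (.inr (.inl x)) => (D x.1.1).2 x.1.2 x.2
  | .inr (.inr (.inr r)) => ρ r

variable [Fintype P]

/-- The world with given parts. -/
noncomputable def joinWorld (g : NullAt ar → Bool)
    (D : GrowData ((UnAt ar → Bool) × X) (BinAt ar → Bool) n)
    (ρ : (Σ p : P, RestArgs (ar p) n) → Bool) : World ar n :=
  Finset.univ.filter fun a => joinBool g D ρ ((atomEquiv ar n).symm a) = true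

theorem mem_joinWorld (g : NullAt ar → Bool)
    (D : GrowData ((UnAt ar → Bool) × X) (BinAt ar → Bool) n)
    (ρ : (Σ p : P, RestArgs (ar p) n) → Bool) (x : SplitAtom ar n) :
    joinAtom x ∈ joinWorld g D ρ ↔ joinBool g D ρ x = true := by
  have : (atomEquiv ar n).symm (joinAtom x) = x := (atomEquiv ar n).symm_apply_apply x
  simp [joinWorld, this]

/-- The component `X` of the types, later the bits, is not part of the world; hence the pairing of
worlds with arbitrary functions to `X`. -/
theorem joinWorld_bijective : Function.Bijective
    (fun y : (NullAt ar → Bool) × GrowData ((UnAt ar → Bool) × X) (BinAt ar → Bool) n ×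
        ((Σ p : P, RestArgs (ar p) n) → Bool) =>
      ((joinWorld y.1 y.2.1 y.2.2, fun a => (y.2.1 a).1.2) : World ar n × (Fin n → X))) := by
  classical
  constructor
  · rintro ⟨g, D, ρ⟩ ⟨g', D', ρ'⟩ h
    simp only [Prod.mk.injEq] at h
    obtain ⟨h1, h2⟩ := h
    have h3 : ∀ x, joinBool g D ρ x = joinBool g' D' ρ' x := fun x => by
      rw [Bool.eq_iff_iff, ← mem_joinWorld, ← mem_joinWorld, h1]
    have hg : g = g' := funext fun p => h3 (.inl p)
    have hρ : ρ = ρ' := funext fun r => h3 (.inr (.inr (.inr r)))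
    have hD : D = D' := funext fun c => Prod.ext
      (Prod.ext (funext fun p => h3 (.inr (.inl (c, p)))) (congrFun h2 c))
      (funext fun a => funext fun x => h3 (.inr (.inr (.inl (⟨c, a⟩, x)))))
    rw [hg, hρ, hD]
  · rintro ⟨ω, b⟩
    refine ⟨⟨fun p => decide (joinAtom (.inl p) ∈ ω), fun c =>
      ⟨⟨fun p => decide (joinAtom (.inr (.inl (c, p))) ∈ ω), b c⟩, fun a x =>
        decide (joinAtom (.inr (.inr (.inl (⟨c, a⟩, x)))) ∈ ω)⟩,
      fun r => decide (joinAtom (.inr (.inr (.inr r))) ∈ ω)⟩, ?_⟩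
    simp only [Prod.mk.injEq, and_true]
    ext a
    obtain ⟨x, rfl⟩ := joinAtom_surjective a
    rw [mem_joinWorld]
    rcases x with x | x | x | x <;> simp [joinBool]

open Classical in
theorem sum_worlds [Fintype X] {A : Type} [AddCommMonoid A]
    (F : World ar n → (Fin n → X) → A) :
    ∑ ω, ∑ b, F ω b = ∑ g : NullAt ar → Bool,
      ∑ D : GrowData ((UnAt ar → Bool) × X) (BinAt ar → Bool) n,
      ∑ ρ : (Σ p : P, RestArgs (ar p) n) → Bool, F (joinWorld g D ρ) fun a => (D a).1.2 := by
  let _ : Fintype (GrowData ((UnAt ar → Bool) × X) (BinAt ar → Bool) n ×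
    ((Σ p : P, RestArgs (ar p) n) → Bool)) := instFintypeProd _ _
  rw [← Fintype.sum_prod_type', ← (joinWorld_bijective (ar := ar) (n := n) (X := X)).sum_comp,
    Fintype.sum_prod_type]
  exact Finset.sum_congr rfl fun g _ => Fintype.sum_prod_type _

variable {K : Type} [Field K] (w wbar : P → K)

/-- The weight of a literal. -/
def litWt (p : P) (b : Bool) : K := if b then w p else wbar p

theorem prod_mul_prod_compl [DecidableEq (GroundAtom ar n)] (ω : World ar n) :
    (∏ a ∈ ω, w a.1) * ∏ a ∈ ωᶜ, wbar a.1 =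
      ∏ a : GroundAtom ar n, litWt w wbar a.1 (decide (a ∈ ω)) := by
  rw [← Finset.prod_mul_prod_compl ω]
  congr 1
  · exact Finset.prod_congr rfl fun a ha => by simp [litWt, ha]
  · exact Finset.prod_congr rfl fun a ha => by simp [litWt, Finset.mem_compl.1 ha]

open Classical in
theorem prod_litWt_joinWorld (g : NullAt ar → Bool)
    (D : GrowData ((UnAt ar → Bool) × X) (BinAt ar → Bool) n)
    (ρ : (Σ p : P, RestArgs (ar p) n) → Bool) :
    ∏ a : GroundAtom ar n, litWt w wbar a.1 (decide (a ∈ joinWorld g D ρ)) =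
      (∏ p, litWt w wbar p.1 (g p)) *
      (∏ c, ((∏ p, litWt w wbar p.1 ((D c).1.1 p)) *
        ∏ a : Fin c, ∏ x : BinAt ar, litWt w wbar x.1.1 ((D c).2 a x))) *
      ∏ r : (Σ p : P, RestArgs (ar p) n), litWt w wbar r.1 (ρ r) := by
  have h : ∀ x, decide (joinAtom x ∈ joinWorld g D ρ) = joinBool g D ρ x := fun x => by
    rw [Bool.eq_iff_iff, ← mem_joinWorld]
    simp
  have he : ∀ x, atomEquiv ar n x = joinAtom x := fun _ => rfl
  have h' : ∀ x, litWt w wbar (atomEquiv ar n x).1 (decide (atomEquiv ar n x ∈ joinWorld g D ρ)) =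
      litWt w wbar (joinAtom x).1 (joinBool g D ρ x) := fun x => by rw [he, h]
  rw [← (atomEquiv ar n).prod_comp, Finset.prod_congr rfl fun x _ => h' x]
  simp only [ Fintype.prod_sum_type, Fintype.prod_prod_type,
    Fintype.prod_sigma, joinBool, joinAtom, Finset.prod_mul_distrib, mul_assoc]

open Classical in
-- Distributivity: two variables never see these atoms, so each is chosen freely.
theorem sum_prod_rest :
    ∑ ρ : (Σ p : P, RestArgs (ar p) n) → Bool, ∏ r, litWt w wbar r.1 (ρ r) =
      ∏ p, (w p + wbar p) ^ Fintype.card (RestArgs (ar p) n) := by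
  have h := Finset.prod_univ_sum (fun _ : (Σ p : P, RestArgs (ar p) n) => (Finset.univ : Finset Bool))
    fun r b => litWt w wbar r.1 b
  rw [Fintype.piFinset_univ] at h
  rw [← h]
  simp only [Fintype.sum_bool, litWt, if_true, Bool.false_eq_true, if_false]
  rw [Fintype.prod_sigma]
  simp

end Worlds

end Herbrand

/-! ## Reduction to the standard order -/

section Permute

variable {P : Type} {ar : P → ℕ} {n : ℕ}

/-- The action of a permutation of the domain on ground atoms. -/
def permAtom (σ : Equiv.Perm (Fin n)) : GroundAtom ar n ≃ GroundAtom ar n :=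
  Equiv.sigmaCongrRight fun _ => Equiv.arrowCongr (Equiv.refl _) σ

/-- The action of a permutation of the domain on worlds. -/
def permWorld (σ : Equiv.Perm (Fin n)) : World ar n ≃ World ar n := (permAtom σ).finsetCongr

theorem mem_permWorld (σ : Equiv.Perm (Fin n)) (ω : World ar n) (p : P) (t : Fin (ar p) → Fin n) :
    (⟨p, t⟩ : GroundAtom ar n) ∈ permWorld σ ω ↔
      (⟨p, fun i => σ.symm (t i)⟩ : GroundAtom ar n) ∈ ω := by
  rw [permWorld, Equiv.finsetCongr_apply, Finset.mem_map_equiv]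
  rfl

theorem sat_permWorld (σ : Equiv.Perm (Fin n)) (ω : World ar n) (φ : C2Formula ar)
    (v : Fin 2 → Fin n) : φ.Sat (permWorld σ ω) v ↔ φ.Sat ω fun i => σ.symm (v i) := by
  have hup : ∀ (v : Fin 2 → Fin n) (x : Fin 2) (d : Fin n),
      (fun i => σ.symm (Function.update v x d i)) =
        Function.update (fun i => σ.symm (v i)) x (σ.symm d) := fun v x d => by
    funext i
    by_cases h : i = x
    · subst h; simp
    · simp [h]
  induction φ generalizing v with
  | atom p t => exact mem_permWorld σ ω p _
  | equal x y => simp [C2Formula.Sat]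
  | neg φ ih => simp only [C2Formula.Sat, ih]
  | and φ χ ih ih' => simp only [C2Formula.Sat, ih, ih']
  | or φ χ ih ih' => simp only [C2Formula.Sat, ih, ih']
  | all x φ ih =>
    simp only [C2Formula.Sat, ih, hup]
    exact σ.symm.forall_congr_right
      (q := fun d => φ.Sat ω (Function.update (fun i => σ.symm (v i)) x d))
  | ex x φ ih =>
    simp only [C2Formula.Sat, ih, hup]
    exact σ.symm.exists_congr_right
      (q := fun d => φ.Sat ω (Function.update (fun i => σ.symm (v i)) x d))
  | count c k x φ ih =>
    simp only [C2Formula.Sat, ih, hup]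
    have : {d | φ.Sat ω (Function.update (fun i => σ.symm (v i)) x (σ.symm d))} =
        σ.symm ⁻¹' {d | φ.Sat ω (Function.update (fun i => σ.symm (v i)) x d)} := rfl
    rw [this, Set.ncard_preimage_of_injective_subset_range σ.symm.injective]
    simp

theorem isModel_permWorld (σ : Equiv.Perm (Fin n)) (ω : World ar n) (φ : C2Formula ar) :
    φ.IsModel (permWorld σ ω) ↔ φ.IsModel ω := by
  simp only [C2Formula.IsModel, sat_permWorld]
  constructor
  · intro h v
    simpa using h fun i => σ (v i)
  · exact fun h v => h _

open Classical in
theorem prod_litWt_permWorld [Fintype P] {K : Type} [Field K] (w wbar : P → K)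
    (σ : Equiv.Perm (Fin n)) (ω : World ar n) :
    ∏ a : GroundAtom ar n, litWt w wbar a.1 (decide (a ∈ permWorld σ ω)) =
      ∏ a : GroundAtom ar n, litWt w wbar a.1 (decide (a ∈ ω)) := by
  rw [← (permAtom σ).prod_comp]
  refine Finset.prod_congr rfl fun a _ => ?_
  obtain ⟨p, t⟩ := a
  have : permAtom σ (⟨p, t⟩ : GroundAtom ar n) = ⟨p, fun i => σ (t i)⟩ := rfl
  rw [this]
  congr 1
  exact decide_eq_decide.2 (by rw [mem_permWorld]; simp)

end Permute

/-! ### Linear orders up to relabelling -/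

section Linear

variable {m : ℕ} {ar : Fin m → ℕ} {n : ℕ}

/-- The order of a world is the standard one. -/
structure World.Std (ω : World (PredSym.arity ar) n) : Prop where
  le : ∀ x y, World.Le ω x y ↔ x ≤ y
  pred : ∀ x y, World.Pred ω x y ↔ (x : ℕ) + 1 = y
  pred2 : ∀ x y, World.Pred2 ω x y ↔ (x : ℕ) + 2 = y

theorem comp_pair {A B : Type} (f : A → B) (x y : A) :
    (fun i => f ((![x, y] : Fin 2 → A) i)) = ![f x, f y] := by
  funext i
  fin_cases i <;> rfl

theorem le_permWorld (σ : Equiv.Perm (Fin n)) (ω : World (PredSym.arity ar) n) (x y : Fin n) :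
    World.Le (permWorld σ ω) x y ↔ World.Le ω (σ.symm x) (σ.symm y) := by
  unfold World.Le
  rw [← comp_pair σ.symm]
  exact mem_permWorld σ ω _ _

theorem pred_permWorld (σ : Equiv.Perm (Fin n)) (ω : World (PredSym.arity ar) n) (x y : Fin n) :
    World.Pred (permWorld σ ω) x y ↔ World.Pred ω (σ.symm x) (σ.symm y) := by
  unfold World.Pred
  rw [← comp_pair σ.symm]
  exact mem_permWorld σ ω _ _

theorem pred2_permWorld (σ : Equiv.Perm (Fin n)) (ω : World (PredSym.arity ar) n) (x y : Fin n) :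
    World.Pred2 (permWorld σ ω) x y ↔ World.Pred2 ω (σ.symm x) (σ.symm y) := by
  unfold World.Pred2
  rw [← comp_pair σ.symm]
  exact mem_permWorld σ ω _ _

theorem World.Linear.permWorld {ω : World (PredSym.arity ar) n} (h : World.Linear ω)
    (σ : Equiv.Perm (Fin n)) : World.Linear (permWorld σ ω) where
  refl x := by rw [le_permWorld]; exact h.refl _
  total x y := by simp only [le_permWorld]; exact h.total _ _
  antisymm x y := by
    simp only [le_permWorld]
    exact fun h1 h2 => σ.symm.injective (h.antisymm _ _ h1 h2)
  trans x y z := by simp only [le_permWorld]; exact h.trans _ _ _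
  pred_iff x y := by
    simp only [pred_permWorld, World.Lt, le_permWorld, h.pred_iff]
    rw [σ.symm.exists_congr_right (q := fun z =>
      (World.Le ω (σ.symm x) z ∧ ¬ World.Le ω z (σ.symm x)) ∧
        World.Le ω z (σ.symm y) ∧ ¬ World.Le ω (σ.symm y) z)]
  pred2_iff x y := by
    simp only [pred_permWorld, pred2_permWorld, h.pred2_iff]
    rw [σ.symm.exists_congr_right (q := fun z =>
      World.Pred ω (σ.symm x) z ∧ World.Pred ω z (σ.symm y))]

theorem lt_and_not_between_iff (x y : Fin n) :
    ((x ≤ y ∧ ¬ y ≤ x) ∧ ¬ ∃ z, (x ≤ z ∧ ¬ z ≤ x) ∧ z ≤ y ∧ ¬ y ≤ z) ↔ (x : ℕ) + 1 = y := by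
  simp only [Fin.le_def]
  constructor
  · rintro ⟨h1, h2⟩
    by_contra h
    have := y.2
    exact h2 ⟨⟨x + 1, by omega⟩, by simp only; omega⟩
  · intro h
    refine ⟨by omega, ?_⟩
    rintro ⟨z, hz⟩
    omega

theorem exists_between_iff (x y : Fin n) :
    (∃ z : Fin n, (x : ℕ) + 1 = z ∧ (z : ℕ) + 1 = y) ↔ (x : ℕ) + 2 = y := by
  constructor
  · rintro ⟨z, hz⟩
    omega
  · intro h
    have := y.2
    exact ⟨⟨x + 1, by omega⟩, rfl, by simpa [add_assoc] using h⟩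

theorem World.Std.linear {ω : World (PredSym.arity ar) n} (h : World.Std ω) : World.Linear ω where
  refl x := by rw [h.le]
  total x y := by simp only [h.le]; exact le_total x y
  antisymm x y := by simp only [h.le]; exact le_antisymm
  trans x y z := by simp only [h.le]; exact le_trans
  pred_iff x y := by
    simp only [h.pred, World.Lt, h.le]
    exact (lt_and_not_between_iff x y).symm
  pred2_iff x y := by
    simp only [h.pred2, h.pred]
    exact (exists_between_iff x y).symm

theorem World.Linear.std {ω : World (PredSym.arity ar) n} (h : World.Linear ω)
    (hle : ∀ x y, World.Le ω x y ↔ x ≤ y) : World.Std ω := by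
  have hp : ∀ x y, World.Pred ω x y ↔ (x : ℕ) + 1 = y := fun x y => by
    rw [h.pred_iff]
    simp only [World.Lt, hle]
    exact lt_and_not_between_iff x y
  refine ⟨hle, hp, fun x y => ?_⟩
  rw [h.pred2_iff]
  simp only [hp]
  exact exists_between_iff x y

/-- A copy of the domain without its standard order. -/
def Unordered (n : ℕ) : Type := Fin n

instance (n : ℕ) : Fintype (Unordered n) := inferInstanceAs (Fintype (Fin n))

/-- The permutation comes from the increasing enumeration of the domain in the order of `ω`.
`Unordered` keeps this order apart from the instance on `Fin n`. -/
theorem World.Linear.exists_std {ω : World (PredSym.arity ar) n} (h : World.Linear ω) :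
    ∃ σ, World.Std (_root_.permWorld σ ω) := by
  classical
  let lo : LinearOrder (Unordered n) :=
    { le := World.Le ω
      le_refl := h.refl
      le_trans := h.trans
      le_antisymm := h.antisymm
      le_total := h.total
      toDecidableLE := Classical.decRel _ }
  let e : Fin n ≃o Unordered n := monoEquivOfFin (Unordered n) (Fintype.card_fin n)
  let σ : Equiv.Perm (Fin n) := ⟨e, e.symm, e.left_inv, e.right_inv⟩
  refine ⟨σ.symm, (h.permWorld _).std fun x y => ?_⟩
  rw [le_permWorld]
  exact e.map_rel_iff

/-- `τ ∘ σ⁻¹` is an order automorphism of `Fin n` and hence the identity. -/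
theorem std_unique {ω : World (PredSym.arity ar) n} {σ τ : Equiv.Perm (Fin n)}
    (h : World.Std (permWorld σ ω)) (h' : World.Std (permWorld τ ω)) : σ = τ := by
  have hmono : ∀ x y, τ (σ.symm x) ≤ τ (σ.symm y) ↔ x ≤ y := fun x y => by
    rw [← h'.le, ← h.le, le_permWorld, le_permWorld]
    simp
  let e : Fin n ≃o Fin n := ⟨σ.symm.trans τ, hmono _ _⟩
  have he : e = OrderIso.refl _ := Subsingleton.elim _ _
  ext x
  have := congrArg (fun f : Fin n ≃o Fin n => f (σ x)) he
  have h2 : τ (σ.symm (σ x)) = σ x := this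
  rw [Equiv.symm_apply_apply] at h2
  rw [h2]

open Classical in
theorem wfomc_eq_factorial_mul {K : Type} [Field K] (ψ : C2Formula (PredSym.arity ar))
    (w wbar : PredSym m → K) :
    WFOMC (PredSym.arity ar) n (World.IsLinearModel ψ) w wbar = (n.factorial : K) *
      ∑ ω : World (PredSym.arity ar) n, if World.Std ω ∧ ψ.IsModel ω then
        ∏ a : GroundAtom (PredSym.arity ar) n, litWt w wbar a.1 (decide (a ∈ ω)) else 0 := by
  set W : World (PredSym.arity ar) n → K := fun ω =>
    ∏ a : GroundAtom (PredSym.arity ar) n, litWt w wbar a.1 (decide (a ∈ ω)) with hW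
  -- Exactly one permutation standardises a linear world and none standardises another world. After
  -- exchanging the sums, all permutations contribute equally.
  have h1 : ∀ ω : World (PredSym.arity ar) n, (if World.IsLinearModel ψ ω then W ω else 0) =
      ∑ σ : Equiv.Perm (Fin n), if World.Std (permWorld σ ω) ∧ ψ.IsModel (permWorld σ ω) then
        W (permWorld σ ω) else 0 := by
    intro ω
    by_cases h : World.Linear ω
    · obtain ⟨σ, hσ⟩ := h.exists_std
      rw [Finset.sum_eq_single σ]
      · simp only [World.IsLinearModel, h, hσ, isModel_permWorld, and_true, true_and, hW,
          prod_litWt_permWorld]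
      · intro τ _ hτ
        exact if_neg fun h => hτ (std_unique h.1 hσ)
      · simp
    · rw [if_neg fun h' => h h'.2]
      symm
      refine Finset.sum_eq_zero fun σ _ => if_neg fun h' => h ?_
      have := h'.1.linear.permWorld σ.symm
      convert this using 1
      ext ⟨p, t⟩
      rw [mem_permWorld, mem_permWorld]
      simp
  rw [WFOMC, Finset.sum_filter]
  calc _ = ∑ ω : World (PredSym.arity ar) n, if World.IsLinearModel ψ ω then W ω else 0 := by
        refine Finset.sum_congr rfl fun ω _ => ?_
        rw [prod_mul_prod_compl]
    _ = ∑ σ : Equiv.Perm (Fin n), ∑ ω : World (PredSym.arity ar) n,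
        if World.Std (permWorld σ ω) ∧ ψ.IsModel (permWorld σ ω) then
          W (permWorld σ ω) else 0 := by
        rw [Finset.sum_comm]
        exact Finset.sum_congr rfl fun ω _ => h1 ω
    _ = ∑ σ : Equiv.Perm (Fin n), ∑ ω : World (PredSym.arity ar) n,
        if World.Std ω ∧ ψ.IsModel ω then W ω else 0 := by
        refine Finset.sum_congr rfl fun σ _ => ?_
        exact (permWorld σ).sum_comp fun ω => if World.Std ω ∧ ψ.IsModel ω then W ω else 0
    _ = _ := by
        rw [Finset.sum_const, Finset.card_univ, Fintype.card_perm, Fintype.card_fin, nsmul_eq_mul]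

end Linear

/-! ## Capped counts -/

/-- Natural numbers up to `k`, with addition capped at `k`. -/
def Cap (k : ℕ) : Type := Fin (k + 1)

namespace Cap

variable {k : ℕ}

instance : Fintype (Cap k) := inferInstanceAs (Fintype (Fin (k + 1)))

/-- The number. -/
def val (a : Cap k) : ℕ := Fin.val a

/-- The capped number. -/
def of (k a : ℕ) : Cap k := ⟨min a k, by omega⟩

theorem val_le (a : Cap k) : a.val ≤ k := Nat.le_of_lt_succ (Fin.is_lt a)

theorem ext {a b : Cap k} (h : a.val = b.val) : a = b := Fin.ext h

instance : Add (Cap k) := ⟨fun a b => of k (a.val + b.val)⟩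

instance : Zero (Cap k) := ⟨of k 0⟩

instance : AddCommMonoid (Cap k) where
  add_assoc a b c := ext (by
    change min (min (a.val + b.val) k + c.val) k = min (a.val + min (b.val + c.val) k) k
    omega)
  zero_add a := ext (by
    have := a.val_le
    change min (min 0 k + a.val) k = a.val
    omega)
  add_zero a := ext (by
    have := a.val_le
    change min (a.val + min 0 k) k = a.val
    omega)
  add_comm a b := ext (by
    change min (a.val + b.val) k = min (b.val + a.val) k
    omega)
  nsmul := nsmulRec

/-- Capping as a homomorphism. -/
def hom (k : ℕ) : ℕ →+ Cap k where
  toFun := of k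
  map_zero' := rfl
  map_add' a b := ext (by
    change min (a + b) k = min (min a k + min b k) k
    omega)

theorem val_hom (a : ℕ) : (hom k a).val = min a k := rfl

end Cap

/-! ## The growing structure of a formula -/

section Concrete

open C2Formula

variable {P : Type} {ar : P → ℕ} (φ : C2Formula ar)

/-- The type of an element: its unary atoms and its bits. -/
abbrev ElemType : Type := (UnAt ar → Bool) × (BitIdx φ → Bool)

/-- The capped counts of an element. -/
abbrev Counts : Type := BitIdx φ → Cap φ.rank

/-- The cell of an element: its type, its counts, and the capped distance to the last element. -/
abbrev Cell : Type := ElemType φ × Counts φ × Fin 3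

variable {φ} (g : NullAt ar → Bool)

/-- The atoms when both variables denote the same element. -/
def selfAtoms (u : UnAt ar → Bool) (p : P) (_ : Fin (ar p) → Fin 2) : Prop :=
  if h : ar p = 0 then g ⟨p, h⟩ = true else u ⟨p, h⟩ = true

open Classical in
/-- The atoms when the variable `x` denotes a new element and the other one an old element. -/
def pairAtoms (uo un : UnAt ar → Bool) (τ : BinAt ar → Bool) (x : Fin 2) (p : P)
    (t : Fin (ar p) → Fin 2) : Prop :=
  if h : ar p = 0 then g ⟨p, h⟩ = true
  else if hs : Function.Surjective fun i => decide (t i = x) then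
    τ ⟨⟨p, fun i => decide (t i = x)⟩, hs⟩ = true
  else if t ⟨0, Nat.pos_of_ne_zero h⟩ = x then un ⟨p, h⟩ = true else uo ⟨p, h⟩ = true

/-- Whether an element is an instance for itself. -/
def selfEv (u : ElemType φ) (θ : BitIdx φ) : Prop :=
  θ.1.qev (selfAtoms g u.1) True fun _ => extBits φ u.2

/-- Whether, when `x` denotes a new element and the other variable an old element, there is an
instance. -/
def pairEv (uo un : ElemType φ) (τ : BinAt ar → Bool) (x : Fin 2) (θ : BitIdx φ) : Prop :=
  θ.1.qev (pairAtoms g uo.1 un.1 τ x) False fun j => if j = x then extBits φ un.2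
    else extBits φ uo.2

open Classical in
/-- One if the proposition is true, else zero. -/
noncomputable def ind (p : Prop) : ℕ := if p then 1 else 0

/-- The growing structure of a formula, with weights `wu` of types and `wp` of tables. -/
noncomputable def formGrowth (root : BitIdx φ) {Z : ℕ} (wu : (UnAt ar → Bool) → Wt Z)
    (wp : Fin 3 → (BinAt ar → Bool) → Wt Z) :
    Growth (ElemType φ) (Counts φ) (BinAt ar → Bool) (Cell φ) Z where
  init u θ := Cap.hom _ (ind (selfEv g u θ))
  fin u s := (u, s, 0)
  move c u τ := (c.1, (fun θ => c.2.1 θ + Cap.hom _ (ind (pairEv g c.1 u τ θ.1.qvar θ))),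
    ⟨min (c.2.2 + 1) 2, by omega⟩)
  eff c u τ θ := Cap.hom _ (ind (pairEv g c.1 u τ (1 - θ.1.qvar) θ))
  acc c := (∀ θ : BitIdx φ, extBits φ c.1.2 θ ↔ θ.1.qcond (c.2.1 θ).val) ∧ c.1.2 root = true
  wtNew u := wu u.1
  wtPair c _ τ := wp c.2.2 τ

variable {n : ℕ}

/-- Whether `c` is an instance for the element `a`. -/
def isInstance (D : GrowData (ElemType φ) (BinAt ar → Bool) n) (θ : BitIdx φ) (a c : Fin n) :
    Prop :=
  if h : a < c then pairEv g (D a).1 (D c).1 ((D c).2 ⟨a, h⟩) θ.1.qvar θ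
  else if h : c < a then pairEv g (D c).1 (D a).1 ((D a).2 ⟨c, h⟩) (1 - θ.1.qvar) θ
  else selfEv g (D a).1 θ

variable (root : BitIdx φ) {Z : ℕ} (wu : (UnAt ar → Bool) → Wt Z)
  (wp : Fin 3 → (BinAt ar → Bool) → Wt Z)

/-- Each pair is examined once, on arrival of its larger element: `move` credits the older element,
`eff` the newer one, and `init` accounts for an element with itself. -/
theorem formGrowth_cells (D : GrowData (ElemType φ) (BinAt ar → Bool) n) (a : Fin n) :
    (formGrowth g root wu wp).cells n D a = ((D a).1,
      (fun θ => ∑ c, Cap.hom _ (ind (isInstance g D θ a c))),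
      ⟨min (n - 1 - a) 2, by omega⟩) := by
  induction n with
  | zero => exact a.elim0
  | succ n ih =>
    have ih := ih D.init
    induction a using Fin.lastCases with
    | last =>
      have hself : ∀ θ, isInstance g D θ (Fin.last n) (Fin.last n) ↔
          selfEv g D.lastType θ := fun θ => by
        simp only [isInstance, lt_irrefl, dite_false]
        rfl
      have hold : ∀ θ (c : Fin n), isInstance g D θ (Fin.last n) c.castSucc ↔
          pairEv g (D.init c).1 D.lastType (D.lastRow c) (1 - θ.1.qvar) θ := fun θ c => by
        have h1 : ¬ Fin.last n < c.castSucc := not_lt.2 (Fin.le_last _)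
        simp only [isInstance, h1, Fin.castSucc_lt_last, dite_false, dite_true]
        rfl
      simp only [Growth.cells, Fin.snoc_last, ih, Fin.sum_univ_castSucc, hself, hold]
      simp only [formGrowth, Prod.mk.injEq]
      refine ⟨rfl, ?_, ?_⟩
      · funext θ
        rw [Pi.add_apply, Finset.sum_apply, add_comm]
      · simp
    | cast a =>
      have hnew : ∀ θ, isInstance g D θ a.castSucc (Fin.last n) ↔
          pairEv g (D.init a).1 D.lastType (D.lastRow a) θ.1.qvar θ := fun θ => by
        simp only [isInstance, Fin.castSucc_lt_last, dite_true]
        rfl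
      have hold : ∀ θ (c : Fin n), isInstance g D θ a.castSucc c.castSucc ↔
          isInstance g D.init θ a c := fun θ c => by
        simp only [isInstance, Fin.castSucc_lt_castSucc_iff]
        rfl
      simp only [Growth.cells, Fin.snoc_castSucc, ih, Fin.sum_univ_castSucc, hnew, hold]
      simp only [formGrowth, Prod.mk.injEq, Fin.mk.injEq, Fin.val_castSucc]
      refine ⟨rfl, trivial, ?_⟩
      have := a.2
      omega

/-- The weight of a pair is taken before `move`, when the cell of `a` still holds the distance to
the element before `c`; hence `c - 1 - a`. -/
theorem formGrowth_dataVal [Fintype P] {K : Type} [Field K] (inp : ℕ → K)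
    (D : GrowData (ElemType φ) (BinAt ar → Bool) n) :
    (formGrowth g root wu wp).dataVal inp n D = ∏ c : Fin n, ((wu (D c).1.1).val inp *
      ∏ a : Fin c, (wp ⟨min (c - 1 - a) 2, by omega⟩ ((D c).2 a)).val inp) := by
  induction n with
  | zero => simp [Growth.dataVal]
  | succ n ih =>
    rw [Growth.dataVal, ih, Fin.prod_univ_castSucc]
    congr 1
    simp only [formGrowth_cells]
    rfl

end Concrete

/-! ### Cells of the growing structure versus truth in the world -/

section Connect

open C2Formula

variable {P : Type} [Fintype P] {ar : P → ℕ} {φ : C2Formula ar} {n : ℕ} (g : NullAt ar → Bool)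
  (D : GrowData (ElemType φ) (BinAt ar → Bool) n) (ρ : (Σ p : P, RestArgs (ar p) n) → Bool)

theorem mem_joinWorld_null {p : P} (h : ar p = 0) (t : Fin (ar p) → Fin n) :
    (⟨p, t⟩ : GroundAtom ar n) ∈ joinWorld g D ρ ↔ g ⟨p, h⟩ = true := by
  have : (⟨p, t⟩ : GroundAtom ar n) = joinAtom (.inl ⟨p, h⟩) := by
    simp only [joinAtom, Sigma.mk.injEq, heq_eq_eq, true_and]
    funext i
    exact (Fin.cast h i).elim0
  rw [this, mem_joinWorld]
  rfl

theorem mem_joinWorld_un {p : P} (h : ar p ≠ 0) {t : Fin (ar p) → Fin n} {a : Fin n}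
    (ht : ∀ i, t i = a) :
    (⟨p, t⟩ : GroundAtom ar n) ∈ joinWorld g D ρ ↔ (D a).1.1 ⟨p, h⟩ = true := by
  have : (⟨p, t⟩ : GroundAtom ar n) = joinAtom (.inr (.inl (a, ⟨p, h⟩))) := by
    simp only [joinAtom, Sigma.mk.injEq, heq_eq_eq, true_and]
    funext i
    exact ht i
  rw [this, mem_joinWorld]
  rfl

theorem mem_joinWorld_bin {p : P} {t : Fin (ar p) → Fin n} {c : Fin n} {a : Fin c}
    {b : Fin (ar p) → Bool} (hb : Function.Surjective b)
    (ht : ∀ i, t i = if b i then c else below a) :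
    (⟨p, t⟩ : GroundAtom ar n) ∈ joinWorld g D ρ ↔ (D c).2 a ⟨⟨p, b⟩, hb⟩ = true := by
  have : (⟨p, t⟩ : GroundAtom ar n) = joinAtom (.inr (.inr (.inl (⟨c, a⟩, ⟨⟨p, b⟩, hb⟩)))) := by
    simp only [joinAtom, Sigma.mk.injEq, heq_eq_eq, true_and]
    funext i
    exact ht i
  rw [this, mem_joinWorld]
  rfl

theorem atomsAt_self {v : Fin 2 → Fin n} {a : Fin n} (hv : ∀ y, v y = a) :
    atomsAt (joinWorld g D ρ) v = selfAtoms g (D a).1.1 := by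
  funext p t
  refine propext ?_
  unfold atomsAt selfAtoms
  split_ifs with h
  · exact mem_joinWorld_null g D ρ h _
  · exact mem_joinWorld_un g D ρ h fun i => hv _

/-- A nonempty tuple of variables that does not use both is constant, so its first entry tells whose
unary atom is meant. -/
theorem atomsAt_pair {v : Fin 2 → Fin n} {c : Fin n} {a : Fin c} {x : Fin 2}
    (hv : ∀ y, v y = if y = x then c else below a) :
    atomsAt (joinWorld g D ρ) v =
      pairAtoms g (D (below a)).1.1 (D c).1.1 ((D c).2 a) x := by
  classical
  funext p t
  refine propext ?_
  unfold atomsAt pairAtoms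
  split_ifs with h hs h0
  · exact mem_joinWorld_null g D ρ h _
  · refine mem_joinWorld_bin g D ρ hs fun i => ?_
    rw [hv]
    simp
  · refine mem_joinWorld_un g D ρ h fun i => ?_
    rw [hv, if_pos]
    by_contra hi
    refine hs fun b => ?_
    cases b
    · exact ⟨i, by simpa using hi⟩
    · exact ⟨_, by simpa using h0⟩
  · refine mem_joinWorld_un g D ρ h fun i => ?_
    rw [hv, if_neg]
    intro hi
    refine hs fun b => ?_
    cases b
    · exact ⟨_, by simpa using h0⟩
    · exact ⟨i, by simpa using hi⟩

theorem qevAt_self (θ : BitIdx φ) {v : Fin 2 → Fin n} {a : Fin n} (hv : ∀ y, v y = a) :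
    qevAt (joinWorld g D ρ) (fun a => extBits φ (D a).1.2) θ v ↔ selfEv g (D a).1 θ := by
  unfold qevAt selfEv
  have hb : (fun j => extBits φ (D (v j)).1.2) = fun _ => extBits φ (D a).1.2 :=
    funext fun j => by rw [hv]
  rw [atomsAt_self g D ρ hv, hb, hv, hv]
  simp

theorem qevAt_pair (θ : BitIdx φ) {v : Fin 2 → Fin n} {c : Fin n} {a : Fin c} {x : Fin 2}
    (hv : ∀ y, v y = if y = x then c else below a) :
    qevAt (joinWorld g D ρ) (fun a => extBits φ (D a).1.2) θ v ↔
      pairEv g (D (below a)).1 (D c).1 ((D c).2 a) x θ := by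
  unfold qevAt pairEv
  have h01 : (v 0 = v 1) = False := by
    have := below_lt a
    simp only [hv, eq_iff_iff, iff_false]
    fin_cases x
    · simpa using this.ne'
    · simpa using this.ne
  rw [atomsAt_pair g D ρ hv, h01]
  have hb : (fun j => extBits φ (D (v j)).1.2) = fun j => if j = x then extBits φ (D c).1.2
      else extBits φ (D (below a)).1.2 := by
    funext j
    by_cases hj : j = x
    · rw [if_pos hj, (hv j).trans (if_pos hj)]
    · rw [if_neg hj, (hv j).trans (if_neg hj)]
  rw [hb]

/-- The bound variable denotes `c` and the other one `a`. The larger of the two is the new element,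
so `x` is `qvar` if `a < c` and `1 - qvar` if `c < a`. -/
theorem isInstance_iff (θ : BitIdx φ) (a c : Fin n) : isInstance g D θ a c ↔
    qevAt (joinWorld g D ρ) (fun a => extBits φ (D a).1.2) θ
      (Function.update (fun _ => a) θ.1.qvar c) := by
  unfold isInstance
  split_ifs with h h'
  · rw [qevAt_pair g D ρ θ (c := c) (a := ⟨a, h⟩) (x := θ.1.qvar)]
    · rfl
    · intro y
      by_cases hy : y = θ.1.qvar
      · simp [hy]
      · simp [hy, below]
  · rw [qevAt_pair g D ρ θ (c := a) (a := ⟨c, h'⟩) (x := 1 - θ.1.qvar)]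
    · rfl
    · intro y
      generalize θ.1.qvar = x
      fin_cases x <;> fin_cases y <;> simp [below]
  · have hac : c = a := le_antisymm (not_lt.1 h) (not_lt.1 h')
    subst hac
    rw [qevAt_self g D ρ θ (a := c)]
    simp

open Classical in
-- Capping is a homomorphism, so the accumulated count is the capped number of instances, and
-- `C2Formula.qcond_min` removes the cap.
theorem acc_iff (root : BitIdx φ) {Z : ℕ} (wu : (UnAt ar → Bool) → Wt Z)
    (wp : Fin 3 → (BinAt ar → Bool) → Wt Z) :
    (∀ a, (formGrowth g root wu wp).acc ((formGrowth g root wu wp).cells n D a)) ↔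
      ∀ a, (∀ θ : BitIdx φ, extBits φ (D a).1.2 θ ↔
        θ.1.qcond {d : Fin n | qevAt (joinWorld g D ρ) (fun a => extBits φ (D a).1.2) θ
          (Function.update (fun _ => a) θ.1.qvar d)}.ncard) ∧ (D a).1.2 root = true := by
  refine forall_congr' fun a => ?_
  rw [formGrowth_cells]
  refine and_congr_left fun _ => forall_congr' fun θ => iff_congr Iff.rfl ?_
  simp only
  rw [← map_sum, Cap.val_hom, qcond_min _ (rank_le_of_mem_quants φ θ.2)]
  have : ∑ c, ind (isInstance g D θ a c) = {d : Fin n | qevAt (joinWorld g D ρ)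
      (fun a => extBits φ (D a).1.2) θ (Function.update (fun _ => a) θ.1.qvar d)}.ncard := by
    simp only [isInstance_iff g D ρ]
    rw [Set.ncard_eq_toFinset_card', Set.toFinset_ofPred, Finset.card_filter]
    rfl
  rw [this]

end Connect

/-! ### The standard order as a condition on types and tables -/

section Standard

variable {m : ℕ} {ar : Fin m → ℕ}

/-- The tuple `(b, not b)` of length two. -/
def orient {k : ℕ} (b : Bool) (i : Fin k) : Bool := if (i : ℕ) = 0 then b else !b

theorem orient_surjective {k : ℕ} (hk : k = 2) (b : Bool) :
    Function.Surjective (orient (k := k) b) := by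
  subst hk
  intro c
  by_cases h : c = b
  · exact ⟨0, by simp [orient, h]⟩
  · exact ⟨1, by cases b <;> cases c <;> simp_all [orient]⟩

/-- The atom of a binary predicate for a pair in one of the two orders. -/
def orientAt (p : PredSym m) (hp : PredSym.arity ar p = 2) (b : Bool) : BinAt (PredSym.arity ar) :=
  ⟨⟨p, orient b⟩, orient_surjective hp b⟩

/-- The atom of a binary predicate for a single element. -/
def diagAt (p : PredSym m) (hp : PredSym.arity ar p = 2) : UnAt (PredSym.arity ar) :=
  ⟨p, by omega⟩

/-- The unary atoms that the standard order requires. -/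
def StdUn (u : UnAt (PredSym.arity ar) → Bool) : Prop :=
  u (diagAt .le rfl) = true ∧ u (diagAt .pred rfl) = false ∧ u (diagAt .pred2 rfl) = false

/-- The tables that the standard order requires for pairs with capped distance `d + 1`. -/
def StdBin (d : ℕ) (τ : BinAt (PredSym.arity ar) → Bool) : Prop :=
  (τ (orientAt .le rfl false) = true ∧ τ (orientAt .le rfl true) = false) ∧
  ((τ (orientAt .pred rfl false) = true ↔ d = 0) ∧ τ (orientAt .pred rfl true) = false) ∧
  ((τ (orientAt .pred2 rfl false) = true ↔ d = 1) ∧ τ (orientAt .pred2 rfl true) = false)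

variable {φ : C2Formula (PredSym.arity ar)} {n : ℕ} (g : NullAt (PredSym.arity ar) → Bool)
  (D : GrowData (ElemType φ) (BinAt (PredSym.arity ar) → Bool) n)
  (ρ : (Σ p : PredSym m, RestArgs (PredSym.arity ar p) n) → Bool)

/-- The pair of arguments of a binary predicate. -/
def pairArgs {k : ℕ} (x y : Fin n) (i : Fin k) : Fin n := if (i : ℕ) = 0 then x else y

/-- `pairArgs` stands in for `![x, y]`, since for variable `p` the arity is only propositionally
two. -/
theorem forall_pairs_iff (p : PredSym m) (hp : PredSym.arity ar p = 2) (R : Fin n → Fin n → Prop) :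
    (∀ x y, (⟨p, pairArgs x y⟩ : GroundAtom (PredSym.arity ar) n) ∈ joinWorld g D ρ ↔ R x y) ↔
      ∀ c, ((D c).1.1 (diagAt p hp) = true ↔ R c c) ∧ ∀ a : Fin c,
        ((D c).2 a (orientAt p hp false) = true ↔ R (below a) c) ∧
        ((D c).2 a (orientAt p hp true) = true ↔ R c (below a)) := by
  have h1 : ∀ c, (⟨p, pairArgs c c⟩ : GroundAtom (PredSym.arity ar) n) ∈ joinWorld g D ρ ↔
      (D c).1.1 (diagAt p hp) = true := fun c =>
    mem_joinWorld_un g D ρ _ fun i => by simp [pairArgs]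
  have h2 : ∀ (c : Fin n) (a : Fin c),
      (⟨p, pairArgs (below a) c⟩ : GroundAtom (PredSym.arity ar) n) ∈ joinWorld g D ρ ↔
      (D c).2 a (orientAt p hp false) = true := fun c a =>
    mem_joinWorld_bin g D ρ _ fun i => by
      unfold pairArgs orient
      split_ifs <;> simp_all
  have h3 : ∀ (c : Fin n) (a : Fin c),
      (⟨p, pairArgs c (below a)⟩ : GroundAtom (PredSym.arity ar) n) ∈ joinWorld g D ρ ↔
      (D c).2 a (orientAt p hp true) = true := fun c a =>
    mem_joinWorld_bin g D ρ _ fun i => by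
      unfold pairArgs orient
      split_ifs <;> simp_all
  constructor
  · intro h c
    refine ⟨by rw [← h1, h], fun a => ⟨by rw [← h2, h], by rw [← h3, h]⟩⟩
  · intro h x y
    rcases lt_trichotomy x y with hxy | rfl | hxy
    · exact (h2 y ⟨x, hxy⟩).trans ((h y).2 ⟨x, hxy⟩).1
    · exact (h1 x).trans (h x).1
    · exact (h3 x ⟨y, hxy⟩).trans ((h x).2 ⟨y, hxy⟩).2

theorem pairArgs_eq (x y : Fin n) : pairArgs (k := 2) x y = ![x, y] := by
  funext i
  fin_cases i <;> rfl

/-- Capping `c - 1 - a` at two still distinguishes the distances one and two from all others, which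
is what `Pred` and `Pred2` ask for. -/
theorem std_joinWorld_iff : World.Std (joinWorld g D ρ) ↔
    ∀ c, StdUn (D c).1.1 ∧ ∀ a : Fin c, StdBin (min (c - 1 - a) 2) ((D c).2 a) := by
  have e : World.Std (joinWorld g D ρ) ↔
      (∀ x y, World.Le (joinWorld g D ρ) x y ↔ x ≤ y) ∧
      (∀ x y, World.Pred (joinWorld g D ρ) x y ↔ (x : ℕ) + 1 = y) ∧
      (∀ x y, World.Pred2 (joinWorld g D ρ) x y ↔ (x : ℕ) + 2 = y) :=
    ⟨fun h => ⟨h.le, h.pred, h.pred2⟩, fun h => ⟨h.1, h.2.1, h.2.2⟩⟩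
  have e1 := Iff.trans (show (∀ x y, World.Le (joinWorld g D ρ) x y ↔ x ≤ y) ↔
      ∀ x y, (⟨.le, pairArgs x y⟩ : GroundAtom (PredSym.arity ar) n) ∈ joinWorld g D ρ ↔ x ≤ y from
    forall_congr' fun x => forall_congr' fun y => by rw [World.Le, ← pairArgs_eq]; rfl)
    (forall_pairs_iff g D ρ .le rfl (· ≤ ·))
  have e2 := Iff.trans (show (∀ x y, World.Pred (joinWorld g D ρ) x y ↔ (x : ℕ) + 1 = y) ↔
      ∀ x y, (⟨.pred, pairArgs x y⟩ : GroundAtom (PredSym.arity ar) n) ∈ joinWorld g D ρ ↔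
        (x : ℕ) + 1 = y from
    forall_congr' fun x => forall_congr' fun y => by rw [World.Pred, ← pairArgs_eq]; rfl)
    (forall_pairs_iff g D ρ .pred rfl (fun x y => (x : ℕ) + 1 = y))
  have e3 := Iff.trans (show (∀ x y, World.Pred2 (joinWorld g D ρ) x y ↔ (x : ℕ) + 2 = y) ↔
      ∀ x y, (⟨.pred2, pairArgs x y⟩ : GroundAtom (PredSym.arity ar) n) ∈ joinWorld g D ρ ↔
        (x : ℕ) + 2 = y from
    forall_congr' fun x => forall_congr' fun y => by rw [World.Pred2, ← pairArgs_eq]; rfl)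
    (forall_pairs_iff g D ρ .pred2 rfl (fun x y => (x : ℕ) + 2 = y))
  rw [e, e1, e2, e3, ← forall_and, ← forall_and]
  refine forall_congr' fun c => ?_
  have key : ∀ a : Fin c, (below a ≤ c ↔ True) ∧ (c ≤ below a ↔ False) ∧
      ((below a : ℕ) + 1 = c ↔ min ((c : ℕ) - 1 - a) 2 = 0) ∧ ((c : ℕ) + 1 = below a ↔ False) ∧
      ((below a : ℕ) + 2 = c ↔ min ((c : ℕ) - 1 - a) 2 = 1) ∧
      ((c : ℕ) + 2 = below a ↔ False) := by
    intro a
    have h := a.2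
    have hb : ((below a : Fin n) : ℕ) = a := rfl
    rw [Fin.le_def, Fin.le_def, hb]
    simp only [iff_true, iff_false]
    refine ⟨?_, ?_, ?_, ?_, ?_, ?_⟩ <;> omega
  simp only [StdUn, StdBin, fun a => (key a).1, fun a => (key a).2.1, fun a => (key a).2.2.1,
    fun a => (key a).2.2.2.1, fun a => (key a).2.2.2.2.1, fun a => (key a).2.2.2.2.2, le_refl,
    iff_true, iff_false, Bool.not_eq_true, show ¬ ((c : ℕ) + 1 = c) by omega,
    show ¬ ((c : ℕ) + 2 = c) by omega, forall_and]
  tauto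

end Standard

/-! ## The program -/

section Final

variable {m : ℕ} {ar : Fin m → ℕ} {K : Type} [Field K]

/-- The address of the weight of a literal. -/
def litAddr (p : PredSym m) (b : Bool) : Fin (2 * (3 + m)) :=
  ⟨if b then 2 * (PredSym.equivFin p : ℕ) else 2 * (PredSym.equivFin p : ℕ) + 1, by
    have := (PredSym.equivFin p).2
    split_ifs <;> omega⟩

theorem inputVal_litAddr (w wbar : PredSym m → K) (p : PredSym m) (b : Bool) :
    inputVal w wbar (litAddr p b) = litWt w wbar p b := by
  cases b
  · have := inputVal_neg w wbar (PredSym.equivFin p)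
    simpa [litAddr, litWt] using this
  · have := inputVal_pos w wbar (PredSym.equivFin p)
    simpa [litAddr, litWt] using this

open Classical in
/-- The product of the weights of literals if a condition holds, else zero. -/
noncomputable def litsWt {ι : Type} [Fintype ι] (f : ι → PredSym m) (c : Prop) (u : ι → Bool) :
    Wt (2 * (3 + m)) :=
  if c then some ((Finset.univ : Finset ι).toList.map fun x => litAddr (f x) (u x)) else none

open Classical in
theorem val_litsWt {ι : Type} [Fintype ι] (f : ι → PredSym m) (c : Prop) (u : ι → Bool)
    (w wbar : PredSym m → K) : (litsWt f c u).val (inputVal w wbar) =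
      if c then ∏ x, litWt w wbar (f x) (u x) else 0 := by
  unfold litsWt
  split_ifs
  · simp only [Wt.val, List.map_map]
    rw [← Finset.prod_map_toList]
    congr 1
    exact List.map_congr_left fun x _ => inputVal_litAddr w wbar _ _
  · rfl

/-- The growing structure of a sentence with the standard order. -/
noncomputable def orderGrowth (ψ : C2Formula (PredSym.arity ar))
    (g : NullAt (PredSym.arity ar) → Bool) :
    Growth (ElemType ψ.close) (Counts ψ.close) (BinAt (PredSym.arity ar) → Bool) (Cell ψ.close)
      (2 * (3 + m)) :=
  formGrowth g ⟨ψ.close, ψ.close_mem⟩ (fun u => litsWt (fun x => x.1) (StdUn u) u)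
    fun d τ => litsWt (fun x => x.1.1) (StdBin d τ) τ

variable {n : ℕ} (ψ : C2Formula (PredSym.arity ar)) (w wbar : PredSym m → K)

open Classical in
-- The order is enforced by weights instead of acceptance: a type or table that violates it has
-- weight zero and annihilates the product.
theorem dataVal_orderGrowth (g : NullAt (PredSym.arity ar) → Bool)
    (D : GrowData (ElemType ψ.close) (BinAt (PredSym.arity ar) → Bool) n)
    (ρ : (Σ p : PredSym m, RestArgs (PredSym.arity ar p) n) → Bool) :
    (orderGrowth ψ g).dataVal (inputVal w wbar) n D =
      if World.Std (joinWorld g D ρ) then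
        ∏ c, ((∏ p, litWt w wbar p.1 ((D c).1.1 p)) *
          ∏ a : Fin c, ∏ x, litWt w wbar x.1.1 ((D c).2 a x)) else 0 := by
  rw [orderGrowth, formGrowth_dataVal]
  simp only [val_litsWt]
  split_ifs with h
  · rw [std_joinWorld_iff] at h
    refine Finset.prod_congr rfl fun c _ => ?_
    rw [if_pos (h c).1]
    congr 1
    exact Finset.prod_congr rfl fun a _ => by rw [if_pos ((h c).2 a)]
  · rw [std_joinWorld_iff] at h
    push Not at h
    obtain ⟨c, hc⟩ := h
    refine Finset.prod_eq_zero (Finset.mem_univ c) ?_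
    by_cases hu : StdUn (D c).1.1
    · obtain ⟨a, ha⟩ := hc hu
      rw [Finset.prod_eq_zero (Finset.mem_univ a) (if_neg ha), mul_zero]
    · rw [if_neg hu, zero_mul]

open Classical in
theorem sum_std_models_eq :
    (∑ ω : World (PredSym.arity ar) n, if World.Std ω ∧ ψ.IsModel ω then
        ∏ a : GroundAtom (PredSym.arity ar) n, litWt w wbar a.1 (decide (a ∈ ω)) else 0) =
      (∑ g : NullAt (PredSym.arity ar) → Bool, (∏ p, litWt w wbar p.1 (g p)) *
        (orderGrowth ψ g).outer (inputVal w wbar) n []) *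
      ∏ p, (w p + wbar p) ^ Fintype.card (RestArgs (PredSym.arity ar p) n) := by
  rw [← sum_prod_rest, Finset.sum_mul]
  -- The inserted sum over bits is one for models and zero otherwise. It turns the global condition
  -- into conditions on single cells, after which worlds with bits are regrouped as data.
  trans ∑ ω : World (PredSym.arity ar) n, ∑ b : Fin n → C2Formula.BitIdx ψ.close → Bool,
    (if World.Std ω then
      ∏ a : GroundAtom (PredSym.arity ar) n, litWt w wbar a.1 (decide (a ∈ ω)) else 0) *
    (if ∀ a, (∀ θ : C2Formula.BitIdx ψ.close, C2Formula.extBits ψ.close (b a) θ ↔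
      θ.1.qcond {d | C2Formula.qevAt ω (fun a => C2Formula.extBits ψ.close (b a)) θ
        (Function.update (fun _ => a) θ.1.qvar d)}.ncard) ∧ b a ⟨ψ.close, ψ.close_mem⟩ = true
      then 1 else 0)
  · refine Finset.sum_congr rfl fun ω _ => ?_
    rw [← Finset.mul_sum, C2Formula.sum_bits_eq]
    by_cases h1 : World.Std ω <;> by_cases h2 : ψ.IsModel ω <;> simp [h1, h2]
  · rw [sum_worlds]
    refine Finset.sum_congr rfl fun g _ => ?_
    rw [Growth.outer_nil, Finset.sum_comm, Finset.mul_sum]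
    refine Finset.sum_congr rfl fun ρ _ => ?_
    rw [Finset.mul_sum, Finset.sum_mul]
    refine Finset.sum_congr rfl fun D _ => ?_
    rw [dataVal_orderGrowth ψ w wbar g D ρ, prod_litWt_joinWorld,
      if_congr (acc_iff g D ρ ⟨ψ.close, ψ.close_mem⟩ _ _).symm rfl rfl]
    by_cases h1 : World.Std (joinWorld g D ρ)
    · rw [if_pos h1, if_pos h1]
      unfold orderGrowth
      ring
    · rw [if_neg h1, if_neg h1]
      ring

open Classical in
/-- A single program computes the weighted model counts for all size models. -/
theorem exists_wfomc_prog : ∃ (A : Prog) (P : Polynomial ℕ), ∀ {K : Type} [Field K] {sz : K → ℕ}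
    {S : ℕ} (M : SizeModel sz S) (n : ℕ) (w wbar : PredSym m → K),
      (∀ p, M.Good 1 (w p)) → (∀ p, M.Good 1 (wbar p)) →
      A.Outputs sz n w wbar (WFOMC (PredSym.arity ar) n (World.IsLinearModel ψ) w wbar)
        (P.eval (n + S)) := by
  have hn : NComp fun s => s 0 := NComp.mem 0
  obtain ⟨A, P, h⟩ := exists_automaton_prog rfl (growRules (orderGrowth ψ))
    -- The fuel that `runVal_outer` requires for `n` elements to come.
    (fun n => n * (n + 3) + 1) ((hn.mul (hn.add (NComp.const 3))).add (NComp.const 1))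
    (fun n => growCount false n [] [])
    (by
      rintro (- | ⟨b, c⟩)
      · exact hn
      · simpa [growCount] using NComp.const 0)
    (fun n i => by simpa using growCount_le false n [] [] i)
    -- One start state for each choice of the nullary atoms, weighted by their literals.
    ((Finset.univ : Finset (NullAt (PredSym.arity ar) → Bool)).toList.map fun g =>
      (litsWt (fun x => x.1) True g, (g, false, none)))
    (fun p n => Fintype.card (RestArgs (PredSym.arity ar p) n))
    (fun p => by
      obtain ⟨c₀, c₁, c₂, h⟩ := exists_card_restArgs (PredSym.arity ar p)
      simp only [h]
      exact (hn.pow _).sub (((NComp.const _).add (hn.mul (NComp.const _))).add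
        (((hn.mul (hn.sub (NComp.const 1))).div (NComp.const 2)).mul (NComp.const _))))
  refine ⟨A, P, fun {K} _ {sz S} M n w wbar hw hwbar => ?_⟩
  have := h M n w wbar hw hwbar
  rw [wfomc_eq_factorial_mul]
  convert this using 1
  rw [sum_std_models_eq, List.map_map, ← mul_assoc, mul_comm ((n.factorial : ℕ) : K)]
  congr 2
  rw [← Finset.sum_map_toList]
  congr 1
  refine List.map_congr_left fun g _ => ?_
  simp only [Function.comp]
  rw [runVal_outer (orderGrowth ψ) _ (by unfold autoBase; omega) g n _ false [] le_rfl (by simp),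
    val_litsWt, if_pos trivial]

end Final

/-! ## Sizes -/

/-- Every operation on real numbers costs one unit. -/
def unitModel : SizeModel unitSize 0 where
  Good _ _ := True
  mono _ _ := trivial
  zero := trivial
  one := trivial
  add _ _ := trivial
  mul _ _ := trivial
  size_le _ := by simp [unitSize]

/-- Rational numbers whose denominators divide powers of `Δ`. -/
def bitModel (Δ μ : ℕ) (hΔ : 0 < Δ) (hμ : Δ ≤ 2 ^ μ) (h1 : 1 ≤ μ) : SizeModel bitSize (3 * μ + 2) where
  Good L q := (∃ z : ℤ, q * (Δ : ℚ) ^ L = z) ∧ |q| ≤ 2 ^ (μ * L)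
  mono {a b x} hab := by
    rintro ⟨⟨z, hz⟩, h⟩
    obtain ⟨d, rfl⟩ := Nat.exists_eq_add_of_le hab
    refine ⟨⟨z * (Δ : ℤ) ^ d, by rw [pow_add, ← mul_assoc, hz]; push_cast; rfl⟩, h.trans ?_⟩
    exact pow_le_pow_right₀ one_le_two (Nat.mul_le_mul_left _ hab)
  zero := ⟨⟨0, by simp⟩, by simp⟩
  one := ⟨⟨1, by simp⟩, by simp⟩
  add {a x y} := by
    rintro ⟨⟨z, hz⟩, h⟩ ⟨⟨z', hz'⟩, h'⟩
    refine ⟨⟨(z + z') * Δ, by rw [pow_succ, ← mul_assoc, add_mul, hz, hz']; push_cast; rfl⟩, ?_⟩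
    calc |x + y| ≤ |x| + |y| := abs_add_le _ _
      _ ≤ 2 ^ (μ * a + 1) := by rw [pow_succ]; linarith
      -- `1 ≤ μ` lets one level absorb the factor two of a sum.
      _ ≤ 2 ^ (μ * (a + 1)) := pow_le_pow_right₀ one_le_two (by rw [mul_add]; omega)
  mul {a b x y} := by
    rintro ⟨⟨z, hz⟩, h⟩ ⟨⟨z', hz'⟩, h'⟩
    refine ⟨⟨z * z', by push_cast; rw [← hz, ← hz']; ring⟩, ?_⟩
    rw [abs_mul, mul_add, pow_add]
    exact mul_le_mul h h' (abs_nonneg _) (by positivity)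
  size_le {a x} := by
    rintro ⟨⟨z, hz⟩, h⟩
    have hd : x.den ∣ Δ ^ a := by
      have hx : x * ((Δ ^ a : ℕ) : ℚ) = z := by push_cast; exact hz
      have h2 : (x.num : ℚ) * ((Δ ^ a : ℕ) : ℚ) = z * x.den := by
        rw [← hx, ← Rat.mul_den_eq_num x]; ring
      have h3 : x.num * ((Δ ^ a : ℕ) : ℤ) = z * x.den := by exact_mod_cast h2
      have h4 : (x.den : ℤ) ∣ x.num * ((Δ ^ a : ℕ) : ℤ) := ⟨z, by rw [h3, mul_comm]⟩
      have h5 : x.den ∣ x.num.natAbs * Δ ^ a := by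
        have := Int.natAbs_dvd_natAbs.2 h4
        rwa [Int.natAbs_mul, Int.natAbs_natCast, Int.natAbs_natCast] at this
      exact x.reduced.symm.dvd_of_dvd_mul_left h5
    have hden : x.den ≤ 2 ^ (μ * a) := by
      rw [pow_mul]
      exact (Nat.le_of_dvd (by positivity) hd).trans (Nat.pow_le_pow_left hμ a)
    -- The numerator is the value times the denominator, hence the doubled exponent; together with
    -- the denominator this gives the `3 * μ` of the size constant.
    have hnum : x.num.natAbs ≤ 2 ^ (μ * a + μ * a) := by
      have : (x.num.natAbs : ℚ) ≤ 2 ^ (μ * a + μ * a) := by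
        rw [Nat.cast_natAbs, Int.cast_abs, ← Rat.mul_den_eq_num x, abs_mul, pow_add, Nat.abs_cast]
        exact mul_le_mul h (by exact_mod_cast hden) (by positivity) (by positivity)
      exact_mod_cast this
    have s1 : x.den.size ≤ μ * a + 1 :=
      Nat.size_le.2 (hden.trans_lt (Nat.pow_lt_pow_right one_lt_two (Nat.lt_succ_self _)))
    have s2 : x.num.natAbs.size ≤ μ * a + μ * a + 1 :=
      Nat.size_le.2 (hnum.trans_lt (Nat.pow_lt_pow_right one_lt_two (Nat.lt_succ_self _)))
    unfold bitSize
    have : (3 * μ + 2) * (a + 1) = 3 * (μ * a) + 3 * μ + 2 * a + 2 := by ring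
    omega

theorem le_two_pow_size (a : ℕ) : a ≤ 2 ^ a.size := (Nat.lt_size_self a).le

/-- The product of all denominators serves; its bit length is controlled by the sum of theirs. -/
theorem exists_common_den {m : ℕ} (w wbar : PredSym m → ℚ) :
    ∃ Δ : ℕ, 0 < Δ ∧ Δ ≤ 2 ^ weightBits w wbar ∧ (∀ p, (w p).den ∣ Δ) ∧ ∀ p, (wbar p).den ∣ Δ := by
  refine ⟨∏ p, (w p).den * (wbar p).den, Finset.prod_pos fun p _ =>
    Nat.mul_pos (w p).den_pos (wbar p).den_pos, ?_, fun p => ?_, fun p => ?_⟩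
  · rw [weightBits, ← Finset.prod_pow_eq_pow_sum]
    refine Finset.prod_le_prod' fun p _ => ?_
    rw [pow_add]
    refine Nat.mul_le_mul ?_ ?_ <;>
    exact (le_two_pow_size _).trans (Nat.pow_le_pow_right two_pos (Nat.le_add_left _ _))
  · exact (Dvd.intro _ rfl).trans (Finset.dvd_prod_of_mem _ (Finset.mem_univ p))
  · exact (Dvd.intro_left _ rfl).trans (Finset.dvd_prod_of_mem _ (Finset.mem_univ p))

theorem bitModel_good {Δ μ : ℕ} (hΔ : 0 < Δ) (hμ : Δ ≤ 2 ^ μ) (h1 : 1 ≤ μ) {q : ℚ} (hq : q.den ∣ Δ)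
    (hs : bitSize q ≤ μ) : (bitModel Δ μ hΔ hμ h1).Good 1 q := by
  obtain ⟨k, rfl⟩ := hq
  refine ⟨⟨q.num * k, ?_⟩, ?_⟩
  · push_cast
    rw [pow_one, ← mul_assoc, Rat.mul_den_eq_num]
  · have h2 : |q| ≤ q.num.natAbs := by
      rw [Nat.cast_natAbs, Int.cast_abs, ← Rat.mul_den_eq_num q, abs_mul, Nat.abs_cast]
      have : (1 : ℚ) ≤ q.den := by exact_mod_cast q.den_pos
      exact le_mul_of_one_le_right (abs_nonneg _) this
    refine h2.trans ?_
    have : q.num.natAbs ≤ 2 ^ (μ * 1) := (le_two_pow_size _).trans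
      (Nat.pow_le_pow_right two_pos (by unfold bitSize at hs; omega))
    exact_mod_cast this

theorem bitSize_le_weightBits {m : ℕ} (w wbar : PredSym m → ℚ) (p : PredSym m) :
    bitSize (w p) + bitSize (wbar p) ≤ weightBits w wbar :=
  Finset.single_le_sum (f := fun p => bitSize (w p) + bitSize (wbar p))
    (fun _ _ => Nat.zero_le _) (Finset.mem_univ p)

theorem mainTheorem7 (m : ℕ) (ar : Fin m → ℕ) (ψ : C2Formula (PredSym.arity ar))
    (hψ : ψ.IsSentence) :
    ∃ (A : Prog) (p q : Polynomial ℕ),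
      (∀ (n : ℕ), 1 ≤ n → ∀ w wbar : PredSym m → ℝ,
        A.Outputs unitSize n w wbar
          (WFOMC (PredSym.arity ar) n (World.IsLinearModel ψ) w wbar) (p.eval n)) ∧
      (∀ (n : ℕ), 1 ≤ n → ∀ w wbar : PredSym m → ℚ,
        A.Outputs bitSize n w wbar
          (WFOMC (PredSym.arity ar) n (World.IsLinearModel ψ) w wbar)
          (q.eval (n + weightBits w wbar))) := by
  obtain ⟨A, P, h⟩ := exists_wfomc_prog ψ
  -- For `bitModel` with `μ = weightBits w wbar + 1`, positive by construction, the size constant is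
  -- `3 * μ + 2 = 3 * weightBits w wbar + 5`. For `unitModel` it is `0`.
  refine ⟨A, P, P.comp (3 * Polynomial.X + 5), fun n _ w wbar => ?_, fun n _ w wbar => ?_⟩
  · exact h unitModel n w wbar (fun _ => trivial) fun _ => trivial
  · obtain ⟨Δ, hΔ, hs, hw, hwbar⟩ := exists_common_den w wbar
    have hs' : Δ ≤ 2 ^ (weightBits w wbar + 1) :=
      hs.trans (Nat.pow_le_pow_right two_pos (Nat.le_succ _))
    have hb := bitSize_le_weightBits w wbar
    obtain ⟨t, s, ht, hr⟩ := h (bitModel Δ _ hΔ hs' (Nat.le_add_left _ _)) n w wbar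
      (fun p => bitModel_good _ _ _ (hw p) (by have := hb p; omega))
      fun p => bitModel_good _ _ _ (hwbar p) (by have := hb p; omega)
    refine ⟨t, s, ht.trans ?_, hr⟩
    rw [Polynomial.eval_comp]
    refine P.eval_mono_nat ?_
    simp
    omega
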